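/- Let $A$ be a finite-dimensional differential $\mathbb Z/2$-graded Frobenius algebra over $\mathbb R$: an associative (not necessarily unital) graded algebra with an odd derivation $d$, $d^2=0$, and a nondegenerate, even, graded-symmetric bilinear form with $\langle a,bc\rangle=\langle ab,c\rangle$ and $\langle da,b\rangle=-(-1)^a\langle a,db\rangle$. Let $(s,\pi)$ be an abstract Hodge decomposition of $A$: $s$ is odd, $\pi$ is even, $ds+sd=\mathrm{id}-\pi$, $s^2=0$, $\pi^2=\pi$, $d\pi=\pi d=0$, $\pi s=s\pi=0$, $\langle s(a),b\rangle=(-1)^a\langle a,s(b)\rangle$, $\langle\pi(a),b\rangle=\langle a,\pi(b)\rangle$. Put $\Delta=ds+sd$ and $K_t=(e^{-t\Delta}\otimes\mathrm{id})\langle-,-\rangle^{-1}\in A\otimes A$. Then $$\int_0^\infty (s\otimes\mathrm{id})K_t\,dt=(s\otimes\mathrm{id})\langle-,-\rangle^{-1},$$ and the integral converges absolutely. A stable ribbon graph $\gamma$ is a connected graph each vertex $v$ of which is decorated by a connected compact oriented surface $S_v$ with nonempty boundary, with the half-edges at $v$ embedded in $\partial S_v$; if $S_v$ has genus $\lambda$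 and $\nu$ boundary circles, it is required that $2(2\lambda+\nu-1)+|v|-2>0$. It has type $(g,n)$ if attaching a strip to the surfaces $S_v$ for every edge gives a surface of genus $g$ with $n$ boundary circles. An orientation of $\gamma$ is an ordering of its edges up to even permutations. Let $g\ge 0$, $n\ge 1$, $2g+n>2$. The compactification $\mathcal L^\circ_{g,n}$ has one orbi-cell for each isomorphism class of stable ribbon graphs of type $(g,n)$ (including the $0$-cell given by the graph with one vertex and no edge) and a $0$-cell at infinity. The compactification $\mathcal L^\infty_{g,n}$, in which edges may become infinitely long, has one orbi-cell $[0,\infty]^k$ for each isomorphism class of stable ribbon graphs of type $(g,n)$ with $k$ black edges and any number of white edges (of infinite length). The map $\mathcal L^\infty_{g,n}\to\mathcal L^\circ_{g,n}$ collapses all cells with a white edge to the point at infinity. Orbi-cellular cochains on $\mathcal L^\circ_{g,n}$ are the real functions on its oriented cells which are invariant under isomorphism and change sign with the orientation; the coboundary is dual to $\partial\gamma=\sum_{e}\gamma/e$, where $\gamma/e$ carries the orientation which, preceded by $e$, gives that of $\gamma$ (with the further term $-[\infty]$ if $\gamma$ has exactly one edge). Costello's construction assigns to a stable ribbon graph with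 ordered black edges $e_1,\dots,e_k$ and with white edges the differential form $\omega_\gamma$ on $[0,\infty)^k$ which is obtained by putting the form $\alpha=K_t+(s\otimes\mathrm{id})K_t\cdot dt$ on each black edge and the tensor $(\pi\otimes\mathrm{id})\langle-,-\rangle^{-1}$ on each white edge, and contracting at every vertex with the multilinear map which the open topological field theory of $A$ assigns to $S_v$ (Koszul sign rule; cells are oriented by $dt_k\wedge\dots\wedge dt_1$). Integrating $\omega_\gamma$ over the cells gives a cochain $\int\omega$ on $\mathcal L^\infty_{g,n}$. Kontsevich's dual construction (in the form of Chuang and Lazarev) assigns to an oriented stable ribbon graph of type $(g,n)$ the number obtained by putting the propagator $(s\otimes\mathrm{id})\langle-,-\rangle^{-1}$ on each edge and contracting at every vertex with the same open topological field theory; it assigns $0$ to the point at infinity. Suppose that $A$ is contractible, i.e. $H(A,d)=0$. Then for all such $(g,n)$ the top-degree parts of the forms $\omega_\gamma$ are integrable over the cells, and there is exactly one orbi-cellular cochain on $\mathcal L^\circ_{g,n}$ whose pull-back to $\mathcal L^\infty_{g,n}$ is $\int\omega$ (the cochain given by Costello's construction). It is a cocycle, and it coincides with the cochain of Kontsevich's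 dual construction, which is therefore also a well-defined cocycle. -/

import Mathlib

open scoped TensorProduct

noncomputable section

/-! ### Differential graded Frobenius algebras and Hodge decompositions -/

/-- The sign `(-1)^i` of a parity `i`. -/
def psign (i : ZMod 2) : ℝ := if i = 0 then 1 else -1

/-- A differential `ℤ/2`-graded Frobenius algebra structure on a real associative (not necessarily
unital) algebra `A`: a grading, an odd derivation of square zero, and a nondegenerate, even,
graded-symmetric, invariant bilinear form compatible with the differential. -/
structure DGFrobenius (A : Type*) [NonUnitalRing A] [Module ℝ A] where
  gr : ZMod 2 → Submodule ℝ A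
  internal : DirectSum.IsInternal gr
  mul_mem : ∀ i j a b, a ∈ gr i → b ∈ gr j → a * b ∈ gr (i + j)
  d : A →ₗ[ℝ] A
  d_mem : ∀ i a, a ∈ gr i → d a ∈ gr (i + 1)
  d_d : ∀ a, d (d a) = 0
  d_mul : ∀ i a b, a ∈ gr i → d (a * b) = d a * b + psign i • (a * d b)
  form : LinearMap.BilinForm ℝ A
  form_nondegenerate : form.Nondegenerate
  form_even : ∀ i j a b, a ∈ gr i → b ∈ gr j → i ≠ j → form a b = 0
  form_symm : ∀ i j a b, a ∈ gr i → b ∈ gr j → form a b = psign (i * j) * form b a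
  form_mul : ∀ a b c, form a (b * c) = form (a * b) c
  form_d : ∀ i a b, a ∈ gr i → form (d a) b = -psign i * form a (d b)

namespace DGFrobenius

variable {A : Type*} [NonUnitalRing A] [Module ℝ A] (F : DGFrobenius A)

/-- An abstract Hodge decomposition: an odd operator `s` and an even operator `p` (the projection
onto the harmonic part). -/
structure Hodge where
  s : A →ₗ[ℝ] A
  p : A →ₗ[ℝ] A
  s_mem : ∀ i a, a ∈ F.gr i → s a ∈ F.gr (i + 1)
  p_mem : ∀ i a, a ∈ F.gr i → p a ∈ F.gr i
  homotopy : ∀ a, F.d (s a) + s (F.d a) = a - p a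
  s_s : ∀ a, s (s a) = 0
  p_p : ∀ a, p (p a) = p a
  d_p : ∀ a, F.d (p a) = 0
  p_d : ∀ a, p (F.d a) = 0
  p_s : ∀ a, p (s a) = 0
  s_p : ∀ a, s (p a) = 0
  form_s : ∀ i a b, a ∈ F.gr i → F.form (s a) b = psign i * F.form a (s b)
  form_p : ∀ a b, F.form (p a) b = F.form a (p b)

/-- `A` is contractible when its cohomology vanishes. -/
def Contractible : Prop := ∀ a, F.d a = 0 → ∃ b, F.d b = a

variable [FiniteDimensional ℝ A]

/-- Index set of a homogeneous basis of `A`; the first component of an index is its parity. -/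
abbrev Idx : Type := Σ i : ZMod 2, Fin (Module.finrank ℝ (F.gr i))

/-- A homogeneous basis of `A`. -/
def basis : Module.Basis F.Idx ℝ A :=
  F.internal.collectedBasis fun i => Module.finBasis ℝ (F.gr i)

/-- The dual basis, normalised by `⟨dual i, basis j⟩ = δ i j`. -/
def dual : Module.Basis F.Idx ℝ A := F.form.dualBasis F.form_nondegenerate F.basis

/-- The inverse inner product `⟨-,-⟩⁻¹ ∈ A ⊗ A`, i.e. the tensor `∑ x ⊗ y` with
`∑ ⟨u, x⟩ y = u` for all `u`. -/
def invForm : A ⊗[ℝ] A := ∑ i, F.basis i ⊗ₜ[ℝ] F.dual i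

/-- The components of a tensor in `A ⊗ A` in the homogeneous basis. -/
def coeff (K : A ⊗[ℝ] A) (i j : F.Idx) : ℝ := (F.basis.tensorProduct F.basis).repr K (i, j)

/-! ### The open topological field theory of a Frobenius algebra -/

/-- The structure map of a disk: `⟨a₁ ⋯ aₙ₋₁, aₙ⟩`, for `n ≥ 2`. -/
def disk : List A → ℝ
  | [] => 0
  | [_] => 0
  | [a, b] => F.form a b
  | a :: b :: c :: l => disk ((a * b) :: c :: l)
termination_by l => l.length

/-- Attach `g` handles to a disk whose boundary carries the word `acc`: each handle glues, in an
interlaced fashion, two strips to the boundary, that is, it contracts the word `acc x y x' y'` with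
`⟨-,-⟩⁻¹` in `(x, x')` and with `⟨-,-⟩⁻¹` in `(y, y')`; the sign is the Koszul sign of
`x x' y y' ↦ x y x' y'`. -/
def handles : ℕ → List A → ℝ
  | 0, acc => F.disk acc
  | g + 1, acc => ∑ i : F.Idx, ∑ j : F.Idx, psign (i.1 * j.1) *
      handles g (acc ++ [F.basis i, F.basis j, F.dual i, F.dual j])

/-- Attach further boundary circles, carrying the words in the given list, and then `g` handles:
gluing a strip to the disk around an arc of its boundary labelled by `w` separates `w` from the rest
of the boundary, and contracts the word `acc x w x'` with `⟨-,-⟩⁻¹` in `(x, x')`; the sign is the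
Koszul sign of `x x' w ↦ x w x'`. -/
def windows : List (List F.Idx) → ℕ → List A → ℝ
  | [], g, acc => F.handles g acc
  | w :: ws, g, acc => ∑ i : F.Idx, psign (i.1 * (w.map Sigma.fst).sum) *
      windows ws g (acc ++ [F.basis i] ++ w.map F.basis ++ [F.dual i])

/-- The value on basis vectors of the multilinear map which the open topological field theory of `A`
assigns to the connected compact oriented surface of genus `g` with one boundary circle for every
list in the given list; such a list (possibly empty) records in cyclic order the labels of the
intervals embedded in that boundary circle.  The inputs are read in the order in which they are
listed.  It is computed by presenting the surface as a disk with strips attached to it. -/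
def otft (g : ℕ) : List (List F.Idx) → ℝ
  | [] => 0
  | w :: ws => F.windows ws g (w.map F.basis)

end DGFrobenius

/-! ### Stable ribbon graphs -/

/-- A connected compact oriented surface with boundary, with elements of `H` embedded in its
boundary: its genus, and the list of its boundary circles, each given as the list of the elements
embedded in it, in their cyclic order (starting anywhere; empty if there are none). -/
structure BdSurface (H : Type) where
  genus : ℕ
  boundary : List (List H)

namespace BdSurface

variable {H : Type}

/-- The half-edges embedded in the boundary of the surface. -/
def halfEdges (S : BdSurface H) : List H := S.boundary.flatten

/-- Two presentations of the same surface: the list of boundary circles may be reordered, and the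
list for each circle may be rotated. -/
def Same (S S' : BdSurface H) : Prop :=
  S.genus = S'.genus ∧ ∃ B, S.boundary.Perm B ∧ List.Forall₂ List.IsRotated B S'.boundary

/-- Relabel (or, where the value is `none`, erase) half-edges. -/
def relabel {H' : Type} (r : H → Option H') (S : BdSurface H) : BdSurface H' :=
  ⟨S.genus, S.boundary.map (List.filterMap r)⟩

variable [DecidableEq H]

/-- The boundary circle in which `h` is embedded. -/
def circle (h : H) (S : BdSurface H) : List H := (S.boundary.filter fun c => h ∈ c).flatten

/-- The half-edges that follow `h` on its boundary circle, in cyclic order, without `h`. -/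
def after (h : H) (S : BdSurface H) : List H :=
  ((S.circle h).rotate ((S.circle h).idxOf h)).tail

/-- The surface obtained from two surfaces by joining an interval `h` of the first with an interval
`h'` of the second by a strip. -/
def glue (h h' : H) (S S' : BdSurface H) : BdSurface H :=
  ⟨S.genus + S'.genus, (S.after h ++ S'.after h') ::
    ((S.boundary.filter fun c => h ∉ c) ++ (S'.boundary.filter fun c => h' ∉ c))⟩

/-- The surface obtained by joining two intervals `h`, `h'` of one surface by a strip: if they lie
on the same boundary circle, this circle is split into two; otherwise their two circles are merged
and the genus grows by one. -/
def selfGlue (h h' : H) (S : BdSurface H) : BdSurface H :=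
  if h' ∈ S.circle h then
    ⟨S.genus, (S.after h).takeWhile (· ≠ h') :: ((S.after h).dropWhile (· ≠ h')).tail ::
      S.boundary.filter fun c => h ∉ c⟩
  else
    ⟨S.genus + 1, (S.after h ++ S.after h') :: S.boundary.filter fun c => h ∉ c ∧ h' ∉ c⟩

end BdSurface

/-- The data of a stable ribbon graph with edges `0, …, m - 1`, in this order.  The half-edges are the
pairs `(e, b)`, the two halves of the edge `e` being `(e, false)` and `(e, true)`.  The vertices are
listed with the surfaces that decorate them.  (The conditions on these data are in
`RibbonGraph.HasType`.)  The ordering of the edges is an orientation of the graph. -/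
structure RibbonGraph (m : ℕ) where
  vertices : List (BdSurface (Fin m × Bool))

namespace RibbonGraph

variable {m : ℕ} (γ : RibbonGraph m)

/-- All boundary circles of all vertices. -/
def circles : List (List (Fin m × Bool)) := γ.vertices.flatMap BdSurface.boundary

/-- All half-edges, in the order in which they are listed at the vertices. -/
def halfEdges : List (Fin m × Bool) := γ.circles.flatten

/-- The permutation of the half-edges whose cycles are the boundary circles of the vertices. -/
def next : Equiv.Perm (Fin m × Bool) := (γ.circles.map List.formPerm).prod

/-- The permutation which exchanges the two halves of each edge. -/
def flip : Equiv.Perm (Fin m × Bool) := (Equiv.refl _).prodCongr Equiv.boolNot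

/-- The number of boundary circles of the surface obtained from the surfaces at the vertices by
gluing in a strip along every edge. -/
def faces : ℕ :=
  Nat.card (Quotient (Equiv.Perm.SameCycle.setoid (γ.next * flip))) + γ.circles.count []

/-- Some edge leads from the vertex `x` to the vertex `y`. -/
def Linked (x y : Fin γ.vertices.length) : Prop :=
  ∃ e : Fin m, (e, false) ∈ (γ.vertices.get x).halfEdges ∧ (e, true) ∈ (γ.vertices.get y).halfEdges

/-- `γ` is a connected stable ribbon graph which indexes an orbi-cell of the moduli space of type
`(g, n)`: gluing in strips along the edges gives a connected surface of genus `g` with `n` boundary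
circles.  (If there is no edge, there is exactly one vertex, without half-edges: this is the cell of
the surfaces all of whose perimeters vanish.) -/
structure HasType (g n : ℕ) : Prop where
  once : ∀ h, γ.halfEdges.count h = 1
  boundary_ne : ∀ S ∈ γ.vertices, S.boundary ≠ []
  stable : ∀ S ∈ γ.vertices,
    4 < 4 * S.genus + 2 * S.boundary.length + S.halfEdges.length
  nonempty : γ.vertices ≠ []
  connected : ∀ x y, Relation.EqvGen γ.Linked x y
  faces_eq : γ.faces = n
  euler : (γ.vertices.map fun S => (2 - 2 * S.genus - S.boundary.length : ℤ)).sum - m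
    = 2 - 2 * g - n

/-- `γ` and `γ'` are isomorphic by an isomorphism which induces the permutation `ρ` on the edges
(and exchanges the halves of the edges `e` with `ε e = true` for some `ε`). -/
def Iso (ρ : Equiv.Perm (Fin m)) (γ γ' : RibbonGraph m) : Prop :=
  ∃ ε : Fin m → Bool, ∃ L,
    (γ.vertices.map (BdSurface.relabel fun h => some (ρ h.1, xor (ε h.1) h.2))).Perm L ∧
      List.Forall₂ BdSurface.Same L γ'.vertices

/-- The graph `γ/e` obtained by contracting the edge (or loop) `e = i`, the other edges keeping their
order. -/
def contract {m : ℕ} (γ : RibbonGraph (m + 1)) (i : Fin (m + 1)) : RibbonGraph m :=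
  let h := (i, false)
  let h' := (i, true)
  let rest := γ.vertices.filter fun S => h ∉ S.halfEdges ∧ h' ∉ S.halfEdges
  let merged : List (BdSurface (Fin (m + 1) × Bool)) :=
    match γ.vertices.find? (fun S => h ∈ S.halfEdges),
      γ.vertices.find? (fun S => h' ∈ S.halfEdges) with
    | some S, some S' => [if h' ∈ S.halfEdges then S.selfGlue h h' else S.glue h h' S']
    | _, _ => []
  ⟨(merged ++ rest).map
    (BdSurface.relabel fun x => (finSuccEquiv' i x.1).map fun e => (e, x.2))⟩

end RibbonGraph

/-! ### Orbi-cellular cochains on the one point compactification -/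

/-- A real function on the oriented orbi-cells of the one point compactification: its values on
oriented stable ribbon graphs and its value on the 0-cell at infinity. -/
structure LCochain where
  onGraph : ∀ m, RibbonGraph m → ℝ
  atInfinity : ℝ

namespace LCochain

/-- `c` is an orbi-cellular cochain (of mixed degree) on the one point compactification of type
`(g, n)`: it depends only on isomorphism classes and changes sign with the orientation. -/
def IsCochain (g n : ℕ) (c : LCochain) : Prop :=
  ∀ (m : ℕ) (γ γ' : RibbonGraph m) (ρ : Equiv.Perm (Fin m)), γ.HasType g n →
    RibbonGraph.Iso ρ γ γ' → c.onGraph m γ' = ((Equiv.Perm.sign ρ : ℤ) : ℝ) * c.onGraph m γ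

/-- The coboundary: the value of `c` on `∂γ = ∑ ± γ/e`, where the sign brings the edge `e` to the
first place.  A cell with one edge is an arc which also ends in the point at infinity. -/
def coboundary (c : LCochain) {m : ℕ} (γ : RibbonGraph (m + 1)) : ℝ :=
  ∑ i : Fin (m + 1), (-1 : ℝ) ^ (i : ℕ) * c.onGraph m (γ.contract i)
    - if m = 0 then c.atInfinity else 0

/-- `c` is a cocycle on the one point compactification of type `(g, n)`. -/
def IsCocycle (g n : ℕ) (c : LCochain) : Prop :=
  c.IsCochain g n ∧
    ∀ (m : ℕ) (γ : RibbonGraph (m + 1)), γ.HasType g n → c.coboundary γ = 0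

/-- The pull-back of `c` along the map which collapses the boundary at infinity.  A cell of the
compactification in which edges may become infinitely long is a stable ribbon graph with `k` black
edges (the first ones, which are ordered) and `w` white edges (of infinite length), and it has
dimension `k`; it is mapped to the point at infinity if there is a white edge. -/
def pullback (c : LCochain) {k : ℕ} : (w : ℕ) → RibbonGraph (k + w) → ℝ
  | 0, γ => c.onGraph k γ
  | _ + 1, _ => if k = 0 then c.atInfinity else 0

/-- `c` and `c'` have the same values on all cells of type `(g, n)`. -/
def Agree (g n : ℕ) (c c' : LCochain) : Prop :=
  (∀ (m : ℕ) (γ : RibbonGraph m), γ.HasType g n → c.onGraph m γ = c'.onGraph m γ) ∧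
    c.atInfinity = c'.atInfinity

end LCochain

/-! ### Contraction of tensors along a stable ribbon graph -/

/-- The Koszul sign of the permutation which brings the half-edges, with parities `q`, from the
order `(0, false), (0, true), (1, false), (1, true), …` to the order of the given list. -/
def koszul {m : ℕ} (q : Fin m × Bool → ZMod 2) : List (Fin m × Bool) → ℝ
  | [] => 1
  | x :: l => (l.map fun y =>
      if y.1 < x.1 ∨ (y.1 = x.1 ∧ y.2 < x.2) then psign (q x * q y) else 1).prod * koszul q l

namespace DGFrobenius

variable {A : Type*} [NonUnitalRing A] [Module ℝ A] [FiniteDimensional ℝ A] (F : DGFrobenius A)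

/-- The map `T = ⨂ t_v : A^{⊗ 2m} → ℝ` of the graph, which applies the open topological field theory
at every vertex, evaluated on the tensor product of basis vectors with indices `f`, taken in the
order of the edges. -/
def vertexMap {m : ℕ} (γ : RibbonGraph m) (f : Fin m × Bool → F.Idx) : ℝ :=
  koszul (fun h => (f h).1) γ.halfEdges *
    (γ.vertices.map fun S => F.otft S.genus (S.boundary.map (List.map f))).prod

/-- `T` applied to the tensor product of the elements `∑ i j, eᵢ ⊗ eⱼ ⊗ a e i j` of `A ⊗ A ⊗ R` over
the edges `e`, in their order.  This is used in two cases.  If `R = ℝ`, the order of the coefficients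
does not matter.  If `R` is an exterior algebra, then the coefficient `a e i j` has the same parity as
`eᵢ ⊗ eⱼ`, and moving the coefficients to the right of all vectors by the Koszul rule amounts to
reversing their order. -/
def contractEdges {R : Type*} [Ring R] [Algebra ℝ R] {m : ℕ} (γ : RibbonGraph m)
    (a : Fin m → F.Idx → F.Idx → R) : R :=
  ∑ f : Fin m × Bool → F.Idx,
    F.vertexMap γ f • (List.ofFn fun e => a e (f (e, false)) (f (e, true))).reverse.prod

end DGFrobenius

/-! ### The two constructions -/

namespace DGFrobenius.Hodge

variable {A : Type*} [NonUnitalRing A] [Module ℝ A] [FiniteDimensional ℝ A] {F : DGFrobenius A}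
  (D : F.Hodge)

/-- The Laplacian. -/
def laplacian : A →ₗ[ℝ] A := F.d ∘ₗ D.s + D.s ∘ₗ F.d

/-- The heat operator `exp (-tΔ)`. -/
def heat (t : ℝ) : A →ₗ[ℝ] A :=
  Matrix.toLin F.basis F.basis
    (NormedSpace.exp ((-t) • LinearMap.toMatrix F.basis F.basis D.laplacian))

/-- The heat kernel `K_t = (exp (-tΔ) ⊗ id) ⟨-,-⟩⁻¹`. -/
def kernel (t : ℝ) : A ⊗[ℝ] A := (D.heat t).rTensor A F.invForm

/-- `(s ⊗ id) K_t`. -/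
def sKernel (t : ℝ) : A ⊗[ℝ] A := D.s.rTensor A (D.kernel t)

/-- The propagator `(s ⊗ id) ⟨-,-⟩⁻¹`. -/
def propagator : A ⊗[ℝ] A := D.s.rTensor A F.invForm

/-- The limit `(p ⊗ id) ⟨-,-⟩⁻¹` of the heat kernel, which is put on white edges. -/
def whiteTensor : A ⊗[ℝ] A := D.p.rTensor A F.invForm

/-- The components of the form `α = K_t + (s ⊗ id) K_t · dt`, with `t` the `j`-th coordinate on
`ℝ^k`; a differential form on `ℝ^k` is a function with values in the exterior algebra on
`dt_1, …, dt_k`. -/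
def alpha {k : ℕ} (j : Fin k) (t : Fin k → ℝ) (x y : F.Idx) : ExteriorAlgebra ℝ (Fin k → ℝ) :=
  algebraMap ℝ _ (F.coeff (D.kernel (t j)) x y) +
    F.coeff (D.sKernel (t j)) x y • ExteriorAlgebra.ι ℝ (Pi.single j (1 : ℝ))

/-- The differential form on the orbi-cell of a stable ribbon graph whose first `k` edges are black
and whose last `w` edges are white. -/
def costelloForm {k w : ℕ} (γ : RibbonGraph (k + w)) (t : Fin k → ℝ) :
    ExteriorAlgebra ℝ (Fin k → ℝ) :=
  F.contractEdges γ fun e x y =>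
    Fin.addCases (motive := fun _ => ExteriorAlgebra ℝ (Fin k → ℝ))
      (fun j => D.alpha j t x y) (fun _ => algebraMap ℝ _ (F.coeff D.whiteTensor x y)) e

/-- The coefficient of the top degree part of a form on an orbi-cell, with respect to the positive
volume form `dt_k ∧ … ∧ dt_1`. -/
def topCoeff (k : ℕ) : ExteriorAlgebra ℝ (Fin k → ℝ) →ₗ[ℝ] ℝ :=
  ExteriorAlgebra.liftAlternating
    (Pi.single k ((Pi.basisFun ℝ (Fin k)).reindex Fin.revPerm).det)

/-- The integral of the form over its orbi-cell. -/
def costelloIntegral {k w : ℕ} (γ : RibbonGraph (k + w)) : ℝ :=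
  ∫ t in Set.Ici (0 : Fin k → ℝ), topCoeff k (D.costelloForm γ t)

/-- `c` is the cochain on the one point compactification given by Costello's construction: the one
whose pull-back is the cochain obtained by integrating the forms over the orbi-cells. -/
def IsCostello (g n : ℕ) (c : LCochain) : Prop :=
  c.IsCochain g n ∧ ∀ (k w : ℕ) (γ : RibbonGraph (k + w)), γ.HasType g n →
    c.pullback w γ = D.costelloIntegral γ

/-- The cochain of Kontsevich's dual construction: put the propagator on every edge, and contract
with the open topological field theory at every vertex. -/
def dualCochain : LCochain where
  onGraph _ γ := F.contractEdges γ fun _ x y => F.coeff D.propagator x y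
  atInfinity := 0

end DGFrobenius.Hodge

end

set_option linter.unusedSectionVars false
set_option linter.unusedSimpArgs false

noncomputable section

/-! ### Signs -/

/-! The comparison of the two constructions is elementary. Since `Δ = 1 - π` and `sπ = 0`, one has
`sΔ = s`, hence `s e^{-tΔ} = e^{-t} s`, and the `dt`-part of the form on a black edge is `e^{-t} dt`
times the propagator (`sKernel_eq`). With `k` black edges and no white one, the top-degree part
takes the `dt`-part on every edge, so it is `∏ e^{-t_j}` times Kontsevich's number
(`topCoeff_costelloForm`), and the integral of the product is `1`. If `A` is contractible, then `π =
0`, and every form with a white edge vanishes. The pull-back condition therefore determines the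
cochain on all graphs. The value at infinity is forced to be `0` by a graph whose only edge is
white, and a graph with one edge exists in every type `(g, n)` (`exists_hasType_one`).

The substance is that Kontsevich's numbers form a cocycle. They do so for three reasons. (1) The
propagator `P` is an odd tensor whose components are symmetric (`coeff_propagator_comm`): permuting
edges costs the sign of the permutation, and flipping an edge costs nothing (`contractEdges_iso`).
(2) Contracting an edge is the same as putting `⟨-,-⟩⁻¹` on it (`vertexMap_contract`). This is the
gluing axiom of the open field theory. (3) When `π = 0`, `⟨-,-⟩⁻¹ = dP` (`inv_eq_d_propagator`), and
the vertex map `T` is a chain map, `T ∘ d = 0` (`sum_vertexMap_update`). Hence `∑ ± T(P ⊗ ⋯ ⊗ dP ⊗ ⋯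
⊗ P) = T(d(P ⊗ ⋯ ⊗ P)) = 0` (`sum_contract_eq_zero`).

For (2) and (3) the field theory needs a closed form. As `A` may lack a unit, it is embedded in the
hull `ℝ1 ⊕ A ⊕ ℝθ`, whose trace reproduces the disk maps. There a further boundary circle with word
`w` is represented by the graded central element `∑ ± eᵢ w eⁱ`, a handle by an even central element,
and the surface by `tr(w₀ · windows · handle^g)` (`otft_cons`). Gluing, symmetry and compatibility
with `d` all reduce to moving operators through `∑ eᵢ ⊗ eⁱ` to their adjoints (`casimir_adjoint`).
The sums run over a basis of `A` only, not of the hull, so gluing two surfaces is valid only away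
from the unit. Stability guarantees this, by excluding the disk with one half-edge. -/

theorem psign_zero : psign 0 = 1 := by simp [psign]

theorem psign_one : psign 1 = -1 := by simp [psign]

theorem psign_add (i j : ZMod 2) : psign (i + j) = psign i * psign j := by
  have h : ∀ i : ZMod 2, i = 0 ∨ i = 1 := by decide
  have h2 : (1 + 1 : ZMod 2) = 0 := by decide
  rcases h i with rfl | rfl <;> rcases h j with rfl | rfl <;> simp [psign, h2]

theorem psign_mul_self (i : ZMod 2) : psign i * psign i = 1 := by
  unfold psign; split_ifs <;> norm_num

theorem parity_cases (i : ZMod 2) : i = 0 ∨ i = 1 := by revert i; decide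

theorem parity_mul_self (i : ZMod 2) : i * i = i := by revert i; decide

theorem parity_add_self (i : ZMod 2) : i + i = 0 := by revert i; decide

namespace DGFrobenius

variable {A : Type*} [NonUnitalRing A] [Module ℝ A] (F : DGFrobenius A)

/-! ### The unital hull -/

/-- The unital Frobenius hull `ℝ 1 ⊕ A ⊕ ℝ θ` of `A`, with product `a b = (a b)_A + ⟨a, b⟩ θ` on `A`;
the trace is the coefficient of `θ`. -/
def Hull (_F : DGFrobenius A) : Type _ := ℝ × A × ℝ

namespace Hull

instance : AddCommGroup F.Hull := inferInstanceAs (AddCommGroup (ℝ × A × ℝ))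

instance : Module ℝ F.Hull := inferInstanceAs (Module ℝ (ℝ × A × ℝ))

variable {F}

/-- The coefficient of the unit. -/
def un : F.Hull →ₗ[ℝ] ℝ := LinearMap.fst ℝ ℝ (A × ℝ)

/-- The component in `A`. -/
def el : F.Hull →ₗ[ℝ] A := LinearMap.fst ℝ A ℝ ∘ₗ LinearMap.snd ℝ ℝ (A × ℝ)

/-- The trace, that is, the coefficient of `θ`. -/
def tr : F.Hull →ₗ[ℝ] ℝ := LinearMap.snd ℝ A ℝ ∘ₗ LinearMap.snd ℝ ℝ (A × ℝ)

/-- The inclusion of `A`. -/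
def inc : A →ₗ[ℝ] F.Hull := LinearMap.inr ℝ ℝ (A × ℝ) ∘ₗ LinearMap.inl ℝ A ℝ

/-- The socle element. -/
def theta : F.Hull := ((0 : ℝ), (0 : A), (1 : ℝ))

@[ext] theorem ext {x y : F.Hull} (h1 : un x = un y) (h2 : el x = el y) (h3 : tr x = tr y) :
    x = y := Prod.ext h1 (Prod.ext h2 h3)

instance : One F.Hull := ⟨((1 : ℝ), (0 : A), (0 : ℝ))⟩

instance : Mul F.Hull := ⟨fun x y =>
  (un x * un y, un x • el y + un y • el x + el x * el y,
    un x * tr y + un y * tr x + F.form (el x) (el y))⟩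

@[simp] theorem un_one : un (1 : F.Hull) = 1 := rfl
@[simp] theorem el_one : el (1 : F.Hull) = 0 := rfl
@[simp] theorem tr_one : tr (1 : F.Hull) = 0 := rfl
@[simp] theorem un_theta : un (theta : F.Hull) = 0 := rfl
@[simp] theorem el_theta : el (theta : F.Hull) = 0 := rfl
@[simp] theorem tr_theta : tr (theta : F.Hull) = 1 := rfl
@[simp] theorem un_inc (a : A) : un (inc a : F.Hull) = 0 := rfl
@[simp] theorem el_inc (a : A) : el (inc a : F.Hull) = a := rfl
@[simp] theorem tr_inc (a : A) : tr (inc a : F.Hull) = 0 := rfl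
@[simp] theorem un_mul (x y : F.Hull) : un (x * y) = un x * un y := rfl
@[simp] theorem el_mul (x y : F.Hull) :
    el (x * y) = un x • el y + un y • el x + el x * el y := rfl
@[simp] theorem tr_mul (x y : F.Hull) :
    tr (x * y) = un x * tr y + un y * tr x + F.form (el x) (el y) := rfl

variable [IsScalarTower ℝ A A] [SMulCommClass ℝ A A]

instance : Ring F.Hull :=
  { (inferInstance : AddCommGroup F.Hull) with
    mul := (· * ·)
    one := 1
    left_distrib := fun x y z => by
      ext <;> simp [smul_add, add_smul, mul_add] <;> first | ring | abel
    right_distrib := fun x y z => by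
      ext <;> simp [smul_add, add_smul, add_mul] <;> first | ring | abel
    zero_mul := fun x => by ext <;> simp
    mul_zero := fun x => by ext <;> simp
    mul_assoc := fun x y z => by
      ext
      · simp [mul_assoc]
      · simp only [el_mul, un_mul, smul_add, mul_add, add_mul, smul_mul_assoc, mul_smul_comm,
          mul_assoc, smul_smul, mul_comm (un z)]
        abel
      · simp only [tr_mul, el_mul, un_mul, map_add, map_smul, LinearMap.add_apply,
          LinearMap.smul_apply, smul_eq_mul, F.form_mul]
        ring
    one_mul := fun x => by ext <;> simp
    mul_one := fun x => by ext <;> simp }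

instance : Algebra ℝ F.Hull := Algebra.ofModule
  (fun r x y => by
    ext <;> simp [smul_add, mul_smul, mul_assoc, smul_mul_assoc, smul_comm r, mul_left_comm, mul_add])
  (fun r x y => by
    ext <;> simp [smul_add, mul_smul, mul_assoc, mul_smul_comm, smul_comm r, mul_left_comm, mul_add])

theorem decompose (x : F.Hull) : x = un x • 1 + inc (el x) + tr x • theta := by
  ext <;> simp

theorem theta_mul {x : F.Hull} (hx : un x = 0) : theta * x = 0 := by ext <;> simp [hx]

theorem mul_theta {x : F.Hull} (hx : un x = 0) : x * theta = 0 := by ext <;> simp [hx]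

theorem inc_mul_inc (a b : A) : (inc a * inc b : F.Hull) = inc (a * b) + F.form a b • theta := by
  ext <;> simp

/-- The `θ`-term of `inc a * inc b` annihilates everything without unit component. Inside longer
words the product of the hull is thus the product of `A`. -/
theorem inc_mul_inc_mul (a b : A) {x : F.Hull} (hx : un x = 0) :
    inc a * (inc b * x) = inc (a * b) * x := by
  rw [← mul_assoc, inc_mul_inc, add_mul, smul_mul_assoc, theta_mul hx, smul_zero, add_zero]

theorem mul_inc_mul_inc (a b : A) {x : F.Hull} (hx : un x = 0) :
    x * inc a * inc b = x * inc (a * b) := by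
  rw [mul_assoc, inc_mul_inc, mul_add, mul_smul_comm, mul_theta hx, smul_zero, add_zero]

/-! ### The grading of the hull -/

variable (F) in
/-- The homogeneous elements of the hull. -/
def hgr (p : ZMod 2) : Submodule ℝ F.Hull where
  carrier := {x | el x ∈ F.gr p ∧ (p ≠ 0 → un x = 0 ∧ tr x = 0)}
  add_mem' := fun {x y} hx hy => ⟨by simpa using add_mem hx.1 hy.1, fun hp => by
    simp [hx.2 hp, hy.2 hp]⟩
  zero_mem' := by simp
  smul_mem' := fun r x hx => ⟨by simpa using Submodule.smul_mem _ r hx.1, fun hp => by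
    simp [hx.2 hp]⟩

theorem one_mem : (1 : F.Hull) ∈ hgr F 0 := by simp [hgr]

theorem inc_mem {p : ZMod 2} {a : A} (ha : a ∈ F.gr p) : (inc a : F.Hull) ∈ hgr F p := by
  simp [hgr, ha]

theorem mul_mem {p q : ZMod 2} {x y : F.Hull} (hx : x ∈ hgr F p) (hy : y ∈ hgr F q) :
    x * y ∈ hgr F (p + q) := by
  have key := F.mul_mem p q _ _ hx.1 hy.1
  have fe := F.form_even p q _ _ hx.1 hy.1
  rcases parity_cases p with rfl | rfl <;> rcases parity_cases q with rfl | rfl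
  · refine ⟨?_, by simp⟩
    rw [el_mul]
    exact add_mem (add_mem (Submodule.smul_mem _ _ hy.1) (Submodule.smul_mem _ _ hx.1)) key
  · refine ⟨?_, fun _ => ?_⟩
    · have := hy.2 one_ne_zero
      rw [el_mul, this.1, zero_smul, add_zero]
      exact add_mem (by simpa using (Submodule.smul_mem _ _ hy.1)) key
    · have := hy.2 one_ne_zero
      simp [this, fe]
  · refine ⟨?_, fun _ => ?_⟩
    · have := hx.2 one_ne_zero
      rw [el_mul, this.1, zero_smul, zero_add]
      exact add_mem (by simpa using (Submodule.smul_mem _ _ hx.1)) key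
    · have := hx.2 one_ne_zero
      simp [this, fe]
  · refine ⟨?_, fun h => absurd (by decide) h⟩
    have h1 := hx.2 one_ne_zero
    have h2 := hy.2 one_ne_zero
    rw [el_mul, h1.1, h2.1, zero_smul, zero_smul, zero_add, zero_add]
    exact key

theorem tr_of_odd {p : ZMod 2} {x : F.Hull} (hx : x ∈ hgr F p) (hp : p ≠ 0) : tr x = 0 :=
  (hx.2 hp).2

/-- Graded cyclicity. The `A`-parts are covered by the symmetry of the form, and the cross terms
between `1` and `θ` occur only for even factors, where the sign is trivial. -/
theorem tr_mul_comm {p q : ZMod 2} {x y : F.Hull} (hx : x ∈ hgr F p) (hy : y ∈ hgr F q) :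
    tr (x * y) = psign (p * q) * tr (y * x) := by
  rw [tr_mul, tr_mul, F.form_symm p q _ _ hx.1 hy.1]
  rcases parity_cases p with rfl | rfl
  · simp [psign_zero]; ring
  rcases parity_cases q with rfl | rfl
  · simp [psign_zero]; ring
  · simp [hx.2 one_ne_zero, hy.2 one_ne_zero]

/-- Linear maps on the homogeneous part of degree `p` are determined by their values on `A`, `1` and
`θ`. -/
theorem eq_of_hgr {M : Type*} [AddCommGroup M] [Module ℝ M] {p : ZMod 2} (L L' : F.Hull →ₗ[ℝ] M)
    (h : ∀ a ∈ F.gr p, L (inc a) = L' (inc a)) (h1 : p = 0 → L 1 = L' 1)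
    (ht : p = 0 → L theta = L' theta) {x : F.Hull} (hx : x ∈ hgr F p) : L x = L' x := by
  by_cases hp : p = 0
  · rw [decompose x]
    simp only [map_add, map_smul, h _ hx.1, h1 hp, ht hp]
  · rw [decompose x, (hx.2 hp).1, (hx.2 hp).2]
    simp [h _ hx.1]

/-! ### The differential of the hull -/

/-- The extension of the differential to the hull. -/
def del : F.Hull →ₗ[ℝ] F.Hull := inc ∘ₗ F.d ∘ₗ el

theorem del_inc (a : A) : del (inc a : F.Hull) = inc (F.d a) := rfl

theorem del_one : del (1 : F.Hull) = 0 := by simp [del]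

theorem tr_del (x : F.Hull) : tr (del x) = 0 := rfl

/-- The `θ`-component of the Leibniz rule is exactly `form_d`. In the `A`-component the sign may be
dropped in front of `un x`, which is nonzero only for even `x`. -/
theorem del_mul {p : ZMod 2} {x y : F.Hull} (hx : x ∈ hgr F p) :
    del (x * y) = del x * y + psign p • (x * del y) := by
  ext
  · simp [del]
  · have h : psign p * un x = un x := by
      rcases parity_cases p with rfl | rfl
      · simp [psign_zero]
      · simp [hx.2 one_ne_zero]
    simp [del, F.d_mul _ _ _ hx.1, smul_smul, h]
    abel
  · simp [del, F.form_d _ _ _ hx.1]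

end Hull

end DGFrobenius

end

noncomputable section

namespace DGFrobenius

variable {A : Type*} [NonUnitalRing A] [Module ℝ A] (F : DGFrobenius A)
  [FiniteDimensional ℝ A]

/-! ### Bases and Casimir identities -/

theorem basis_mem (i : F.Idx) : F.basis i ∈ F.gr i.1 := F.internal.collectedBasis_mem _ _

theorem form_dual_basis (i j : F.Idx) : F.form (F.dual i) (F.basis j) = if j = i then 1 else 0 :=
  LinearMap.BilinForm.apply_dualBasis_left _ _ _ _

theorem sum_form_basis_smul_dual (u : A) : ∑ i, F.form u (F.basis i) • F.dual i = u := by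
  conv_rhs => rw [← F.dual.sum_repr u]
  simp only [dual, LinearMap.BilinForm.dualBasis_repr_apply]

theorem basis_repr (u : A) (i : F.Idx) : F.basis.repr u i = F.form (F.dual i) u := by
  conv_rhs => rw [← F.basis.sum_repr u]
  simp only [map_sum, map_smul, form_dual_basis, smul_eq_mul, mul_ite, mul_one, mul_zero,
    Finset.sum_ite_eq', Finset.mem_univ, if_true]

theorem sum_form_dual_smul_basis (u : A) : ∑ i, F.form (F.dual i) u • F.basis i = u := by
  conv_rhs => rw [← F.basis.sum_repr u]
  simp only [basis_repr]

/-- The component of the wrong parity is orthogonal to the whole basis, hence zero by nondegeneracy.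
This is how the dual basis inherits the parities of the basis. -/
theorem mem_gr_of_form {p : ZMod 2} {u : A} (h : ∀ i : F.Idx, i.1 ≠ p → F.form u (F.basis i) = 0) :
    u ∈ F.gr p := by
  set v : A := ∑ i : F.Idx, if i.1 = p then F.basis.repr u i • F.basis i else 0 with hv
  set w : A := ∑ i : F.Idx, if i.1 = p then 0 else F.basis.repr u i • F.basis i with hw
  have huvw : u = v + w := by
    rw [hv, hw, ← Finset.sum_add_distrib]
    conv_lhs => rw [← F.basis.sum_repr u]
    refine Finset.sum_congr rfl fun i _ => ?_
    split_ifs <;> simp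
  have hvm : v ∈ F.gr p := Submodule.sum_mem _ fun i _ => by
    split_ifs with hi
    · exact Submodule.smul_mem _ _ (hi ▸ F.basis_mem i)
    · exact Submodule.zero_mem _
  have hwm : w ∈ F.gr (p + 1) := Submodule.sum_mem _ fun i _ => by
    split_ifs with hi
    · exact Submodule.zero_mem _
    · have : i.1 = p + 1 := by
        exact (by decide : ∀ r p : ZMod 2, r ≠ p → r = p + 1) _ _ hi
      exact Submodule.smul_mem _ _ (this ▸ F.basis_mem i)
  have hw0 : w = 0 := by
    rw [← F.sum_form_basis_smul_dual w]
    refine Finset.sum_eq_zero fun i _ => ?_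
    by_cases hi : i.1 = p
    · rw [F.form_even _ _ _ _ hwm (F.basis_mem i), zero_smul]
      rw [hi]; exact (by decide : ∀ p : ZMod 2, p + 1 ≠ p) p
    · have h1 := h i hi
      rw [huvw, map_add, LinearMap.add_apply, F.form_even _ _ _ _ hvm (F.basis_mem i) (Ne.symm hi),
        zero_add] at h1
      rw [h1, zero_smul]
  rw [huvw, hw0, add_zero]; exact hvm

theorem dual_mem (i : F.Idx) : F.dual i ∈ F.gr i.1 := by
  refine F.mem_gr_of_form fun j hj => ?_
  rw [form_dual_basis, if_neg]
  rintro rfl; exact hj rfl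

section Casimir

variable {F} {M : Type*} [Ring M] [Algebra ℝ M]

/-- Moving an operator through the inverse of the inner product to its adjoint. -/
theorem casimir_adjoint (L R : ZMod 2 → A →ₗ[ℝ] M) (x y : F.Idx → A) (t : ZMod 2)
    (h : ∀ i j, F.form (F.dual j) (x i) = F.form (y j) (F.basis i))
    (hx : ∀ i, x i ∈ F.gr (i.1 + t)) :
    ∑ i, L (i.1 + t) (x i) * R (i.1 + t) (F.dual i) = ∑ j, L j.1 (F.basis j) * R j.1 (y j) := by
  have h1 : ∀ i, L (i.1 + t) (x i) * R (i.1 + t) (F.dual i) =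
      ∑ j, F.form (y j) (F.basis i) • (L j.1 (F.basis j) * R j.1 (F.dual i)) := by
    intro i
    conv_lhs => rw [← F.sum_form_dual_smul_basis (x i)]
    rw [map_sum, Finset.sum_mul]
    refine Finset.sum_congr rfl fun j _ => ?_
    rw [map_smul, smul_mul_assoc, ← h]
    -- `L` and `R` depend on the parity so that Koszul signs can be built into them. Components of
    -- the wrong parity have coefficient zero, so the parity index may be replaced by that of `j`.
    by_cases hj : j.1 = i.1 + t
    · rw [hj]
    · rw [F.form_even _ _ _ _ (F.dual_mem j) (hx i) hj, zero_smul, zero_smul]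
  simp_rw [h1]
  rw [Finset.sum_comm]
  refine Finset.sum_congr rfl fun j _ => ?_
  conv_rhs => rw [← F.sum_form_basis_smul_dual (y j)]
  simp only [map_sum, map_smul, Finset.mul_sum, mul_smul_comm]

/-- The inverse of the inner product is graded symmetric. -/
theorem casimir_symm (L R : ZMod 2 → A →ₗ[ℝ] M) :
    ∑ i : F.Idx, L i.1 (F.basis i) * R i.1 (F.dual i) =
      ∑ i : F.Idx, psign i.1 • (L i.1 (F.dual i) * R i.1 (F.basis i)) := by
  have h1 : ∀ i : F.Idx, psign i.1 • (L i.1 (F.dual i) * R i.1 (F.basis i)) =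
      ∑ j : F.Idx, F.form (F.dual i) (F.dual j) • (L j.1 (F.basis j) * R j.1 (F.basis i)) := by
    intro i
    conv_lhs => rw [← F.sum_form_dual_smul_basis (F.dual i)]
    rw [map_sum, Finset.sum_mul, Finset.smul_sum]
    refine Finset.sum_congr rfl fun j _ => ?_
    rw [map_smul, smul_mul_assoc, smul_smul]
    by_cases hj : j.1 = i.1
    · rw [hj, F.form_symm _ _ _ _ (F.dual_mem i) (F.dual_mem j), hj, parity_mul_self]
    · rw [F.form_even _ _ _ _ (F.dual_mem j) (F.dual_mem i) hj,
        F.form_even _ _ _ _ (F.dual_mem i) (F.dual_mem j) (Ne.symm hj), mul_zero, zero_smul,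
        zero_smul]
  simp_rw [h1]
  rw [Finset.sum_comm]
  refine Finset.sum_congr rfl fun j _ => ?_
  conv_lhs => rw [← F.sum_form_dual_smul_basis (F.dual j)]
  simp only [map_sum, map_smul, Finset.mul_sum, mul_smul_comm]

/-- This and the next two lemmas supply the adjoints needed in `casimir_adjoint`: right
multiplication for left multiplication, left for right, and `∓d` for `d`. -/
theorem adjoint_mulLeft (a : A) (i j : F.Idx) :
    F.form (F.dual j) (a * F.basis i) = F.form (F.dual j * a) (F.basis i) := F.form_mul _ _ _

theorem adjoint_mulRight {q : ZMod 2} {a : A} (ha : a ∈ F.gr q) (i j : F.Idx) :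
    F.form (F.dual j) (F.basis i * a) = F.form (psign q • (a * F.dual j)) (F.basis i) := by
  have hm := F.mul_mem _ _ _ _ (F.dual_mem j) (F.basis_mem i)
  rw [F.form_mul, map_smul, LinearMap.smul_apply, smul_eq_mul, ← F.form_mul a]
  by_cases h : j.1 + i.1 = q
  · rw [F.form_symm _ _ _ _ hm ha, h, parity_mul_self]
  · rw [F.form_even _ _ _ _ hm ha h, F.form_even _ _ _ _ ha hm (Ne.symm h), mul_zero]

theorem adjoint_d (i j : F.Idx) :
    F.form (F.dual j) (F.d (F.basis i)) = F.form (-psign j.1 • F.d (F.dual j)) (F.basis i) := by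
  rw [map_smul, LinearMap.smul_apply, F.form_d _ _ _ (F.dual_mem j), smul_eq_mul, ← mul_assoc,
    neg_mul_neg, psign_mul_self, one_mul]

end Casimir

namespace Hull

variable {F} [IsScalarTower ℝ A A] [SMulCommClass ℝ A A]

/-! ### Windows and handles in the hull -/

/-- The operator `w ↦ ∑ ± eᵢ w eⁱ` on elements of degree `p`. -/
def cas (p : ZMod 2) : F.Hull →ₗ[ℝ] F.Hull :=
  ∑ i : F.Idx, psign (i.1 * p) •
    (LinearMap.mulRight ℝ (inc (F.dual i)) ∘ₗ LinearMap.mulLeft ℝ (inc (F.basis i)))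

theorem cas_apply (p : ZMod 2) (z : F.Hull) :
    cas p z = ∑ i : F.Idx, psign (i.1 * p) • (inc (F.basis i) * z * inc (F.dual i)) := by
  simp [cas]

theorem un_cas (p : ZMod 2) (z : F.Hull) : un (cas p z) = 0 := by
  simp [cas_apply]

theorem cas_mem {p : ZMod 2} {z : F.Hull} (hz : z ∈ hgr F p) : cas p z ∈ hgr F p := by
  rw [cas_apply]
  refine Submodule.sum_mem _ fun i _ => Submodule.smul_mem _ _ ?_
  have := mul_mem (mul_mem (inc_mem (F.basis_mem i)) hz) (inc_mem (F.dual_mem i))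
  rwa [(by decide : ∀ r p : ZMod 2, r + p + r = p) i.1 p] at this

/-- Left multiplication on `eᵢ` passes through the Casimir tensor to right multiplication on `eⁱ`.
This makes `cas p z` graded central for every `z`. -/
theorem inc_mul_cas {p q : ZMod 2} {a : A} (ha : a ∈ F.gr q) (z : F.Hull) :
    inc a * cas p z = psign (p * q) • (cas p z * inc a) := by
  have key := casimir_adjoint (F := F) (M := F.Hull)
    (fun r => psign ((r + q) * p) • LinearMap.mulRight ℝ z ∘ₗ inc) (fun _ => inc)
    (fun i => a * F.basis i) (fun j => F.dual j * a) q (adjoint_mulLeft a)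
    (fun i => add_comm q i.1 ▸ F.mul_mem _ _ _ _ ha (F.basis_mem i))
  simp only [LinearMap.smul_apply, LinearMap.comp_apply, LinearMap.mulRight_apply,
    add_assoc, parity_add_self, add_zero, smul_mul_assoc] at key
  rw [cas_apply, Finset.mul_sum, Finset.sum_mul, Finset.smul_sum]
  calc _ = ∑ i : F.Idx, psign (i.1 * p) • (inc (a * F.basis i) * z * inc (F.dual i)) :=
        Finset.sum_congr rfl fun i _ => by
          rw [mul_smul_comm, mul_assoc, inc_mul_inc_mul _ _ (by simp), mul_assoc]
    _ = _ := key
    _ = _ := Finset.sum_congr rfl fun j _ => by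
      rw [smul_mul_assoc, mul_inc_mul_inc _ _ (by simp), smul_smul, ← psign_add]
      congr 2
      ring

/-- A graded central element of degree `p`. -/
def GradedCentral (p : ZMod 2) (z : F.Hull) : Prop :=
  ∀ (q : ZMod 2) (y : F.Hull), y ∈ hgr F q → y * z = psign (p * q) • (z * y)

/-- Only elements of `A` need to be tested: commutation with `1` is automatic, and `θ` kills `z`
from both sides. -/
theorem gradedCentral_of_inc {p : ZMod 2} {z : F.Hull} (hz : un z = 0)
    (h : ∀ q, ∀ a ∈ F.gr q, inc a * z = psign (p * q) • (z * inc a)) : GradedCentral p z := by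
  intro q y hy
  have := eq_of_hgr (F := F) (p := q) (LinearMap.mulRight ℝ z)
    (psign (p * q) • LinearMap.mulLeft ℝ z) (fun a ha => by simpa using h q a ha)
    (by rintro rfl; simp [psign_zero]) (fun _ => by simp [theta_mul hz, mul_theta hz]) hy
  simpa using this

theorem gradedCentral_cas (p : ZMod 2) (z : F.Hull) : GradedCentral p (cas p z) :=
  gradedCentral_of_inc (un_cas p z) fun _ _ ha => inc_mul_cas ha z

theorem gradedCentral_one : GradedCentral 0 (1 : F.Hull) := by
  intro q y _; simp [psign_zero]

theorem GradedCentral.mul {p q : ZMod 2} {z w : F.Hull} (hz : GradedCentral p z)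
    (hw : GradedCentral q w) : GradedCentral (p + q) (z * w) := by
  intro r y hy
  rw [← mul_assoc, hz r y hy, smul_mul_assoc, mul_assoc, hw r y hy, mul_smul_comm, smul_smul,
    ← psign_add, mul_assoc, add_mul]

theorem GradedCentral.smul_comm {p q : ZMod 2} {z y : F.Hull} (hz : GradedCentral p z)
    (hy : y ∈ hgr F q) : z * y = psign (p * q) • (y * z) := by
  rw [hz q y hy, smul_smul, psign_mul_self, one_smul]

/-- Here right multiplication on `eᵢ` passes to left multiplication on `eⁱ`. The result is the
cyclic invariance of the word on an inner boundary circle. -/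
theorem cas_mul_inc {p q : ZMod 2} {a : A} (ha : a ∈ F.gr q) (x : F.Hull) :
    cas p (x * inc a) = psign ((p + q) * q) • cas p (inc a * x) := by
  have key := casimir_adjoint (F := F) (M := F.Hull)
    (fun r => psign (r * p) • LinearMap.mulRight ℝ x ∘ₗ inc) (fun _ => inc)
    (fun i => F.basis i * a) (fun j => psign q • (a * F.dual j)) q (adjoint_mulRight ha)
    (fun i => F.mul_mem _ _ _ _ (F.basis_mem i) ha)
  simp only [LinearMap.smul_apply, LinearMap.comp_apply, LinearMap.mulRight_apply,
    smul_mul_assoc, map_smul, mul_smul_comm] at key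
  rw [cas_apply, cas_apply, Finset.smul_sum]
  calc _ = psign q • ∑ j : F.Idx, psign (j.1 * p) • psign q •
        (inc (F.basis j) * x * inc (a * F.dual j)) := by
        rw [Finset.smul_sum]
        refine Finset.sum_congr rfl fun j _ => ?_
        rw [smul_comm (psign q), smul_smul (psign q), psign_mul_self, one_smul,
          ← mul_inc_mul_inc _ _ (by simp), mul_assoc (inc (F.basis j)) x]
    _ = psign q • ∑ i : F.Idx, psign ((i.1 + q) * p) •
        (inc (F.basis i * a) * x * inc (F.dual i)) := by
        rw [key]; simp only [smul_comm (psign q)]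
    _ = _ := by
        rw [Finset.smul_sum]
        refine Finset.sum_congr rfl fun i _ => ?_
        rw [mul_assoc (inc (F.basis i * a)), ← inc_mul_inc_mul _ _ (by simp), smul_smul, smul_smul,
          ← psign_add, ← psign_add]
        simp only [mul_assoc]
        congr 2
        exact (by decide : ∀ r p q : ZMod 2, q + (r + q) * p = (p + q) * q + r * p) _ _ _

/-- The element of the hull which represents a handle. -/
def handle : F.Hull := ∑ j : F.Idx, cas j.1 (inc (F.basis j)) * inc (F.dual j)

theorem un_handle : un (handle : F.Hull) = 0 := by simp [handle]

theorem handle_mem : (handle : F.Hull) ∈ hgr F 0 := by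
  refine Submodule.sum_mem _ fun j _ => ?_
  have := mul_mem (cas_mem (inc_mem (F.basis_mem j))) (inc_mem (F.dual_mem j))
  rwa [parity_add_self] at this

/-- An element `a` is carried through `∑ cas(eⱼ) eʲ` in four moves: past `cas(eⱼ)` by centrality,
from `eʲ` to the right of `eⱼ` by adjunction, to its left by cyclicity of `cas`, and to the right of
`eʲ` by the other adjunction. -/
theorem gradedCentral_handle : GradedCentral 0 (handle : F.Hull) := by
  refine gradedCentral_of_inc un_handle fun q a ha => ?_
  have key := casimir_adjoint (F := F) (M := F.Hull)
    (fun r => psign (r * q) • cas r ∘ₗ inc) (fun _ => inc)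
    (fun i => F.basis i * a) (fun j => psign q • (a * F.dual j)) q (adjoint_mulRight ha)
    (fun i => F.mul_mem _ _ _ _ (F.basis_mem i) ha)
  have key2 := casimir_adjoint (F := F) (M := F.Hull)
    (fun r => cas r ∘ₗ inc) (fun _ => inc)
    (fun i => a * F.basis i) (fun j => F.dual j * a) q (adjoint_mulLeft a)
    (fun i => add_comm q i.1 ▸ F.mul_mem _ _ _ _ ha (F.basis_mem i))
  simp only [LinearMap.smul_apply, LinearMap.comp_apply,
    smul_mul_assoc, map_smul, mul_smul_comm] at key key2
  rw [zero_mul, psign_zero, one_smul, handle, Finset.mul_sum, Finset.sum_mul]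
  calc _ = psign q • ∑ j : F.Idx, psign (j.1 * q) • psign q •
        (cas j.1 (inc (F.basis j)) * inc (a * F.dual j)) := by
        rw [Finset.smul_sum]
        refine Finset.sum_congr rfl fun j _ => ?_
        rw [← mul_assoc, inc_mul_cas ha, smul_mul_assoc, mul_inc_mul_inc _ _ (un_cas _ _),
          smul_comm (psign q), smul_smul (psign q), psign_mul_self, one_smul]
    _ = psign q • ∑ i : F.Idx, psign ((i.1 + q) * q) •
        (cas (i.1 + q) (inc (F.basis i * a)) * inc (F.dual i)) := by
        rw [key]; simp only [smul_comm (psign q)]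
    _ = ∑ i : F.Idx, (cas (i.1 + q) (inc (a * F.basis i)) * inc (F.dual i)) := by
        rw [Finset.smul_sum]
        refine Finset.sum_congr rfl fun i _ => ?_
        -- `cas` kills `θ`, so it does not distinguish the product of `A` from that of the hull.
        have h1 : ∀ b c : A, cas (i.1 + q) (inc (b * c)) = cas (i.1 + q) (inc b * inc c : F.Hull) := by
          intro b c
          have : cas (i.1 + q) (theta : F.Hull) = 0 := by
            rw [cas_apply]
            refine Finset.sum_eq_zero fun j _ => ?_
            rw [mul_theta (by simp), zero_mul, smul_zero]
          rw [inc_mul_inc, map_add, map_smul, this, smul_zero, add_zero]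
        rw [h1, cas_mul_inc ha, h1, smul_mul_assoc, smul_smul, smul_smul, ← psign_add, ← psign_add]
        have : q + (i.1 + q) * q + (i.1 + q + q) * q = 0 := by
          exact (by decide : ∀ r q : ZMod 2, q + (r + q) * q + (r + q + q) * q = 0) _ _
        rw [this, psign_zero, one_smul]
    _ = _ := key2
    _ = _ := Finset.sum_congr rfl fun j _ => by rw [mul_inc_mul_inc _ _ (un_cas _ _)]

theorem handle_eq : (handle : F.Hull) = ∑ i : F.Idx, ∑ j : F.Idx, psign (i.1 * j.1) •
    (inc (F.basis i) * inc (F.basis j) * inc (F.dual i) * inc (F.dual j)) := by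
  rw [Finset.sum_comm]
  simp only [handle, cas_apply, Finset.sum_mul, smul_mul_assoc]

theorem handle_eq_symm :
    (handle : F.Hull) = ∑ j : F.Idx, inc (F.basis j) * cas j.1 (inc (F.dual j)) := by
  have := casimir_symm (F := F) (M := F.Hull) (fun _ => inc) (fun r => cas r ∘ₗ inc)
  simp only [LinearMap.comp_apply] at this
  rw [this, handle]
  refine Finset.sum_congr rfl fun j _ => ?_
  rw [inc_mul_cas (F.dual_mem j), smul_smul, parity_mul_self, psign_mul_self, one_smul]

/-! ### Gluing identities for traces -/

variable {p q r : ZMod 2} {u v Z : F.Hull}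

/-- The boundary circle chosen as the outer one is not distinguished. The closing vector `eⁱ` is
moved around the trace, and the graded symmetry of the Casimir tensor restores the order. -/
theorem tr_cas_mul (hu : u ∈ hgr F p) (hv : v ∈ hgr F q) (hZ : Z ∈ hgr F r)
    (cZ : GradedCentral r Z) : tr (cas p u * v * Z) = tr (u * cas q v * Z) := by
  have hs := casimir_symm (F := F) (M := F.Hull)
    (fun r => psign (r * p) • LinearMap.mulRight ℝ u ∘ₗ inc) (fun _ => inc)
  simp only [LinearMap.smul_apply, LinearMap.comp_apply, LinearMap.mulRight_apply,
    smul_mul_assoc] at hs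
  rw [cas_apply, cas_apply, hs]
  simp only [Finset.mul_sum, Finset.sum_mul, map_sum]
  refine Finset.sum_congr rfl fun i _ => ?_
  have hb := inc_mem (F := F) (F.basis_mem i)
  have hd := inc_mem (F := F) (F.dual_mem i)
  have h1 : u * (inc (F.basis i) * v * inc (F.dual i)) * Z =
      psign (r * i.1) • ((u * inc (F.basis i) * v * Z) * inc (F.dual i)) := by
    simp only [mul_assoc]
    rw [cZ _ _ hd]
    simp only [mul_smul_comm]
  have h2 := tr_mul_comm (mul_mem (mul_mem (mul_mem hu hb) hv) hZ) hd
  simp only [smul_mul_assoc, mul_smul_comm, map_smul, smul_eq_mul, h1, h2]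
  simp only [← mul_assoc, ← psign_add]
  congr 2
  exact (by decide : ∀ s p q r : ZMod 2,
    s + s * p = s * q + (r * s + (p + s + q + r) * s)) _ _ _ _

theorem tr_mul_cas_swap (hu : u ∈ hgr F p) (hv : v ∈ hgr F q) (hZ : Z ∈ hgr F r)
    (cZ : GradedCentral r Z) :
    tr (u * cas q v * Z) = psign (p * q) * tr (v * cas p u * Z) := by
  rw [← tr_cas_mul hu hv hZ cZ, (gradedCentral_cas p u).smul_comm hv, smul_mul_assoc, map_smul,
    smul_eq_mul]

/-- A strip from a circle to itself cuts off the part of the word between its ends as a new window.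
-/
theorem sum_tr_split (hu : u ∈ hgr F p) (hv : v ∈ hgr F q) (hZ : Z ∈ hgr F r)
    (cZ : GradedCentral r Z) :
    ∑ x : F.Idx, psign (x.1 * p) * tr (inc (F.basis x) * u * (inc (F.dual x) * v) * Z) =
      tr (u * cas q v * Z) := by
  rw [← tr_cas_mul hu hv hZ cZ, cas_apply]
  simp only [Finset.sum_mul, map_sum, smul_mul_assoc, map_smul, smul_eq_mul, mul_assoc]

/-- By linearity it is enough to take `v` in `A`, `v = 1` and `v = θ`. In the first case adjunction
moves `v` to the front of the sum, which leaves the symmetric form of `handle`; the case of `1` is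
that form, and both sides vanish at `θ`. -/
theorem sum_basis_mul_cas (hv : v ∈ hgr F q) :
    ∑ x : F.Idx, inc (F.basis x) * cas (x.1 + q) (inc (F.dual x) * v) = v * handle := by
  have := eq_of_hgr (F := F) (p := q)
    (∑ x : F.Idx, LinearMap.mulLeft ℝ (inc (F.basis x)) ∘ₗ cas (x.1 + q) ∘ₗ
      LinearMap.mulLeft ℝ (inc (F.dual x)))
    (LinearMap.mulRight ℝ handle) ?_ ?_ ?_ hv
  · simpa using this
  · intro a ha
    have key := casimir_adjoint (F := F) (M := F.Hull)
      (fun _ => inc) (fun r => cas (r + q) ∘ₗ inc)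
      (fun i => a * F.basis i) (fun j => F.dual j * a) q (adjoint_mulLeft a)
      (fun i => add_comm q i.1 ▸ F.mul_mem _ _ _ _ ha (F.basis_mem i))
    simp only [LinearMap.comp_apply, add_assoc, parity_add_self, add_zero] at key
    have ht : ∀ r, cas r (theta : F.Hull) = 0 := fun r => by
      rw [cas_apply]
      refine Finset.sum_eq_zero fun j _ => ?_
      rw [mul_theta (by simp), zero_mul, smul_zero]
    simp only [LinearMap.sum_apply, LinearMap.comp_apply, LinearMap.mulLeft_apply,
      LinearMap.mulRight_apply, inc_mul_inc, map_add, map_smul, ht, smul_zero, add_zero, ← key]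
    rw [handle_eq_symm, Finset.mul_sum]
    exact Finset.sum_congr rfl fun j _ => by rw [inc_mul_inc_mul _ _ (un_cas _ _)]
  · rintro rfl
    simp [handle_eq_symm]
  · intro _
    have h (c : F.Idx) : (inc (F.dual c) * theta : F.Hull) = 0 := mul_theta (un_inc _)
    simp [theta_mul un_handle, h]

/-- A strip between two circles of one surface. The window is central, so it can be brought next to
`eₓ`; `sum_basis_mul_cas` then turns the sum into `v * handle`, and cyclicity returns `v` to its
place behind `u`. -/
theorem sum_tr_merge (hu : u ∈ hgr F p) (hv : v ∈ hgr F q) (hZ : Z ∈ hgr F r)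
    (cZ : GradedCentral r Z) :
    ∑ x : F.Idx, psign (x.1 * p) *
        tr (inc (F.basis x) * u * cas (x.1 + q) (inc (F.dual x) * v) * Z) =
      tr (u * v * (handle * Z)) := by
  have h1 : ∀ x : F.Idx, psign (x.1 * p) *
        tr (inc (F.basis x) * u * cas (x.1 + q) (inc (F.dual x) * v) * Z) =
      psign (q * p) * tr (inc (F.basis x) * cas (x.1 + q) (inc (F.dual x) * v) * u * Z) := by
    intro x
    rw [mul_assoc (inc (F.basis x)) u, gradedCentral_cas _ _ _ _ hu]
    simp only [mul_smul_comm, smul_mul_assoc, map_smul, smul_eq_mul, ← mul_assoc, ← psign_add]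
    congr 2
    exact (by decide : ∀ s p q : ZMod 2, s * p + (s + q) * p = q * p) _ _ _
  simp_rw [h1]
  rw [← Finset.mul_sum, ← map_sum, ← Finset.sum_mul, ← Finset.sum_mul, sum_basis_mul_cas hv]
  have cHZ := gradedCentral_handle (F := F).mul cZ
  have hHZ := mul_mem (handle_mem (F := F)) hZ
  have h2 : v * handle * u * Z = v * (u * (handle * Z)) := by
    have := gradedCentral_handle (F := F) _ _ hu
    rw [zero_mul, psign_zero, one_smul] at this
    simp only [mul_assoc]
    rw [← mul_assoc handle, ← this, mul_assoc]
  rw [h2, tr_mul_comm hv (mul_mem hu hHZ), mul_assoc u, mul_assoc u, cHZ.smul_comm hv]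
  simp only [mul_smul_comm, map_smul, smul_eq_mul, ← mul_assoc, ← psign_add]
  rw [(by decide : ∀ p q r : ZMod 2, q * p + (q * (p + (0 + r)) + (0 + r) * q) = 0) p q r,
    psign_zero, one_mul]

/-- A strip between two surfaces amounts to `∑ ⟨U, eₓ⟩⟨eˣ, V⟩ = ⟨U, V⟩`. Since `x` runs over a basis
of `A` only, this equals `tr (U V)` just when `U` and `V` have no unit component. -/
theorem sum_tr_glue {Z' : F.Hull} (hu : u ∈ hgr F p) (hv : v ∈ hgr F q)
    (hZ : Z ∈ hgr F r) (cZ : GradedCentral r Z) (h1 : un (u * Z) = 0) (h2 : un (v * Z') = 0) :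
    ∑ x : F.Idx, psign (x.1 * (p + r)) *
        (tr (inc (F.basis x) * u * Z) * tr (inc (F.dual x) * v * Z')) =
      psign (q * r) * tr (u * v * (Z * Z')) := by
  have h3 : ∀ x : F.Idx, psign (x.1 * (p + r)) *
        (tr (inc (F.basis x) * u * Z) * tr (inc (F.dual x) * v * Z')) =
      F.form (el (u * Z)) (F.basis x) * F.form (F.dual x) (el (v * Z')) := by
    intro x
    rw [mul_assoc _ u, tr_mul_comm (inc_mem (F.basis_mem x)) (mul_mem hu hZ), mul_assoc _ v,
      ← mul_assoc, ← mul_assoc, psign_mul_self, one_mul]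
    rw [tr_mul _ (inc (F.basis x)), tr_mul (inc (F.dual x)), h1, h2]
    simp
  simp_rw [h3]
  have h4 : tr (u * Z * (v * Z')) = F.form (el (u * Z)) (el (v * Z')) := by
    rw [tr_mul, h1, h2]; simp
  have h5 : u * Z * (v * Z') = psign (q * r) • (u * v * (Z * Z')) := by
    rw [mul_assoc u, ← mul_assoc Z, cZ.smul_comm hv]
    simp only [smul_mul_assoc, mul_smul_comm, mul_assoc]
    rw [mul_comm r q]
  rw [← smul_eq_mul (psign _), ← map_smul, ← h5, h4]
  conv_rhs => rw [← F.sum_form_basis_smul_dual (el (u * Z))]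
  simp

/-! ### The differential of windows and handles -/

/-- The Casimir tensor is closed: the terms with `d eᵢ` and with `d eⁱ` cancel by `adjoint_d`, and
only `d` applied to `z` survives. -/
theorem del_cas {z : F.Hull} (hz : z ∈ hgr F p) : del (cas p z) = cas (p + 1) (del z) := by
  have key := casimir_adjoint (F := F) (M := F.Hull)
    (fun r => psign ((r + 1) * p) • LinearMap.mulRight ℝ z ∘ₗ inc) (fun _ => inc)
    (fun i => F.d (F.basis i)) (fun j => -psign j.1 • F.d (F.dual j)) 1 adjoint_d
    (fun i => F.d_mem _ _ (F.basis_mem i))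
  simp only [LinearMap.smul_apply, LinearMap.comp_apply, LinearMap.mulRight_apply,
    add_assoc, parity_add_self, add_zero, smul_mul_assoc, map_smul, mul_smul_comm] at key
  rw [cas_apply, cas_apply, map_sum]
  have h1 : ∀ i : F.Idx, del (psign (i.1 * p) • (inc (F.basis i) * z * inc (F.dual i))) =
      psign (i.1 * p) • (inc (F.d (F.basis i)) * z * inc (F.dual i)) +
      psign (i.1 * (p + 1)) • (inc (F.basis i) * del z * inc (F.dual i)) +
      psign (i.1 * p + (i.1 + p)) • (inc (F.basis i) * z * inc (F.d (F.dual i))) := by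
    intro i
    have hb := inc_mem (F := F) (F.basis_mem i)
    rw [map_smul, del_mul (mul_mem hb hz), del_mul hb, del_inc, del_inc, add_mul, smul_add,
      smul_add, smul_mul_assoc, smul_smul, smul_smul, ← psign_add, ← psign_add, mul_add, mul_one]
  simp_rw [h1]
  rw [Finset.sum_add_distrib, Finset.sum_add_distrib, key]
  have h2 : ∀ i : F.Idx, -psign i.1 • psign ((i.1 + 1) * p) •
      (inc (F.basis i) * z * inc (F.d (F.dual i))) =
      - (psign (i.1 * p + (i.1 + p)) • (inc (F.basis i) * z * inc (F.d (F.dual i)))) := by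
    intro i
    rw [smul_smul, neg_mul, neg_smul, ← psign_add]
    congr 3
    ring
  simp_rw [h2]
  rw [Finset.sum_neg_distrib]
  abel

/-- The same cancellation for the outer Casimir tensor, after `del_cas` has dealt with the inner
one. -/
theorem del_handle : del (handle : F.Hull) = 0 := by
  have key := casimir_adjoint (F := F) (M := F.Hull)
    (fun r => cas r ∘ₗ inc) (fun _ => inc)
    (fun i => F.d (F.basis i)) (fun j => -psign j.1 • F.d (F.dual j)) 1 adjoint_d
    (fun i => F.d_mem _ _ (F.basis_mem i))
  simp only [LinearMap.comp_apply, map_smul, mul_smul_comm] at key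
  have h1 : ∀ j : F.Idx, del (cas j.1 (inc (F.basis j)) * inc (F.dual j) : F.Hull) =
      cas (j.1 + 1) (inc (F.d (F.basis j))) * inc (F.dual j) +
        psign j.1 • (cas j.1 (inc (F.basis j)) * inc (F.d (F.dual j))) := by
    intro j
    have hb := inc_mem (F := F) (F.basis_mem j)
    rw [del_mul (cas_mem hb), del_cas hb, del_inc, del_inc]
  rw [handle, map_sum]
  simp_rw [h1]
  rw [Finset.sum_add_distrib, key]
  simp [neg_smul, Finset.sum_neg_distrib]

end Hull

end DGFrobenius

end

noncomputable section

namespace DGFrobenius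

variable {A : Type*} [NonUnitalRing A] [Module ℝ A] {F : DGFrobenius A}

/-- The total parity of a word. -/
def par (l : List F.Idx) : ZMod 2 := (l.map Sigma.fst).sum

@[simp] theorem par_nil : par ([] : List F.Idx) = 0 := rfl

@[simp] theorem par_cons (i : F.Idx) (l : List F.Idx) : par (i :: l) = i.1 + par l := by
  simp [par]

@[simp] theorem par_append (l l' : List F.Idx) : par (l ++ l') = par l + par l' := by
  simp [par]

variable [FiniteDimensional ℝ A] [IsScalarTower ℝ A A] [SMulCommClass ℝ A A]

open Hull

/-! ### The open topological field theory in the hull -/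

/-- The product of a word of basis vectors in the hull. -/
def word (l : List F.Idx) : F.Hull := (l.map fun i => inc (F.basis i)).prod

@[simp] theorem word_nil : word ([] : List F.Idx) = 1 := rfl

@[simp] theorem word_cons (i : F.Idx) (l : List F.Idx) :
    word (i :: l) = inc (F.basis i) * word l := by simp [word]

@[simp] theorem word_append (l l' : List F.Idx) : word (l ++ l') = word l * word l' := by
  simp [word]

theorem word_mem (l : List F.Idx) : word l ∈ hgr F (par l) := by
  induction l with
  | nil => exact one_mem
  | cons i l ih => rw [word_cons, par_cons]; exact Hull.mul_mem (inc_mem (F.basis_mem i)) ih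

/-- The central element of the hull which represents a boundary circle. -/
def window (l : List F.Idx) : F.Hull := cas (par l) (word l)

theorem window_mem (l : List F.Idx) : window l ∈ hgr F (par l) := cas_mem (word_mem l)

/-- The central element of the hull which represents some boundary circles and handles. -/
def rest (ls : List (List F.Idx)) (g : ℕ) : F.Hull := (ls.map window).prod * handle ^ g

theorem handle_pow_mem (g : ℕ) : (handle ^ g : F.Hull) ∈ hgr F 0 := by
  induction g with
  | zero => exact one_mem
  | succ g ih => rw [pow_succ]; simpa using Hull.mul_mem ih handle_mem

theorem gradedCentral_handle_pow (g : ℕ) : GradedCentral 0 (handle ^ g : F.Hull) := by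
  induction g with
  | zero => exact gradedCentral_one
  | succ g ih => rw [pow_succ]; simpa using ih.mul gradedCentral_handle

@[simp] theorem rest_cons (l : List F.Idx) (ls : List (List F.Idx)) (g : ℕ) :
    rest (l :: ls) g = window l * rest ls g := by simp [rest, mul_assoc]

theorem rest_mem (ls : List (List F.Idx)) (g : ℕ) : rest ls g ∈ hgr F (par ls.flatten) := by
  induction ls with
  | nil => simpa [rest] using handle_pow_mem g
  | cons l ls ih =>
    rw [rest_cons, List.flatten_cons, par_append]; exact Hull.mul_mem (window_mem l) ih

theorem gradedCentral_rest (ls : List (List F.Idx)) (g : ℕ) :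
    GradedCentral (par ls.flatten) (rest ls g) := by
  induction ls with
  | nil => simpa [rest] using gradedCentral_handle_pow g
  | cons l ls ih =>
    rw [rest_cons, List.flatten_cons, par_append]; exact (gradedCentral_cas _ _).mul ih

theorem rest_append (ls ls' : List (List F.Idx)) (g g' : ℕ) :
    rest (ls ++ ls') (g + g') = rest ls g * rest ls' g' := by
  induction ls with
  | nil =>
    have h := (gradedCentral_handle_pow (F := F) g).smul_comm
      (rest_mem ls' 0)
    rw [zero_mul, psign_zero, one_smul] at h
    simp only [rest, List.nil_append, List.map_nil, List.prod_nil, one_mul, pow_zero, mul_one,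
      pow_add, ← mul_assoc] at h ⊢
    rw [h]
  | cons l ls ih => rw [List.cons_append, rest_cons, rest_cons, ih, mul_assoc]

/-- The conventional values `0` on words of length less than two are correct because `tr` vanishes
on `1` and on `A`. For longer words, merging the first two letters is harmless: the remaining factor
has no unit component. -/
theorem disk_eq (l : List A) : F.disk l = tr (l.map (inc (F := F))).prod := by
  induction l using DGFrobenius.disk.induct with
  | case1 => simp [disk]
  | case2 a => simp [disk]
  | case3 a b => simp [disk]
  | case4 a b c l ih =>
    rw [disk, ih]
    simp only [List.map_cons, List.prod_cons]
    rw [inc_mul_inc_mul a b (x := inc c * _) (by simp)]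

theorem handles_eq (g : ℕ) (acc : List A) :
    F.handles g acc = tr ((acc.map (inc (F := F))).prod * handle ^ g) := by
  induction g generalizing acc with
  | zero => simp [handles, disk_eq]
  | succ g ih =>
    rw [handles, pow_succ']
    conv_rhs => enter [2, 2, 1]; rw [handle_eq]
    simp only [ih, List.map_append, List.prod_append, List.map_cons, List.map_nil, List.prod_cons,
      List.prod_nil, mul_one, Finset.sum_mul, Finset.mul_sum, map_sum, smul_mul_assoc,
      mul_smul_comm, map_smul, smul_eq_mul, mul_assoc]

theorem map_inc_basis (w : List F.Idx) :
    ((w.map F.basis).map (inc (F := F))).prod = word w := by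
  simp [word, Function.comp_def]

theorem windows_eq (ws : List (List F.Idx)) (g : ℕ) (acc : List A) :
    F.windows ws g acc = tr ((acc.map (inc (F := F))).prod * rest ws g) := by
  induction ws generalizing acc with
  | nil => simp [windows, handles_eq, rest]
  | cons w ws ih =>
    rw [windows, rest_cons, window, cas_apply]
    simp only [ih, List.map_append, List.prod_append, map_inc_basis, List.map_cons, List.map_nil,
      List.prod_cons,
      List.prod_nil, mul_one, Finset.sum_mul, Finset.mul_sum, map_sum, smul_mul_assoc,
      mul_smul_comm, map_smul, smul_eq_mul, mul_assoc, par]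

theorem otft_cons (g : ℕ) (w : List F.Idx) (ws : List (List F.Idx)) :
    F.otft g (w :: ws) = tr (word w * rest ws g) := by
  rw [otft, windows_eq, map_inc_basis]

theorem otft_parity (g : ℕ) (ls : List (List F.Idx)) (h : par ls.flatten ≠ 0) :
    F.otft g ls = 0 := by
  cases ls with
  | nil => rfl
  | cons w ws =>
    rw [otft_cons]
    refine tr_of_odd (Hull.mul_mem (word_mem w) (rest_mem ws g)) ?_
    simpa using h

/-- The word is rotated one letter at a time by `cas_mul_inc`. -/
theorem cas_word_rotate (u v : List F.Idx) :
    window (u ++ v) = psign (par u * par v) • window (v ++ u) := by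
  induction v generalizing u with
  | nil => simp [psign_zero]
  | cons x v ih =>
    have h1 := ih (u ++ [x])
    rw [List.append_assoc, List.singleton_append] at h1
    rw [h1]
    have h2 : window (v ++ (u ++ [x])) =
        psign (x.1 * (par v + par u)) • window (x :: v ++ u) := by
      simp only [window, word_append, word_cons, word_nil, mul_one, ← mul_assoc]
      rw [cas_mul_inc (F.basis_mem x), mul_assoc]
      simp only [par_append, par_cons, par_nil, add_zero, List.cons_append]
      have e1 : par v + (par u + x.1) = x.1 + (par v + par u) := by ring
      rw [e1]
      congr 2
      exact (by decide : ∀ x a : ZMod 2, (x + a + x) * x = x * a) _ _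
    rw [h2, smul_smul, ← psign_add]
    simp only [par_append, par_cons, par_nil]
    congr 2
    exact (by decide : ∀ u v x : ZMod 2, (u + (x + 0)) * v + x * (v + u) = u * (x + v)) _ _ _

theorem rest_middle (fr bk : List (List F.Idx)) (g : ℕ) (l : List F.Idx) :
    rest (fr ++ l :: bk) g = rest fr 0 * (window l * rest bk g) := by
  rw [← rest_cons, ← rest_append, zero_add]

/-- For the first circle this is cyclicity of the trace together with centrality of the rest; for
any other circle it is cyclicity of `cas`. -/
theorem otft_rotate (g : ℕ) (fr bk : List (List F.Idx)) (u v : List F.Idx) :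
    F.otft g (fr ++ (u ++ v) :: bk) =
      psign (par u * par v) * F.otft g (fr ++ (v ++ u) :: bk) := by
  cases fr with
  | nil =>
    simp only [List.nil_append, otft_cons, word_append]
    rw [mul_assoc, tr_mul_comm (word_mem u) (Hull.mul_mem (word_mem v) (rest_mem bk g)), mul_assoc,
      mul_assoc, gradedCentral_rest bk g _ _ (word_mem u)]
    simp only [mul_smul_comm, map_smul, smul_eq_mul, ← mul_assoc, ← psign_add]
    congr 2
    exact (by decide : ∀ u v r : ZMod 2, u * (v + r) = u * v + r * u) _ _ _
  | cons w fr =>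
    simp only [List.cons_append, otft_cons, rest_middle]
    rw [cas_word_rotate]
    simp only [smul_mul_assoc, mul_smul_comm, map_smul, smul_eq_mul]

/-- Two inner circles are graded central elements and commute up to sign. Exchanging the outer
circle with an inner one is `tr_mul_cas_swap`. -/
theorem otft_swap (g : ℕ) (fr bk : List (List F.Idx)) (u v : List F.Idx) :
    F.otft g (fr ++ u :: v :: bk) = psign (par u * par v) * F.otft g (fr ++ v :: u :: bk) := by
  cases fr with
  | nil =>
    simp only [List.nil_append, otft_cons, rest_cons, ← mul_assoc]
    exact tr_mul_cas_swap (word_mem u) (word_mem v) (rest_mem bk g) (gradedCentral_rest bk g)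
  | cons w fr =>
    simp only [List.cons_append, otft_cons, rest_middle, rest_cons, ← mul_assoc]
    rw [mul_assoc _ (window u),
      GradedCentral.smul_comm (z := window u) (gradedCentral_cas _ _) (window_mem v)]
    simp only [smul_mul_assoc, mul_smul_comm, map_smul, smul_eq_mul, mul_assoc]

/-! ### Gluing strips -/

/-- The components of the inverse of the inner product. -/
def inv (F : DGFrobenius A) (x y : F.Idx) : ℝ := F.basis.repr (F.dual x) y

theorem inv_eq_zero {x y : F.Idx} (h : x.1 ≠ y.1) : F.inv x y = 0 := by
  rw [inv, basis_repr, F.form_even _ _ _ _ (F.dual_mem y) (F.dual_mem x) (Ne.symm h)]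

theorem sum_inv_smul {M : Type*} [AddCommGroup M] [Module ℝ M] (L : A →ₗ[ℝ] M) (x : F.Idx) :
    ∑ y, F.inv x y • L (F.basis y) = L (F.dual x) := by
  conv_rhs => rw [← F.basis.sum_repr (F.dual x)]
  simp only [inv, map_sum, map_smul]

theorem otft_split (g : ℕ) (u v : List F.Idx) (ls : List (List F.Idx)) :
    ∑ x, ∑ y, F.inv x y * (psign (x.1 * par u) * F.otft g ((x :: u ++ y :: v) :: ls)) =
      F.otft g (u :: v :: ls) := by
  have key := sum_tr_split (word_mem u) (word_mem v) (rest_mem ls g) (gradedCentral_rest ls g)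
  rw [otft_cons, rest_cons, ← mul_assoc, window, ← key]
  refine Finset.sum_congr rfl fun x _ => ?_
  have := sum_inv_smul (F := F) (psign (x.1 * par u) • (tr ∘ₗ
    LinearMap.mulRight ℝ (word v * rest ls g) ∘ₗ
    LinearMap.mulLeft ℝ (inc (F.basis x) * word u) ∘ₗ inc)) x
  simp only [LinearMap.smul_apply, LinearMap.comp_apply, LinearMap.mulRight_apply,
    LinearMap.mulLeft_apply, smul_eq_mul] at this
  simp only [otft_cons, word_append, word_cons, mul_assoc] at this ⊢
  exact this

theorem otft_merge (g : ℕ) (u v : List F.Idx) (ls : List (List F.Idx)) :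
    ∑ x, ∑ y, F.inv x y * (psign (x.1 * par u) * F.otft g ((x :: u) :: (y :: v) :: ls)) =
      F.otft (g + 1) ((u ++ v) :: ls) := by
  have key := sum_tr_merge (word_mem u) (word_mem v) (rest_mem ls g) (gradedCentral_rest ls g)
  have h1 : handle * rest ls g = rest ls (g + 1) := by
    have := (gradedCentral_handle (F := F)).smul_comm (rest_mem ls g)
    rw [zero_mul, psign_zero, one_smul] at this
    rw [this, rest, rest, pow_succ, mul_assoc]
  rw [otft_cons, word_append, ← h1, ← key]
  refine Finset.sum_congr rfl fun x _ => ?_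
  have := sum_inv_smul (F := F) (psign (x.1 * par u) • (tr ∘ₗ
    LinearMap.mulRight ℝ (rest ls g) ∘ₗ
    LinearMap.mulLeft ℝ (inc (F.basis x) * word u) ∘ₗ cas (x.1 + par v) ∘ₗ
    LinearMap.mulRight ℝ (word v) ∘ₗ inc)) x
  simp only [LinearMap.smul_apply, LinearMap.comp_apply, LinearMap.mulRight_apply,
    LinearMap.mulLeft_apply, smul_eq_mul] at this
  rw [← this]
  refine Finset.sum_congr rfl fun y _ => ?_
  by_cases hxy : x.1 = y.1
  · simp only [otft_cons, rest_cons, window, par_cons, word_cons, mul_assoc, hxy]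
  · rw [inv_eq_zero hxy, zero_mul, zero_mul]

/-- The excluded case is the empty product, equal to `1`. With one further letter in front, it is
the disk with a single interval. -/
theorem un_word_mul_rest {g : ℕ} {u : List F.Idx} {ls : List (List F.Idx)}
    (h : u ≠ [] ∨ ls ≠ [] ∨ g ≠ 0) : un (word u * rest ls g) = 0 := by
  cases u with
  | cons x u => simp
  | nil =>
    cases ls with
    | cons l ls => simp [window, un_cas]
    | nil =>
      cases g with
      | zero => simp at h
      | succ g => simp [rest, pow_succ, un_handle]

/-- The sign on the right is the cost of moving `v` past the inner circles of the first surface, so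
that it can join `u`. -/
theorem otft_glue (g g' : ℕ) (u v : List F.Idx) (ls ls' : List (List F.Idx))
    (h : u ≠ [] ∨ ls ≠ [] ∨ g ≠ 0) (h' : v ≠ [] ∨ ls' ≠ [] ∨ g' ≠ 0) :
    ∑ x, ∑ y, F.inv x y * (psign (x.1 * (par u + par ls.flatten)) *
        (F.otft g ((x :: u) :: ls) * F.otft g' ((y :: v) :: ls'))) =
      psign (par v * par ls.flatten) * F.otft (g + g') ((u ++ v) :: (ls ++ ls')) := by
  have key := sum_tr_glue (word_mem u) (word_mem v) (rest_mem ls g) (gradedCentral_rest ls g)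
    (un_word_mul_rest h) (un_word_mul_rest h')
  rw [otft_cons, word_append, rest_append, ← key]
  refine Finset.sum_congr rfl fun x _ => ?_
  have := sum_inv_smul (F := F) (psign (x.1 * (par u + par ls.flatten)) •
    tr (inc (F.basis x) * word u * rest ls g) • (tr ∘ₗ
    LinearMap.mulRight ℝ (word v * rest ls' g') ∘ₗ inc)) x
  simp only [LinearMap.smul_apply, LinearMap.comp_apply, LinearMap.mulRight_apply,
    smul_eq_mul] at this
  simp only [otft_cons, word_cons, mul_assoc] at this ⊢
  exact this

/-! ### The differential of multilinear maps -/

/-- The components of the differential. -/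
def dmat (F : DGFrobenius A) (x y : F.Idx) : ℝ := F.basis.repr (F.d (F.basis y)) x

theorem dmat_eq_zero {x y : F.Idx} (h : x.1 ≠ y.1 + 1) : F.dmat x y = 0 := by
  rw [dmat, basis_repr, F.form_even _ _ _ _ (F.dual_mem x) (F.d_mem _ _ (F.basis_mem y)) h]

variable {H : Type*} [DecidableEq H] {M N : Type*} [AddCommGroup M] [Module ℝ M]
  [AddCommGroup N] [Module ℝ N]

/-- The sum, over the inputs in the given list, of the multilinear map `G` with the differential
applied to this input. -/
def dsum : List H → ((H → F.Idx) → M) → (H → F.Idx) → M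
  | [], _, _ => 0
  | h :: l, G, f => ∑ x, F.dmat x (f h) • G (Function.update f h x) + psign (f h).1 • dsum l G f

theorem dsum_append (l l' : List H) (G : (H → F.Idx) → M) (f : H → F.Idx) :
    dsum (l ++ l') G f = dsum l G f + psign (par (l.map f)) • dsum l' G f := by
  induction l with
  | nil => simp [dsum, psign_zero]
  | cons h l ih => simp [dsum, ih, psign_add, mul_smul, add_assoc]

/-- Since `d` is odd, only labels of the opposite parity contribute. This restriction is needed for
`cas`, whose parity index depends on the labels. -/
theorem dsum_map (L : M →ₗ[ℝ] N) (l : List H) (G : (H → F.Idx) → M) (G' : (H → F.Idx) → N)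
    (f : H → F.Idx)
    (hG : ∀ h ∈ l, ∀ x : F.Idx, x.1 = (f h).1 + 1 →
      G' (Function.update f h x) = L (G (Function.update f h x))) :
    dsum l G' f = L (dsum l G f) := by
  induction l with
  | nil => simp [dsum]
  | cons h l ih =>
    rw [dsum, dsum, map_add, map_sum, map_smul, ih fun h' hh' => hG h' (List.mem_cons_of_mem _ hh')]
    congr 1
    refine Finset.sum_congr rfl fun x _ => ?_
    rw [map_smul]
    by_cases hx : x.1 = (f h).1 + 1
    · rw [hG h List.mem_cons_self x hx]
    · rw [dmat_eq_zero hx, zero_smul, zero_smul]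

theorem par_map_update {l : List H} (hl : l.Nodup) {h : H} (hh : h ∈ l) (f : H → F.Idx) {x : F.Idx}
    (hx : x.1 = (f h).1 + 1) : par (l.map (Function.update f h x)) = par (l.map f) + 1 := by
  induction l with
  | nil => simp at hh
  | cons y l ih =>
    rw [List.nodup_cons] at hl
    by_cases hy : h = y
    · subst hy
      have : l.map (Function.update f h x) = l.map f := List.map_congr_left fun z hz =>
        Function.update_of_ne (fun hzh : z = h => hl.1 (hzh ▸ hz)) _ _
      rw [List.map_cons, List.map_cons, par_cons, par_cons, this, Function.update_self, hx]
      ring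
    · rw [List.map_cons, List.map_cons, par_cons, par_cons,
        ih hl.2 ((List.mem_cons.1 hh).resolve_left hy), Function.update_of_ne (Ne.symm hy)]
      ring

/-- A multilinear map with values in the hull, with inputs in the given list, is compatible with the
gradings and the differentials. -/
structure IsDer (l : List H) (G : (H → F.Idx) → F.Hull) : Prop where
  nodup : l.Nodup
  congr : ∀ f f', (∀ h ∈ l, f h = f' h) → G f = G f'
  mem : ∀ f, G f ∈ hgr F (par (l.map f))
  del_eq : ∀ f, del (G f) = dsum l G f

theorem IsDer.mul {l l' : List H} {G G' : (H → F.Idx) → F.Hull} (hG : IsDer l G)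
    (hG' : IsDer l' G') (hl : (l ++ l').Nodup) : IsDer (l ++ l') (fun f => G f * G' f) where
  nodup := hl
  congr f f' h := by
    rw [hG.congr f f' fun x hx => h x (List.mem_append_left _ hx),
      hG'.congr f f' fun x hx => h x (List.mem_append_right _ hx)]
  mem f := by
    rw [List.map_append, par_append]; exact Hull.mul_mem (hG.mem f) (hG'.mem f)
  del_eq f := by
    rw [del_mul (hG.mem f), hG.del_eq, hG'.del_eq, dsum_append]
    have hd := List.disjoint_of_nodup_append hl
    congr 1
    · rw [dsum_map (LinearMap.mulRight ℝ (G' f)) l G (fun f => G f * G' f)]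
      · rfl
      · intro h hh x _
        rw [LinearMap.mulRight_apply, hG'.congr (Function.update f h x) f]
        intro y hy
        exact Function.update_of_ne (fun e : y = h => hd hh (e ▸ hy)) _ _
    · rw [dsum_map (LinearMap.mulLeft ℝ (G f)) l' G' (fun f => G f * G' f)]
      · rfl
      · intro h hh x _
        rw [LinearMap.mulLeft_apply, hG.congr (Function.update f h x) f]
        intro y hy
        exact Function.update_of_ne (fun e : y = h => hd (e ▸ hy) hh) _ _

theorem IsDer.const {z : F.Hull} (hz : z ∈ hgr F 0) (hd : del z = 0) :
    IsDer ([] : List H) (fun _ => z) :=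
  ⟨List.nodup_nil, fun _ _ _ => rfl, fun _ => hz, fun _ => hd⟩

theorem IsDer.single (h : H) : IsDer [h] (fun f => (inc (F.basis (f h)) : F.Hull)) where
  nodup := List.nodup_singleton h
  congr f f' hf := by rw [hf h (by simp)]
  mem f := by simpa using inc_mem (F.basis_mem (f h))
  del_eq f := by
    simp only [dsum, Function.update_self, smul_zero, add_zero, del_inc]
    conv_lhs => rw [← F.basis.sum_repr (F.d (F.basis (f h)))]
    simp only [dmat, map_sum, map_smul]

/-- When `d` hits an input, the parity of the word rises by one, which is the shift of the index in
`del_cas`. -/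
theorem IsDer.cas {l : List H} {G : (H → F.Idx) → F.Hull} (hG : IsDer l G) :
    IsDer l (fun f => Hull.cas (par (l.map f)) (G f)) where
  nodup := hG.nodup
  congr f f' hf := by
    rw [hG.congr f f' hf, List.map_congr_left hf]
  mem f := cas_mem (hG.mem f)
  del_eq f := by
    rw [del_cas (hG.mem f), hG.del_eq, ← dsum_map]
    intro h hh x hx
    rw [par_map_update hG.nodup hh f hx]

theorem isDer_word {l : List H} (hl : l.Nodup) : IsDer l (fun f => word (l.map f) : _ → F.Hull) := by
  induction l with
  | nil => exact IsDer.const one_mem del_one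
  | cons h l ih => exact (IsDer.single h).mul (ih (List.nodup_cons.1 hl).2) hl

theorem del_handle_pow (g : ℕ) : del (handle ^ g : F.Hull) = 0 := by
  induction g with
  | zero => exact del_one
  | succ g ih => rw [pow_succ, del_mul (handle_pow_mem g), ih, del_handle]; simp

theorem isDer_rest {ls : List (List H)} (hl : ls.flatten.Nodup) (g : ℕ) :
    IsDer ls.flatten (fun f => rest (ls.map (List.map f)) g : _ → F.Hull) := by
  induction ls with
  | nil => simpa [rest] using IsDer.const (handle_pow_mem g) (del_handle_pow g)
  | cons l ls ih =>
    rw [List.flatten_cons] at hl ⊢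
    simp only [List.map_cons, rest_cons, window]
    exact (isDer_word hl.of_append_left).cas.mul (ih hl.of_append_right) hl

/-- The maps of the open topological field theory are compatible with the differential. -/
theorem dsum_otft {ls : List (List H)} (hl : ls.flatten.Nodup) (g : ℕ) (f : H → F.Idx) :
    dsum ls.flatten (fun f => F.otft g (ls.map (List.map f))) f = 0 := by
  cases ls with
  | nil => rfl
  | cons l ls =>
    have hD := (isDer_word hl.of_append_left).mul (isDer_rest (F := F) hl.of_append_right g) hl
    -- The trace vanishes on the image of the differential.
    have := congrArg tr (hD.del_eq f)
    rw [tr_del, ← dsum_map tr _ _ (fun f => F.otft g ((l :: ls).map (List.map f)))] at this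
    · exact this.symm
    · intro h _ x _
      simp only [List.map_cons, otft_cons]

theorem otft_congr {ls : List (List H)} (g : ℕ) {f f' : H → F.Idx}
    (h : ∀ x ∈ ls.flatten, f x = f' x) :
    F.otft g (ls.map (List.map f)) = F.otft g (ls.map (List.map f')) := by
  congr 1
  refine List.map_congr_left fun l hl => List.map_congr_left fun x hx => h x ?_
  exact List.mem_flatten.2 ⟨l, hl, hx⟩

end DGFrobenius

end

noncomputable section

/-! ### Koszul signs of lists of half-edges -/

section Koszul

variable {m : ℕ}

/-- The Koszul sign of a pair of half-edges which are listed in this order. -/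
def pairSign (q : Fin m × Bool → ZMod 2) (x y : Fin m × Bool) : ℝ :=
  if y.1 < x.1 ∨ (y.1 = x.1 ∧ y.2 < x.2) then psign (q x * q y) else 1

/-- The product of the Koszul signs of the pairs from two lists. -/
def cross (q : Fin m × Bool → ZMod 2) (l l' : List (Fin m × Bool)) : ℝ :=
  (l.map fun x => (l'.map fun y => pairSign q x y).prod).prod

variable (q : Fin m × Bool → ZMod 2)

theorem koszul_nil : koszul q [] = 1 := rfl

theorem cross_nil_right (l : List (Fin m × Bool)) : cross q l [] = 1 := by simp [cross]

theorem cross_nil_left (l : List (Fin m × Bool)) : cross q [] l = 1 := by simp [cross]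

theorem cross_append_left (a b c : List (Fin m × Bool)) :
    cross q (a ++ b) c = cross q a c * cross q b c := by simp [cross]

theorem cross_append_right (a b c : List (Fin m × Bool)) :
    cross q a (b ++ c) = cross q a b * cross q a c := by
  simp [cross, List.prod_map_mul]

theorem cross_cons_left (x : Fin m × Bool) (a b : List (Fin m × Bool)) :
    cross q (x :: a) b = cross q [x] b * cross q a b := cross_append_left q [x] a b

theorem cross_cons_right (x : Fin m × Bool) (a b : List (Fin m × Bool)) :
    cross q a (x :: b) = cross q a [x] * cross q a b := cross_append_right q a [x] b

theorem cross_single (x y : Fin m × Bool) : cross q [x] [y] = pairSign q x y := by simp [cross]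

theorem koszul_cons (x : Fin m × Bool) (l : List (Fin m × Bool)) :
    koszul q (x :: l) = cross q [x] l * koszul q l := by
  simp [koszul, cross, pairSign]

theorem koszul_append (a b : List (Fin m × Bool)) :
    koszul q (a ++ b) = koszul q a * cross q a b * koszul q b := by
  induction a with
  | nil => simp [koszul_nil, cross_nil_left]
  | cons x a ih =>
    rw [List.cons_append, koszul_cons, ih, koszul_cons, cross_append_right, cross_cons_left q x a b]
    ring

theorem pairSign_comm {x y : Fin m × Bool} (h : x ≠ y) :
    pairSign q x y = psign (q x * q y) * pairSign q y x := by
  have hb : ∀ a b : Bool, a ≠ b → (a < b ↔ ¬ b < a) := by decide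
  unfold pairSign
  obtain ⟨e, b⟩ := x
  obtain ⟨e', b'⟩ := y
  rcases lt_trichotomy e e' with h1 | rfl | h1
  · simp [h1, h1.ne', h1.ne, h1.not_gt, mul_comm (q (e', b')), psign_mul_self]
  · have hbb : b ≠ b' := fun hb => h (by rw [hb])
    by_cases h2 : b' < b
    · simp [h2, (hb _ _ hbb.symm).1 h2]
    · simp [h2, (hb _ _ hbb).2 h2, mul_comm (q (e, b')), psign_mul_self]
  · simp [h1, h1.ne', h1.ne, h1.not_gt, psign_mul_self]

theorem cross_comm {l l' : List (Fin m × Bool)} (h : l.Disjoint l') :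
    cross q l l' = psign ((l.map q).sum * (l'.map q).sum) * cross q l' l := by
  have h1 : ∀ (x : Fin m × Bool) (l' : List (Fin m × Bool)), x ∉ l' →
      cross q [x] l' = psign (q x * (l'.map q).sum) * cross q l' [x] := by
    intro x l' hx
    induction l' with
    | nil => simp [cross_nil_right, cross_nil_left, psign_zero]
    | cons y l' ih =>
      rw [List.mem_cons, not_or] at hx
      rw [cross_cons_right, ih hx.2, cross_single, cross_cons_left, cross_single,
        pairSign_comm q hx.1, List.map_cons, List.sum_cons, mul_add, psign_add]
      ring
  induction l with
  | nil => simp [cross_nil_right, cross_nil_left, psign_zero]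
  | cons x l ih =>
    rw [List.disjoint_cons_left] at h
    rw [cross_cons_left, ih h.2, h1 x l' h.1, cross_cons_right q x l' l, List.map_cons,
      List.sum_cons, add_mul, psign_add]
    ring

/-- Only the pairs between `u` and `v` change their relative order, and each contributes the product
of its parities. -/
theorem koszul_swap {a u v b : List (Fin m × Bool)} (h : u.Disjoint v) :
    koszul q (a ++ (u ++ (v ++ b))) =
      psign ((u.map q).sum * (v.map q).sum) * koszul q (a ++ (v ++ (u ++ b))) := by
  simp only [koszul_append, cross_append_right, cross_comm q h]
  ring

theorem pairSign_mul_self (x y : Fin m × Bool) : pairSign q x y * pairSign q x y = 1 := by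
  unfold pairSign
  split_ifs
  · exact psign_mul_self _
  · exact one_mul 1

theorem cross_mul_self (l l' : List (Fin m × Bool)) : cross q l l' * cross q l l' = 1 := by
  simp only [cross, ← List.prod_map_mul, pairSign_mul_self, List.map_const', List.prod_replicate,
    one_pow]

theorem koszul_mul_self (l : List (Fin m × Bool)) : koszul q l * koszul q l = 1 := by
  induction l with
  | nil => simp [koszul_nil]
  | cons x l ih => rw [koszul_cons, mul_mul_mul_comm, cross_mul_self, ih, one_mul]

variable {q} in
theorem koszul_congr {q' : Fin m × Bool → ZMod 2} {l : List (Fin m × Bool)}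
    (h : ∀ x ∈ l, q x = q' x) : koszul q l = koszul q' l := by
  induction l with
  | nil => rfl
  | cons x l ih =>
    rw [koszul, koszul, ih fun y hy => h y (List.mem_cons_of_mem _ hy), h x List.mem_cons_self]
    congr 2
    refine List.map_congr_left fun y hy => ?_
    rw [h y (List.mem_cons_of_mem _ hy)]

/-- Two halves of one edge, with equal parities, do not contribute to the Koszul sign. -/
theorem koszul_pair (i : Fin m) {l : List (Fin m × Bool)} (h0 : (i, false) ∉ l) (h1 : (i, true) ∉ l)
    (hq : q (i, false) = q (i, true)) : koszul q ((i, false) :: (i, true) :: l) = koszul q l := by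
  rw [koszul_cons, koszul_cons, cross_cons_right, cross_single]
  have h2 : cross q [(i, false)] l = cross q [(i, true)] l := by
    simp only [cross, List.map_cons, List.map_nil, List.prod_singleton]
    congr 1
    refine List.map_congr_left fun y hy => ?_
    have hy1 : ¬ y.1 = i := by
      rintro rfl
      rcases hb : y.2 with _ | _
      · exact h0 (by rw [← hb]; exact hy)
      · exact h1 (by rw [← hb]; exact hy)
    simp [pairSign, hq, hy1]
  have h3 : pairSign q (i, false) (i, true) = 1 := by simp [pairSign]
  rw [h2, h3, one_mul, ← mul_assoc, cross_mul_self, one_mul]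

/-- Koszul signs are compatible with order preserving maps of the edges. -/
theorem koszul_map {k : ℕ} (φ : Fin k → Fin m) (hφ : StrictMono φ) (l : List (Fin k × Bool)) :
    koszul q (l.map fun x => (φ x.1, x.2)) = koszul (fun x => q (φ x.1, x.2)) l := by
  induction l with
  | nil => rfl
  | cons x l ih =>
    rw [List.map_cons, koszul, koszul, ih, List.map_map]
    simp only [Function.comp_def, hφ.lt_iff_lt, hφ.injective.eq_iff]

/-- Changing the parity of one half-edge. -/
theorem koszul_update {a b : List (Fin m × Bool)} {h : Fin m × Bool} (hl : (a ++ h :: b).Nodup)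
    (hc : ∀ x, x ∈ a ++ h :: b) (p : ZMod 2) (hp : p = q h + 1) :
    koszul (Function.update q h p) (a ++ h :: b) *
        psign (∑ y with y.1 < h.1 ∨ (y.1 = h.1 ∧ y.2 < h.2), q y) =
      koszul q (a ++ h :: b) * psign ((a.map q).sum) := by
  have hna : h ∉ a := fun ha => (List.nodup_append.1 hl).2.2 h ha h List.mem_cons_self rfl
  have hnb : h ∉ b := (List.nodup_cons.1 (List.nodup_append.1 hl).2.1).1
  have e1 : ∀ c : List (Fin m × Bool), h ∉ c →
      cross (Function.update q h p) [h] c = cross q [h] c *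
        psign ((c.map fun y => if y.1 < h.1 ∨ (y.1 = h.1 ∧ y.2 < h.2) then q y else 0).sum) := by
    intro c hc
    induction c with
    | nil => simp [cross_nil_right, psign_zero]
    | cons y c ih =>
      rw [List.mem_cons, not_or] at hc
      rw [cross_cons_right, cross_cons_right q, ih hc.2, cross_single, cross_single, List.map_cons,
        List.sum_cons, psign_add]
      have : pairSign (Function.update q h p) h y = pairSign q h y *
          psign (if y.1 < h.1 ∨ (y.1 = h.1 ∧ y.2 < h.2) then q y else 0) := by
        unfold pairSign
        rw [Function.update_self, Function.update_of_ne (Ne.symm hc.1)]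
        split_ifs
        · rw [hp, add_mul, one_mul, psign_add]
        · rw [psign_zero, mul_one]
      rw [this]
      ring
  have e2 : ∀ c d : List (Fin m × Bool), h ∉ c → h ∉ d →
      cross (Function.update q h p) c d = cross q c d := by
    intro c d hc hd
    unfold cross
    congr 1
    refine List.map_congr_left fun x hx => ?_
    congr 1
    refine List.map_congr_left fun y hy => ?_
    unfold pairSign
    rw [Function.update_of_ne (fun e : x = h => hc (e ▸ hx)),
      Function.update_of_ne (fun e : y = h => hd (e ▸ hy))]
  have e3 : ∀ c : List (Fin m × Bool), h ∉ c → koszul (Function.update q h p) c = koszul q c :=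
    fun c hc => koszul_congr fun x hx => Function.update_of_ne (fun e : x = h => hc (e ▸ hx)) _ _
  have e4 : (∑ y with y.1 < h.1 ∨ (y.1 = h.1 ∧ y.2 < h.2), q y) =
      ((a.map fun y => if y.1 < h.1 ∨ (y.1 = h.1 ∧ y.2 < h.2) then q y else 0).sum) +
      ((b.map fun y => if y.1 < h.1 ∨ (y.1 = h.1 ∧ y.2 < h.2) then q y else 0).sum) := by
    rw [Finset.sum_filter]
    have : (Finset.univ : Finset (Fin m × Bool)) = (a ++ h :: b).toFinset := by
      ext x
      have := hc x
      simp only [List.mem_append, List.mem_cons] at this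
      simp only [Finset.mem_univ, List.mem_toFinset, List.mem_append, List.mem_cons, this]
    rw [this, List.sum_toFinset _ hl]
    simp
  -- Pairs in which `h` comes second are turned round, so that `e1` computes the change of sign on
  -- both sides of `h`. Turning them round produces the factor for the parity of `a`.
  have e5 : ∀ p', cross (Function.update q h p') a [h] =
      psign ((a.map q).sum * p') * cross (Function.update q h p') [h] a := by
    intro p'
    rw [cross_comm _ (by simpa using hna)]
    have : a.map (Function.update q h p') = a.map q :=
      List.map_congr_left fun x hx => Function.update_of_ne (fun e : x = h => hna (e ▸ hx)) _ _
    simp [this]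
  have e6 := e5 (q h)
  rw [Function.update_eq_self] at e6
  rw [koszul_append, koszul_cons, cross_cons_right, e5, e1 a hna, e1 b hnb, e2 a b hna hnb, e3 a hna,
    e3 b hnb, e4, psign_add, koszul_append, koszul_cons, cross_cons_right q, e6, hp, mul_add,
    mul_one, psign_add]
  set s := psign ((a.map fun y => if y.1 < h.1 ∨ (y.1 = h.1 ∧ y.2 < h.2) then q y else 0).sum)
    with hs
  set t := psign ((b.map fun y => if y.1 < h.1 ∨ (y.1 = h.1 ∧ y.2 < h.2) then q y else 0).sum)
    with ht
  have h1 : s * s = 1 := psign_mul_self _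
  have h2 : t * t = 1 := psign_mul_self _
  linear_combination (koszul q a * (psign ((a.map q).sum * q h) * psign ((a.map q).sum) *
    cross q [h] a * cross q a b) * (cross q [h] b * koszul q b)) * (t * t * h1 + h2)

end Koszul

end

/-! ### Koszul signs under relabelling of the half-edges -/

noncomputable section

section KoszulPerm

variable {m : ℕ} (q : Fin m × Bool → ZMod 2)

/-- The discrepancy of Koszul signs under a relabelling does not depend on the order. -/
theorem koszul_map_mul_perm {σ : Fin m × Bool → Fin m × Bool} (hσ : Function.Injective σ)
    {l l' : List (Fin m × Bool)} (h : l.Perm l') (hl : l.Nodup) :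
    koszul q (l.map σ) * koszul (q ∘ σ) l = koszul q (l'.map σ) * koszul (q ∘ σ) l' := by
  have hc : ∀ (x : Fin m × Bool) {l l' : List (Fin m × Bool)}, l.Perm l' →
      cross q [x] l = cross q [x] l' := by
    intro x l l' h
    simp only [cross, List.map_cons, List.map_nil, List.prod_singleton]
    exact (h.map _).prod_eq
  have hc' : ∀ (x : Fin m × Bool) {l l' : List (Fin m × Bool)}, l.Perm l' →
      cross (q ∘ σ) [x] l = cross (q ∘ σ) [x] l' := by
    intro x l l' h
    simp only [cross, List.map_cons, List.map_nil, List.prod_singleton]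
    exact (h.map _).prod_eq
  induction h with
  | nil => rfl
  | @cons x l₁ l₂ h ih =>
    have := ih (List.nodup_cons.1 hl).2
    rw [List.map_cons, List.map_cons, koszul_cons, koszul_cons, koszul_cons, koszul_cons,
      hc _ (h.map σ), hc' _ h]
    linear_combination (cross q [σ x] (l₂.map σ) * cross (q ∘ σ) [x] l₂) * this
  -- An adjacent transposition changes both Koszul signs by the same factor, which drops out of
  -- their product.
  | swap x y l =>
    have hxy : y ≠ x := fun e => by simp [e] at hl
    simp only [List.map_cons, koszul_cons]
    rw [cross_cons_right q (σ x) [σ y], cross_cons_right _ x [y], cross_single, cross_single,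
      cross_cons_right q (σ y) [σ x], cross_cons_right _ y [x], cross_single, cross_single,
      pairSign_comm q (hσ.ne hxy), pairSign_comm _ hxy]
    have := psign_mul_self (q (σ y) * q (σ x))
    simp only [Function.comp_apply]
    linear_combination (pairSign q (σ x) (σ y) * cross q [σ y] (l.map σ) *
      (cross q [σ x] (l.map σ) * koszul q (l.map σ)) * (pairSign (q ∘ σ) x y *
      cross (q ∘ σ) [y] l * (cross (q ∘ σ) [x] l * koszul (q ∘ σ) l))) * this
  | trans h1 h2 ih1 ih2 => rw [ih1 hl, ih2 (h1.nodup_iff.1 hl)]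

/-- All half-edges, edge by edge. -/
def stdList (m : ℕ) : List (Fin m × Bool) :=
  (List.finRange m).flatMap fun e => [(e, false), (e, true)]

theorem mem_stdList (x : Fin m × Bool) : x ∈ stdList m := by
  obtain ⟨e, b⟩ := x
  cases b <;> simp [stdList]

theorem nodup_stdList : (stdList m).Nodup := by
  rw [stdList, List.nodup_flatMap]
  refine ⟨fun e _ => by simp, ?_⟩
  refine (List.nodup_finRange m).imp ?_
  intro a b hab
  simp [Function.onFun, hab, hab.symm]

theorem prod_flatMap_pairs (g : Fin m × Bool → ℝ) (es : List (Fin m)) (φ ψ : Fin m → Fin m × Bool) :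
    ((es.flatMap fun e => [φ e, ψ e]).map g).prod = (es.map fun e => g (φ e) * g (ψ e)).prod := by
  induction es with
  | nil => rfl
  | cons e es ih =>
    rw [List.flatMap_cons, List.map_append, List.prod_append, ih]
    simp

/-- A product over the pairs of entries of a list. -/
def pairProd {α : Type*} (g : α → α → ℝ) : List α → ℝ
  | [] => 1
  | x :: l => (l.map (g x)).prod * pairProd g l

theorem pairProd_map {α β : Type*} (g : β → β → ℝ) (φ : α → β) (l : List α) :
    pairProd g (l.map φ) = pairProd (fun x y => g (φ x) (φ y)) l := by
  induction l with
  | nil => rfl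
  | cons x l ih => simp [pairProd, ih, Function.comp_def]

/-- Brings the product over pairs to the shape of `Equiv.Perm.sign_eq_prod_prod_Ioi`. -/
theorem pairProd_finRange {n : ℕ} (g : Fin n → Fin n → ℝ) :
    pairProd g (List.finRange n) = ∏ i, ∏ j ∈ Finset.Ioi i, g i j := by
  induction n with
  | zero => simp [pairProd]
  | succ n ih =>
    rw [List.finRange_succ, pairProd, pairProd_map, ih, Fin.prod_univ_succ, Fin.prod_Ioi_zero]
    congr 1
    · simp [List.prod_ofFn, List.map_map, ← List.ofFn_eq_map]
    · refine Finset.prod_congr rfl fun i _ => ?_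
      rw [Fin.prod_Ioi_succ]

/-- The halves of an odd edge have parities `0` and `1`, so their order within the block is
irrelevant, while interchanging two odd blocks costs `-1`. What remains counts the inversions of
`ρ`. -/
theorem koszul_blocks (ρ : Equiv.Perm (Fin m)) (ε : Fin m → Bool)
    (hq : ∀ e, q (e, false) + q (e, true) = 1) (es : List (Fin m)) (hes : es.Nodup) :
    koszul q (es.flatMap fun e => [(ρ e, ε e), (ρ e, !ε e)]) =
      pairProd (fun i j => if ρ i < ρ j then 1 else -1) es := by
  induction es with
  | nil => rfl
  | cons e es ih =>
    rw [List.nodup_cons] at hes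
    rw [List.flatMap_cons, koszul_append, ih hes.2, pairProd]
    have h0 : ∀ e b, q (e, b) + q (e, !b) = 1 := by
      intro e b; cases b
      · exact hq e
      · rw [add_comm]; exact hq e
    have h1 : koszul q [(ρ e, ε e), (ρ e, !ε e)] = 1 := by
      rw [koszul_cons, cross_single, koszul_cons, cross_nil_right, koszul_nil, pairSign,
        (by decide : ∀ a b : ZMod 2, a + b = 1 → a * b = 0) _ _ (h0 (ρ e) (ε e)), psign_zero]
      simp
    rw [h1, one_mul]
    congr 1
    rw [cross_cons_left]
    simp only [cross, List.map_cons, List.map_nil, List.prod_singleton]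
    rw [prod_flatMap_pairs, prod_flatMap_pairs, ← List.prod_map_mul]
    congr 1
    refine List.map_congr_left fun e' he' => ?_
    have hne : ρ e' ≠ ρ e := fun h => hes.1 (ρ.injective h ▸ he')
    have h2 : ∀ b b' : Bool, pairSign q (ρ e, b) (ρ e', b') =
        if ρ e < ρ e' then 1 else psign (q (ρ e, b) * q (ρ e', b')) := by
      intro b b'
      unfold pairSign
      rcases lt_or_gt_of_ne hne with h | h
      · simp [h, h.not_gt]
      · simp [h, h.not_gt, hne]
    rw [h2, h2, h2, h2]
    split_ifs
    · norm_num
    · simp only [← psign_add]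
      rw [← psign_one]
      congr 1
      exact (by decide : ∀ a a' b b' : ZMod 2, a + a' = 1 → b + b' = 1 →
        a * b + a * b' + (a' * b + a' * b') = 1) _ _ _ _ (h0 _ _) (h0 _ _)

/-- The Koszul sign of a relabelling, if all edges are odd. -/
theorem koszul_map_perm (ρ : Equiv.Perm (Fin m)) (ε : Fin m → Bool)
    (hq : ∀ e, q (e, false) + q (e, true) = 1) {l : List (Fin m × Bool)} (hl : l.Nodup)
    (hc : ∀ x, x ∈ l) :
    koszul q (l.map fun h => (ρ h.1, xor (ε h.1) h.2)) =
      ((Equiv.Perm.sign ρ : ℤ) : ℝ) * koszul (fun h => q (ρ h.1, xor (ε h.1) h.2)) l := by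
  have hσ : Function.Injective fun h : Fin m × Bool => (ρ h.1, xor (ε h.1) h.2) := by
    rintro ⟨e, b⟩ ⟨e', b'⟩ h
    simp only [Prod.mk.injEq, EmbeddingLike.apply_eq_iff_eq] at h
    obtain ⟨rfl, h⟩ := h
    simpa using h
  have hp : l.Perm (stdList m) := (List.perm_ext_iff_of_nodup hl nodup_stdList).2 fun x =>
    ⟨fun _ => mem_stdList x, fun _ => hc x⟩
  -- The discrepancy may be computed on the standard list, where the original sign is `1` and the
  -- relabelled one is the sign of `ρ`.
  have key := koszul_map_mul_perm q hσ hp hl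
  have h1 : koszul (q ∘ fun h : Fin m × Bool => (ρ h.1, xor (ε h.1) h.2)) (stdList m) = 1 := by
    have := koszul_blocks (q ∘ fun h : Fin m × Bool => (ρ h.1, xor (ε h.1) h.2)) 1 (fun _ => false)
      (fun e => by
        have := hq (ρ e)
        rcases hb : ε e with _ | _ <;> simp [hb, this, add_comm (q (ρ e, true))]) _
      (List.nodup_finRange m)
    rw [pairProd_finRange] at this
    simp only [Equiv.Perm.coe_one, id_eq, Bool.not_false] at this
    rw [stdList, this]
    refine Finset.prod_eq_one fun i _ => Finset.prod_eq_one fun j hj => if_pos (Finset.mem_Ioi.1 hj)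
  have h2 : koszul q ((stdList m).map fun h => (ρ h.1, xor (ε h.1) h.2)) =
      ((Equiv.Perm.sign ρ : ℤ) : ℝ) := by
    have := koszul_blocks q ρ ε hq _ (List.nodup_finRange m)
    rw [pairProd_finRange] at this
    rw [stdList, List.map_flatMap]
    simp only [List.map_cons, List.map_nil, Bool.xor_false, Bool.xor_true]
    rw [this, Equiv.Perm.sign_eq_prod_prod_Ioi]
    push_cast
    refine Finset.prod_congr rfl fun i _ => Finset.prod_congr rfl fun j _ => ?_
    split_ifs <;> simp
  rw [h1, h2, mul_one] at key
  rw [← key, mul_assoc]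
  change _ = _ * (koszul (q ∘ _) l * koszul (q ∘ _) l)
  rw [koszul_mul_self, mul_one]

end KoszulPerm

end

/-! ### Independence of presentations and invariance under isomorphism -/

noncomputable section

theorem List.perm_flatten_of_forall₂_isRotated {α : Type*} {B B' : List (List α)}
    (h : List.Forall₂ List.IsRotated B B') : B.flatten.Perm B'.flatten := by
  induction h with
  | nil => exact .refl _
  | cons h _ ih => exact h.perm.append ih

theorem BdSurface.Same.perm_halfEdges {H : Type} {S S' : BdSurface H} (h : S.Same S') :
    S.halfEdges.Perm S'.halfEdges := by
  obtain ⟨_, B, hB, hr⟩ := h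
  exact hB.flatten.trans (List.perm_flatten_of_forall₂_isRotated hr)

theorem RibbonGraph.halfEdges_eq {m : ℕ} (γ : RibbonGraph m) :
    γ.halfEdges = γ.vertices.flatMap BdSurface.halfEdges := by
  obtain ⟨vs⟩ := γ
  simp only [RibbonGraph.halfEdges, RibbonGraph.circles]
  induction vs with
  | nil => rfl
  | cons S vs ih => simp only [List.flatMap_cons, List.flatten_append, ih, BdSurface.halfEdges]

namespace DGFrobenius

variable {A : Type*} [NonUnitalRing A] [Module ℝ A] {F : DGFrobenius A}
  [FiniteDimensional ℝ A] [IsScalarTower ℝ A A] [SMulCommClass ℝ A A] {m : ℕ}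

theorem par_map {H : Type*} (f : H → F.Idx) (l : List H) :
    par (l.map f) = (l.map fun h => (f h).1).sum := by simp [par, Function.comp_def]

/-- The value of the open topological field theory at one vertex. -/
def vertexValue (S : BdSurface (Fin m × Bool)) (f : Fin m × Bool → F.Idx) : ℝ :=
  F.otft S.genus (S.boundary.map (List.map f))

/-- The value of a list of vertices, including the Koszul sign. -/
def listValue (vs : List (BdSurface (Fin m × Bool))) (f : Fin m × Bool → F.Idx) : ℝ :=
  koszul (fun h => (f h).1) (vs.flatMap BdSurface.halfEdges) *
    (vs.map fun S => vertexValue S f).prod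

theorem vertexMap_eq (γ : RibbonGraph m) (f : Fin m × Bool → F.Idx) :
    F.vertexMap γ f = listValue γ.vertices f := by
  rw [vertexMap, listValue, γ.halfEdges_eq]; rfl

theorem vertexValue_parity {S : BdSurface (Fin m × Bool)} {f : Fin m × Bool → F.Idx}
    (h : (S.halfEdges.map fun h => (f h).1).sum ≠ 0) : vertexValue S f = 0 := by
  refine otft_parity _ _ ?_
  rwa [← List.map_flatten, par_map]

/-- The signs of `otft_swap` are cancelled by those of the Koszul factor. The list `fr` holds the
circles already treated, `pre` and `post` the half-edges of other vertices; the induction needs this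
generality. -/
theorem koszul_mul_otft_perm (f : Fin m × Bool → F.Idx) (g : ℕ) {B B' : List (List (Fin m × Bool))}
    (h : B.Perm B') (fr : List (List (Fin m × Bool))) (pre post : List (Fin m × Bool))
    (hB : B.flatten.Nodup) :
    koszul (fun h => (f h).1) (pre ++ ((fr ++ B).flatten ++ post)) *
        F.otft g ((fr ++ B).map (List.map f)) =
      koszul (fun h => (f h).1) (pre ++ ((fr ++ B').flatten ++ post)) *
        F.otft g ((fr ++ B').map (List.map f)) := by
  induction h generalizing fr with
  | nil => rfl
  | cons x h ih =>
    have := ih (fr ++ [x]) (by rw [List.flatten_cons] at hB; exact hB.of_append_right)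
    simpa only [List.append_assoc, List.singleton_append] using this
  | swap x y l =>
    simp only [List.flatten_cons, ← List.append_assoc] at hB
    have hd := List.disjoint_of_nodup_append hB.of_append_left
    simp only [List.flatten_append, List.flatten_cons, List.append_assoc, List.map_append,
      List.map_cons]
    rw [← List.append_assoc pre, koszul_swap _ hd, otft_swap, par_map, par_map, List.append_assoc]
    have := psign_mul_self ((y.map fun h => (f h).1).sum * (x.map fun h => (f h).1).sum)
    linear_combination (koszul (fun h => (f h).1) (pre ++ (fr.flatten ++ (x ++ (y ++ (l.flatten ++ post)))))
      * F.otft g (fr.map (List.map f) ++ x.map f :: y.map f :: l.map (List.map f))) * this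
  | trans h1 h2 ih1 ih2 => rw [ih1 fr hB, ih2 fr (h1.flatten.nodup_iff.1 hB)]

theorem koszul_mul_otft_rotate (f : Fin m × Bool → F.Idx) (g : ℕ)
    {B B' : List (List (Fin m × Bool))} (h : List.Forall₂ List.IsRotated B B')
    (fr : List (List (Fin m × Bool))) (pre post : List (Fin m × Bool)) (hB : B.flatten.Nodup) :
    koszul (fun h => (f h).1) (pre ++ ((fr ++ B).flatten ++ post)) *
        F.otft g ((fr ++ B).map (List.map f)) =
      koszul (fun h => (f h).1) (pre ++ ((fr ++ B').flatten ++ post)) *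
        F.otft g ((fr ++ B').map (List.map f)) := by
  induction h generalizing fr with
  | nil => rfl
  | @cons l l' B B' h _ ih =>
    rw [List.flatten_cons] at hB
    obtain ⟨u, v, rfl, rfl⟩ : ∃ u v, l = u ++ v ∧ l' = v ++ u := by
      obtain ⟨n, rfl⟩ := h
      exact ⟨_, _, (List.take_append_drop (n % l.length) l).symm, List.rotate_eq_drop_append_take_mod⟩
    have := ih (fr ++ [v ++ u]) hB.of_append_right
    simp only [List.append_assoc, List.singleton_append] at this
    rw [← this]
    have hd := List.disjoint_of_nodup_append hB.of_append_left
    simp only [List.flatten_append, List.flatten_cons, List.append_assoc, List.map_append,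
      List.map_cons]
    rw [← List.append_assoc pre, koszul_swap _ hd, otft_rotate, par_map, par_map, List.append_assoc]
    have := psign_mul_self ((u.map fun h => (f h).1).sum * (v.map fun h => (f h).1).sum)
    linear_combination (koszul (fun h => (f h).1) (pre ++ (fr.flatten ++ (v ++ (u ++ (B.flatten ++ post)))))
      * F.otft g (fr.map (List.map f) ++ (v.map f ++ u.map f) :: B.map (List.map f))) * this

theorem koszul_mul_vertexValue_same (f : Fin m × Bool → F.Idx) {S S' : BdSurface (Fin m × Bool)}
    (h : S.Same S') (pre post : List (Fin m × Bool)) (hS : S.halfEdges.Nodup) :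
    koszul (fun h => (f h).1) (pre ++ (S.halfEdges ++ post)) * vertexValue S f =
      koszul (fun h => (f h).1) (pre ++ (S'.halfEdges ++ post)) * vertexValue S' f := by
  obtain ⟨hg, B, hB, hr⟩ := h
  have h1 := koszul_mul_otft_perm f S.genus hB [] pre post hS
  have h2 := koszul_mul_otft_rotate f S.genus hr [] pre post (hB.flatten.nodup_iff.1 hS)
  simp only [List.nil_append] at h1 h2
  rw [vertexValue, vertexValue, ← hg]
  exact h1.trans h2

theorem listValue_same (f : Fin m × Bool → F.Idx) {vs vs' : List (BdSurface (Fin m × Bool))}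
    (h : List.Forall₂ BdSurface.Same vs vs') (hn : (vs.flatMap BdSurface.halfEdges).Nodup) :
    listValue vs f = listValue vs' f := by
  suffices ∀ pre, koszul (fun h => (f h).1) (pre ++ vs.flatMap BdSurface.halfEdges) *
      (vs.map fun S => vertexValue S f).prod =
      koszul (fun h => (f h).1) (pre ++ vs'.flatMap BdSurface.halfEdges) *
      (vs'.map fun S => vertexValue S f).prod from this []
  induction h with
  | nil => intro; rfl
  | @cons S S' vs vs' h _ ih =>
    intro pre
    simp only [List.flatMap_cons, List.map_cons, List.prod_cons] at hn ⊢
    rw [← mul_assoc, koszul_mul_vertexValue_same f h _ _ hn.of_append_left]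
    have := ih hn.of_append_right (pre ++ S'.halfEdges)
    simp only [List.append_assoc] at this
    linear_combination vertexValue S' f * this

/-- The map at each vertex is even: either the half-edges of a vertex have total parity zero, and
moving it costs no sign, or its value vanishes. -/
theorem listValue_perm (f : Fin m × Bool → F.Idx) {vs vs' : List (BdSurface (Fin m × Bool))}
    (h : vs.Perm vs') (hn : (vs.flatMap BdSurface.halfEdges).Nodup) :
    listValue vs f = listValue vs' f := by
  suffices ∀ pre, koszul (fun h => (f h).1) (pre ++ vs.flatMap BdSurface.halfEdges) *
      (vs.map fun S => vertexValue S f).prod =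
      koszul (fun h => (f h).1) (pre ++ vs'.flatMap BdSurface.halfEdges) *
      (vs'.map fun S => vertexValue S f).prod from this []
  induction h with
  | nil => intro; rfl
  | cons S h ih =>
    intro pre
    simp only [List.flatMap_cons, List.map_cons, List.prod_cons] at hn ⊢
    have := ih hn.of_append_right (pre ++ S.halfEdges)
    simp only [List.append_assoc] at this
    linear_combination vertexValue S f * this
  | swap S S' vs =>
    intro pre
    simp only [List.flatMap_cons, List.map_cons, List.prod_cons, ← List.append_assoc] at hn ⊢
    have hd := List.disjoint_of_nodup_append hn.of_append_left
    simp only [List.append_assoc]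
    rw [koszul_swap _ hd]
    by_cases hS : (S.halfEdges.map fun h => (f h).1).sum = 0
    · rw [hS, mul_zero, psign_zero]; ring
    · rw [vertexValue_parity hS]; ring
  | trans h1 h2 ih1 ih2 =>
    intro pre
    rw [ih1 hn, ih2 ((h1.flatMap_right _).nodup_iff.1 hn)]

/-! ### Symmetry of the propagator and isomorphism invariance -/

/-- The value of a graph for a family of tensors on the edges. -/
theorem contractEdges_real (γ : RibbonGraph m) (a : Fin m → F.Idx → F.Idx → ℝ) :
    F.contractEdges γ a = ∑ f, F.vertexMap γ f * ∏ e, a e (f (e, false)) (f (e, true)) := by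
  simp only [contractEdges, List.prod_reverse, List.prod_ofFn, smul_eq_mul]

/-- Labellings are transported along the relabelling of half-edges. Symmetry of `P` absorbs flipped
edges, and oddness turns the permutation of the edges into its sign. -/
theorem contractEdges_iso {P : F.Idx → F.Idx → ℝ} (hodd : ∀ x y, x.1 + y.1 ≠ 1 → P x y = 0)
    (hsymm : ∀ x y, P x y = P y x) {γ γ' : RibbonGraph m} {ρ : Equiv.Perm (Fin m)}
    (hγ : ∀ h, γ.halfEdges.count h = 1) (h : RibbonGraph.Iso ρ γ γ') :
    F.contractEdges γ' (fun _ => P) =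
      ((Equiv.Perm.sign ρ : ℤ) : ℝ) * F.contractEdges γ (fun _ => P) := by
  obtain ⟨ε, L, hL, hs⟩ := h
  set σ : Fin m × Bool → Fin m × Bool := fun h => (ρ h.1, xor (ε h.1) h.2) with hσ
  have hσi : Function.Injective σ := by
    rintro ⟨e, b⟩ ⟨e', b'⟩ h
    simp only [hσ, Prod.mk.injEq, EmbeddingLike.apply_eq_iff_eq] at h
    obtain ⟨rfl, h⟩ := h
    simpa using h
  have hσb : Function.Bijective σ := Finite.injective_iff_bijective.1 hσi
  have hrel : ∀ S : BdSurface (Fin m × Bool), (S.relabel fun h => some (σ h)) =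
      ⟨S.genus, S.boundary.map (List.map σ)⟩ := by
    intro S
    simp only [BdSurface.relabel, BdSurface.mk.injEq, true_and]
    refine List.map_congr_left fun l _ => ?_
    rw [← List.filterMap_eq_map]; rfl
  have hrelH : ∀ S : BdSurface (Fin m × Bool),
      (BdSurface.relabel (fun h => some (σ h)) S).halfEdges = S.halfEdges.map σ := by
    intro S; rw [hrel, BdSurface.halfEdges, BdSurface.halfEdges, List.map_flatten]
  have hflat : (γ.vertices.map (BdSurface.relabel fun h => some (σ h))).flatMap
      BdSurface.halfEdges = γ.halfEdges.map σ := by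
    rw [List.flatMap_map, γ.halfEdges_eq, List.map_flatMap]
    simp only [hrelH]
  have hmem : ∀ h, h ∈ γ.halfEdges := fun h => List.count_pos_iff.1 (by rw [hγ h]; norm_num)
  have hnd : γ.halfEdges.Nodup := List.nodup_iff_count_le_one.2 fun h => (hγ h).le
  have hnd' : ((γ.vertices.map (BdSurface.relabel fun h => some (σ h))).flatMap
      BdSurface.halfEdges).Nodup := by rw [hflat]; exact hnd.map hσi
  have hval : ∀ f : Fin m × Bool → F.Idx, F.vertexMap γ' f =
      koszul (fun h => (f h).1) (γ.halfEdges.map σ) *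
        (γ.vertices.map fun S => vertexValue S (f ∘ σ)).prod := by
    intro f
    rw [vertexMap_eq, ← listValue_same f hs ((hL.flatMap_right _).nodup_iff.1 hnd'),
      ← listValue_perm f hL hnd', listValue, hflat, List.map_map]
    congr 2
    refine List.map_congr_left fun S _ => ?_
    simp only [Function.comp_apply]
    change vertexValue (BdSurface.relabel (fun h => some (σ h)) S) f = _
    rw [hrel, vertexValue, vertexValue, List.map_map]
    congr 1
    refine List.map_congr_left fun l _ => ?_
    simp
  rw [contractEdges_real, contractEdges_real, Finset.mul_sum]
  refine Fintype.sum_bijective (fun f => f ∘ σ) ?_ _ _ ?_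
  · exact (Equiv.arrowCongr (Equiv.ofBijective σ hσb).symm (Equiv.refl _)).bijective
  intro f
  have hprod : ∏ e, P ((f ∘ σ) (e, false)) ((f ∘ σ) (e, true)) =
      ∏ e, P (f (e, false)) (f (e, true)) := by
    rw [← Equiv.prod_comp ρ fun e => P (f (e, false)) (f (e, true))]
    refine Finset.prod_congr rfl fun e _ => ?_
    simp only [Function.comp_apply, hσ]
    rcases ε e with _ | _
    · simp
    · simp [hsymm (f (ρ e, true))]
  rw [hprod]
  -- `koszul_map_perm` requires all edges to be odd. For any other labelling both sides vanish,
  -- because `P` does on an even edge.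
  by_cases hq : ∀ e, (f (e, false)).1 + (f (e, true)).1 = 1
  · rw [hval, koszul_map_perm (fun h => (f h).1) ρ ε hq hnd hmem, vertexMap_eq, listValue,
      ← γ.halfEdges_eq]
    simp only [hσ, Function.comp_def]
    ring
  · push Not at hq
    obtain ⟨e, he⟩ := hq
    rw [Finset.prod_eq_zero (Finset.mem_univ e) (hodd _ _ he)]
    simp

end DGFrobenius

end

noncomputable section

/-! ### Normal forms of vertices -/

section Lists

variable {α β : Type*} [DecidableEq β] {k : α → List β} {l : List α} {a b : α} {x : β}

theorem List.perm_cons_filter_notMem (hl : (l.flatMap k).Nodup) (ha : a ∈ l) (hx : x ∈ k a) :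
    l.Perm (a :: l.filter fun b => x ∉ k b) := by
  induction l with
  | nil => simp at ha
  | cons c l ih =>
    rw [List.flatMap_cons] at hl
    have hd := List.disjoint_of_nodup_append hl
    by_cases hc : x ∈ k c
    · have hnot : ∀ b ∈ l, x ∉ k b := fun b hb hxb => hd hc (List.mem_flatMap.2 ⟨b, hb, hxb⟩)
      have hac : a = c := (List.mem_cons.1 ha).resolve_right fun h => hnot a h hx
      subst hac
      rw [List.filter_cons_of_neg (by simpa using hx), List.filter_eq_self.2]
      intro b hb
      simpa using hnot b hb
    · have hac : a ∈ l := (List.mem_cons.1 ha).resolve_left fun h => hc (h ▸ hx)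
      rw [List.filter_cons_of_pos (by simpa using hc)]
      exact ((ih hl.of_append_right hac).cons c).trans (List.Perm.swap _ _ _)

theorem List.eq_of_mem_of_nodup_flatMap (hl : (l.flatMap k).Nodup) (ha : a ∈ l) (hb : b ∈ l)
    (hxa : x ∈ k a) (hxb : x ∈ k b) : b = a := by
  have := (List.perm_cons_filter_notMem hl ha hxa).mem_iff.1 hb
  rcases List.mem_cons.1 this with h | h
  · exact h
  · simp [hxb] at h

theorem List.filter_mem_of_nodup_flatMap (hl : (l.flatMap k).Nodup) (ha : a ∈ l) (hx : x ∈ k a) :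
    (l.filter fun b => x ∈ k b) = [a] := by
  have h := (List.perm_cons_filter_notMem hl ha hx).filter fun b => decide (x ∈ k b)
  rw [List.filter_cons_of_pos (by simpa using hx), List.filter_filter] at h
  simp only [decide_not, Bool.and_not_self, List.filter_false] at h
  exact List.perm_singleton.1 h

theorem List.rotate_idxOf {c : List β} (hx : x ∈ c) :
    c.rotate (c.idxOf x) = x :: (c.rotate (c.idxOf x)).tail := by
  have h1 : c.idxOf x < c.length := List.idxOf_lt_length_iff.2 hx
  rw [List.rotate_eq_drop_append_take h1.le, List.drop_eq_getElem_cons h1, List.getElem_idxOf]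
  rfl

theorem List.takeWhile_append_cons_tail {c : List β} (hx : x ∈ c) :
    c = c.takeWhile (· ≠ x) ++ x :: (c.dropWhile (· ≠ x)).tail := by
  induction c with
  | nil => simp at hx
  | cons y c ih =>
    by_cases hy : y = x
    · subst hy; simp
    · rw [List.takeWhile_cons_of_pos (by simpa using hy), List.dropWhile_cons_of_pos (by simpa using hy),
        List.cons_append, ← ih ((List.mem_cons.1 hx).resolve_left (Ne.symm hy))]

end Lists

namespace BdSurface

variable {H : Type} [DecidableEq H] {S : BdSurface H} {h h' : H}

theorem isRotated_of_mem {c : List H} (hS : S.halfEdges.Nodup) (hc : c ∈ S.boundary) (hh : h ∈ c) :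
    c ~r h :: S.after h ∧ S.circle h = c := by
  have h1 : S.circle h = c := by
    have := List.filter_mem_of_nodup_flatMap (k := id) (l := S.boundary) (x := h) (a := c)
      (by rw [List.flatMap_id]; exact hS) hc hh
    simp only [id_eq] at this
    rw [circle, this, List.flatten_singleton]
  refine ⟨?_, h1⟩
  rw [after, h1, ← List.rotate_idxOf hh]
  exact ⟨_, rfl⟩

theorem mem_halfEdges : h ∈ S.halfEdges ↔ ∃ c ∈ S.boundary, h ∈ c := List.mem_flatten

theorem perm_boundary {c : List H} (hS : S.halfEdges.Nodup) (hc : c ∈ S.boundary) (hh : h ∈ c) :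
    S.boundary.Perm (c :: S.boundary.filter fun c => h ∉ c) :=
  List.perm_cons_filter_notMem (k := id) (by rw [List.flatMap_id]; exact hS) hc hh

/-- Any surface can be presented with a given half-edge in the first place. -/
theorem same_first (hS : S.halfEdges.Nodup) (hh : h ∈ S.halfEdges) :
    S.Same ⟨S.genus, (h :: S.after h) :: S.boundary.filter fun c => h ∉ c⟩ := by
  obtain ⟨c, hc, hhc⟩ := mem_halfEdges.1 hh
  exact ⟨rfl, _, perm_boundary hS hc hhc,
    .cons (isRotated_of_mem hS hc hhc).1 (List.forall₂_same.2 fun _ _ => .refl _)⟩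

theorem same_first_of_mem_circle (hS : S.halfEdges.Nodup) (hh : h ∈ S.halfEdges)
    (hh' : h' ∈ S.circle h) (hne : h' ≠ h) :
    S.Same ⟨S.genus, (h :: ((S.after h).takeWhile (· ≠ h') ++
      h' :: ((S.after h).dropWhile (· ≠ h')).tail)) :: S.boundary.filter fun c => h ∉ c⟩ := by
  obtain ⟨c, hc, hhc⟩ := mem_halfEdges.1 hh
  have h1 := isRotated_of_mem hS hc hhc
  rw [h1.2] at hh'
  have h2 : h' ∈ S.after h :=
    (List.mem_cons.1 (h1.1.perm.mem_iff.1 hh')).resolve_left hne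
  rw [← List.takeWhile_append_cons_tail h2]
  exact same_first hS hh

theorem same_first_second (hS : S.halfEdges.Nodup) (hh : h ∈ S.halfEdges) (hh' : h' ∈ S.halfEdges)
    (hne : h' ∉ S.circle h) :
    S.Same ⟨S.genus, (h :: S.after h) :: (h' :: S.after h') ::
      S.boundary.filter fun c => h ∉ c ∧ h' ∉ c⟩ := by
  obtain ⟨c, hc, hhc⟩ := mem_halfEdges.1 hh
  obtain ⟨c', hc', hhc'⟩ := mem_halfEdges.1 hh'
  have h1 := isRotated_of_mem hS hc hhc
  have h1' := isRotated_of_mem hS hc' hhc'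
  rw [h1.2] at hne
  -- Otherwise `c'` would be the circle of `h`, which does not contain `h'`.
  have h2 : h ∉ c' := fun hx => by
    have := (isRotated_of_mem hS hc' hx).2
    rw [h1.2] at this
    exact hne (this ▸ hhc')
  have h3 : (S.boundary.filter fun c => h ∉ c).Perm
      (c' :: S.boundary.filter fun c => h ∉ c ∧ h' ∉ c) := by
    have h4 := List.perm_cons_filter_notMem (k := id) (l := S.boundary.filter fun c => h ∉ c)
      (x := h') (a := c') ?_ (by simp [hc', h2]) hhc'
    · rw [List.filter_filter] at h4
      refine h4.trans (.of_eq ?_)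
      congr 1
      refine List.filter_congr fun c _ => ?_
      simp [Bool.and_comm]
    · have := (perm_boundary hS hc hhc).flatten.nodup_iff.1 hS
      rw [List.flatten_cons] at this
      simpa using this.of_append_right
  exact ⟨rfl, _, (perm_boundary hS hc hhc).trans (h3.cons c),
    .cons h1.1 (.cons h1'.1 (List.forall₂_same.2 fun _ _ => .refl _))⟩

end BdSurface

/-! ### Contraction of an edge -/

section Relabel

variable {m : ℕ} (i : Fin (m + 1))

/-- The half-edges of the graph as half-edges of a graph with a further edge `i`. -/
def liftHalf (x : Fin m × Bool) : Fin (m + 1) × Bool := (i.succAbove x.1, x.2)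

/-- The partial inverse of `liftHalf`. -/
def dropHalf (x : Fin (m + 1) × Bool) : Option (Fin m × Bool) :=
  (finSuccEquiv' i x.1).map fun e => (e, x.2)

theorem liftHalf_ne (x : Fin m × Bool) (b : Bool) : liftHalf i x ≠ (i, b) := fun h =>
  Fin.succAbove_ne i x.1 (congrArg Prod.fst h)

theorem map_filterMap_dropHalf {l : List (Fin (m + 1) × Bool)} (h : (i, false) ∉ l)
    (h' : (i, true) ∉ l) : (l.filterMap (dropHalf i)).map (liftHalf i) = l := by
  induction l with
  | nil => rfl
  | cons x l ih =>
    simp only [List.mem_cons, not_or] at h h'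
    have hx : x.1 ≠ i := by
      obtain ⟨e, b⟩ := x
      rintro rfl
      cases b
      · exact h.1 rfl
      · exact h'.1 rfl
    obtain ⟨e, he⟩ := Fin.exists_succAbove_eq hx
    have : dropHalf i x = some (e, x.2) := by rw [dropHalf, ← he]; simp
    rw [List.filterMap_cons_some this, List.map_cons, ih h.2 h'.2, liftHalf, he]

/-- The surface with half-edges relabelled by `liftHalf`. -/
def liftSurface (S : BdSurface (Fin m × Bool)) : BdSurface (Fin (m + 1) × Bool) :=
  ⟨S.genus, S.boundary.map (List.map (liftHalf i))⟩

theorem map_map_filterMap_dropHalf {ls : List (List (Fin (m + 1) × Bool))}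
    (h : (i, false) ∉ ls.flatten) (h' : (i, true) ∉ ls.flatten) :
    (ls.map (List.filterMap (dropHalf i))).map (List.map (liftHalf i)) = ls := by
  rw [List.map_map]
  conv_rhs => rw [← List.map_id ls]
  refine List.map_congr_left fun l hl => map_filterMap_dropHalf i ?_ ?_
  · exact fun hx => h (List.mem_flatten.2 ⟨l, hl, hx⟩)
  · exact fun hx => h' (List.mem_flatten.2 ⟨l, hl, hx⟩)

theorem map_liftSurface_relabel {vs : List (BdSurface (Fin (m + 1) × Bool))}
    (h : (i, false) ∉ vs.flatMap BdSurface.halfEdges)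
    (h' : (i, true) ∉ vs.flatMap BdSurface.halfEdges) :
    (vs.map (BdSurface.relabel (dropHalf i))).map (liftSurface i) = vs := by
  rw [List.map_map]
  conv_rhs => rw [← List.map_id vs]
  refine List.map_congr_left fun S hS => ?_
  simp only [Function.comp_apply, liftSurface, BdSurface.relabel, id_eq]
  rw [map_map_filterMap_dropHalf]
  · exact fun hx => h (List.mem_flatMap.2 ⟨S, hS, hx⟩)
  · exact fun hx => h' (List.mem_flatMap.2 ⟨S, hS, hx⟩)

theorem halfEdges_liftSurface (S : BdSurface (Fin m × Bool)) :
    (liftSurface i S).halfEdges = S.halfEdges.map (liftHalf i) := by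
  rw [liftSurface, BdSurface.halfEdges, BdSurface.halfEdges, List.map_flatten]

theorem flatMap_liftSurface (vs : List (BdSurface (Fin m × Bool))) :
    (vs.map (liftSurface i)).flatMap BdSurface.halfEdges =
      (vs.flatMap BdSurface.halfEdges).map (liftHalf i) := by
  rw [List.flatMap_map, List.map_flatMap]
  simp only [halfEdges_liftSurface]

end Relabel

namespace DGFrobenius

variable {A : Type*} [NonUnitalRing A] [Module ℝ A] {F : DGFrobenius A}
  [FiniteDimensional ℝ A] [IsScalarTower ℝ A A] [SMulCommClass ℝ A A] {m : ℕ} (i : Fin (m + 1))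

/-- Extend a labelling of the half-edges by labels of the two halves of a further edge `i`. -/
def insertEdge (f : Fin m × Bool → F.Idx) (x y : F.Idx) (h : Fin (m + 1) × Bool) : F.Idx :=
  i.insertNth (α := fun _ => Bool → F.Idx) (fun b => bif b then y else x) (fun e b => f (e, b)) h.1 h.2

variable (f : Fin m × Bool → F.Idx) (x y : F.Idx)

@[simp] theorem insertEdge_false : insertEdge i f x y (i, false) = x := by simp [insertEdge]

@[simp] theorem insertEdge_true : insertEdge i f x y (i, true) = y := by simp [insertEdge]

@[simp] theorem insertEdge_lift (h : Fin m × Bool) : insertEdge i f x y (liftHalf i h) = f h := by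
  simp [insertEdge, liftHalf]

theorem map_insertEdge_lift (l : List (Fin m × Bool)) :
    (l.map (liftHalf i)).map (insertEdge i f x y) = l.map f := by
  rw [List.map_map]; exact List.map_congr_left fun h _ => insertEdge_lift i f x y h

theorem map_map_insertEdge_lift (ls : List (List (Fin m × Bool))) :
    (ls.map (List.map (liftHalf i))).map (List.map (insertEdge i f x y)) = ls.map (List.map f) := by
  rw [List.map_map]; exact List.map_congr_left fun l _ => map_insertEdge_lift i f x y l

theorem vertexValue_mk (g : ℕ) (bd : List (List (Fin m × Bool))) :
    vertexValue ⟨g, bd⟩ f = F.otft g (bd.map (List.map f)) := rfl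

theorem prod_vertexValue_lift (vs : List (BdSurface (Fin m × Bool))) :
    ((vs.map (liftSurface i)).map fun S => vertexValue S (insertEdge i f x y)).prod =
      (vs.map fun S => vertexValue S f).prod := by
  rw [List.map_map]
  congr 1
  refine List.map_congr_left fun S _ => ?_
  rw [Function.comp_apply, vertexValue, vertexValue, liftSurface, map_map_insertEdge_lift]

/-- The second half is moved next to the first, past `a`; two adjacent halves of equal parity then
drop out. The remaining sign is the one in `otft_split`, `otft_merge` and `otft_glue`. -/
theorem koszul_insertEdge {x y : F.Idx} (hxy : x.1 = y.1) {a b : List (Fin m × Bool)} :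
    koszul (fun h => (insertEdge i f x y h).1)
        ((i, false) :: (a.map (liftHalf i) ++ (i, true) :: b.map (liftHalf i))) =
      psign (x.1 * par (a.map f)) * koszul (fun h => (f h).1) (a ++ b) := by
  have hd : (a.map (liftHalf i)).Disjoint [(i, true)] := by
    rw [List.disjoint_singleton]
    simp [liftHalf_ne]
  have h1 := koszul_swap (fun h => (insertEdge i f x y h).1) (a := [(i, false)])
    (b := b.map (liftHalf i)) hd
  simp only [List.singleton_append, List.map_map, List.map_cons, List.map_nil, List.sum_singleton,
    insertEdge_true, Function.comp_def, insertEdge_lift, ← par_map] at h1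
  rw [h1, koszul_pair]
  · rw [← List.map_append]
    have := koszul_map (fun h => (insertEdge i f x y h).1) i.succAbove (Fin.strictMono_succAbove i)
      (a ++ b)
    change koszul _ ((a ++ b).map (liftHalf i)) = koszul (fun h =>
      (insertEdge i f x y (liftHalf i h)).1) (a ++ b) at this
    rw [this, hxy, mul_comm (par _)]
    simp only [insertEdge_lift]
  · simp [liftHalf_ne]
  · simp [liftHalf_ne]
  · simp [hxy]

theorem sum_listValue_split (g : ℕ) (u v : List (Fin m × Bool)) (cs : List (List (Fin m × Bool)))
    (vs : List (BdSurface (Fin m × Bool))) :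
    ∑ x, ∑ y, F.inv x y * listValue (⟨g, ((i, false) :: (u.map (liftHalf i) ++
        (i, true) :: v.map (liftHalf i))) :: cs.map (List.map (liftHalf i))⟩ ::
        vs.map (liftSurface i)) (insertEdge i f x y) =
      listValue (⟨g, u :: v :: cs⟩ :: vs) f := by
  rw [listValue, List.map_cons, List.prod_cons, vertexValue, List.map_cons, List.map_cons,
    ← otft_split, Finset.sum_mul, Finset.mul_sum]
  refine Finset.sum_congr rfl fun x _ => ?_
  rw [Finset.sum_mul, Finset.mul_sum]
  refine Finset.sum_congr rfl fun y _ => ?_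
  by_cases hxy : x.1 = y.1
  · have hk := koszul_insertEdge i f hxy (a := u)
      (b := v ++ (cs.flatten ++ vs.flatMap BdSurface.halfEdges))
    simp only [listValue, List.flatMap_cons, BdSurface.halfEdges, List.flatten_cons,
      ← List.map_flatten, flatMap_liftSurface, List.append_assoc, List.cons_append,
      List.map_append, List.map_cons, List.prod_cons, prod_vertexValue_lift, vertexValue_mk,
      insertEdge_false, insertEdge_true, map_insertEdge_lift, map_map_insertEdge_lift] at hk ⊢
    rw [hk]
    ring
  · simp [inv_eq_zero hxy]

theorem sum_listValue_merge (g : ℕ) (u v : List (Fin m × Bool)) (cs : List (List (Fin m × Bool)))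
    (vs : List (BdSurface (Fin m × Bool))) :
    ∑ x, ∑ y, F.inv x y * listValue (⟨g, ((i, false) :: u.map (liftHalf i)) ::
        ((i, true) :: v.map (liftHalf i)) :: cs.map (List.map (liftHalf i))⟩ ::
        vs.map (liftSurface i)) (insertEdge i f x y) =
      listValue (⟨g + 1, (u ++ v) :: cs⟩ :: vs) f := by
  rw [listValue, List.map_cons, List.prod_cons, vertexValue, List.map_cons, List.map_append,
    ← otft_merge, Finset.sum_mul, Finset.mul_sum]
  refine Finset.sum_congr rfl fun x _ => ?_
  rw [Finset.sum_mul, Finset.mul_sum]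
  refine Finset.sum_congr rfl fun y _ => ?_
  by_cases hxy : x.1 = y.1
  · have hk := koszul_insertEdge i f hxy (a := u)
      (b := v ++ (cs.flatten ++ vs.flatMap BdSurface.halfEdges))
    simp only [listValue, List.flatMap_cons, BdSurface.halfEdges, List.flatten_cons,
      ← List.map_flatten, flatMap_liftSurface, List.append_assoc, List.cons_append,
      List.map_append, List.map_cons, List.prod_cons, prod_vertexValue_lift, vertexValue_mk,
      insertEdge_false, insertEdge_true, map_insertEdge_lift, map_map_insertEdge_lift] at hk ⊢
    rw [hk]
    ring
  · simp [inv_eq_zero hxy]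

/-- In the merged surface `v` precedes the circles `cs`, whereas in the unglued pair it follows
them. The Koszul sign of this exchange cancels the sign on the right of `otft_glue`. -/
theorem sum_listValue_glue (g g' : ℕ) (u v : List (Fin m × Bool))
    (cs cs' : List (List (Fin m × Bool))) (vs : List (BdSurface (Fin m × Bool)))
    (h : u ≠ [] ∨ cs ≠ [] ∨ g ≠ 0) (h' : v ≠ [] ∨ cs' ≠ [] ∨ g' ≠ 0)
    (hd : cs.flatten.Disjoint v) :
    ∑ x, ∑ y, F.inv x y * listValue
        (⟨g, ((i, false) :: u.map (liftHalf i)) :: cs.map (List.map (liftHalf i))⟩ ::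
        ⟨g', ((i, true) :: v.map (liftHalf i)) :: cs'.map (List.map (liftHalf i))⟩ ::
        vs.map (liftSurface i)) (insertEdge i f x y) =
      listValue (⟨g + g', (u ++ v) :: (cs ++ cs')⟩ :: vs) f := by
  have key := otft_glue g g' (u.map f) (v.map f) (cs.map (List.map f)) (cs'.map (List.map f))
    (by simpa using h) (by simpa using h')
  have hk : listValue (⟨g + g', (u ++ v) :: (cs ++ cs')⟩ :: vs) f =
      koszul (fun h => (f h).1) ((u ++ cs.flatten) ++ (v ++ (cs'.flatten ++
        vs.flatMap BdSurface.halfEdges))) * (vs.map fun S => vertexValue S f).prod *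
      (psign (par (v.map f) * par (cs.map (List.map f)).flatten) * F.otft (g + g')
        ((u.map f ++ v.map f) :: (cs.map (List.map f) ++ cs'.map (List.map f)))) := by
    rw [List.append_assoc, koszul_swap _ hd, ← par_map, ← par_map, ← List.map_flatten,
      mul_comm (par (cs.flatten.map f))]
    have := psign_mul_self (par (v.map f) * par (cs.flatten.map f))
    simp only [listValue, List.flatMap_cons, BdSurface.halfEdges, List.flatten_cons,
      List.flatten_append, List.append_assoc, List.map_append, List.map_cons, List.prod_cons,
      vertexValue_mk]
    linear_combination (-1 : ℝ) * (koszul (fun h => (f h).1) (u ++ (v ++ (cs.flatten ++ (cs'.flatten ++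
        vs.flatMap BdSurface.halfEdges)))) * (vs.map fun S => vertexValue S f).prod * F.otft (g + g')
        ((u.map f ++ v.map f) :: (cs.map (List.map f) ++ cs'.map (List.map f)))) * this
  rw [hk, ← key, Finset.mul_sum]
  refine Finset.sum_congr rfl fun x _ => ?_
  rw [Finset.mul_sum]
  refine Finset.sum_congr rfl fun y _ => ?_
  by_cases hxy : x.1 = y.1
  · have hk := koszul_insertEdge i f hxy (a := u ++ cs.flatten)
      (b := v ++ (cs'.flatten ++ vs.flatMap BdSurface.halfEdges))
    rw [List.map_append (f := f), par_append, List.map_flatten (f := f)] at hk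
    simp only [listValue, List.flatMap_cons, BdSurface.halfEdges, List.flatten_cons,
      ← List.map_flatten, flatMap_liftSurface, List.append_assoc, List.cons_append,
      List.map_append, List.map_cons, List.prod_cons, prod_vertexValue_lift, vertexValue_mk,
      insertEdge_false, insertEdge_true, map_insertEdge_lift, map_map_insertEdge_lift] at hk ⊢
    rw [hk]
    ring
  · simp [inv_eq_zero hxy]

end DGFrobenius

end

/-! ### Contracting an edge and inserting the inverse of the inner product -/

noncomputable section

theorem List.Nodup.notMem_of_cons_append_cons {α : Type*} {a b : List α} {x y : α}
    (h : (x :: (a ++ y :: b)).Nodup) : x ∉ a ∧ x ∉ b ∧ y ∉ a ∧ y ∉ b := by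
  rw [List.nodup_cons, List.nodup_middle, List.nodup_cons] at h
  simp only [List.mem_append, List.mem_cons, not_or] at h
  exact ⟨h.1.1, h.1.2.2, h.2.1.1, h.2.1.2⟩

theorem liftHalf_mem_of_mem_filterMap {m : ℕ} (i : Fin (m + 1)) {l : List (Fin (m + 1) × Bool)}
    {z : Fin m × Bool} (h : z ∈ l.filterMap (dropHalf i)) : liftHalf i z ∈ l := by
  obtain ⟨x, hx, hz⟩ := List.mem_filterMap.1 h
  obtain ⟨e, he, rfl⟩ := Option.map_eq_some_iff.1 hz
  have hxe : x.1 = i.succAbove e := by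
    by_cases hxi : x.1 = i
    · rw [hxi, finSuccEquiv'_at] at he; simp at he
    · obtain ⟨e', he'⟩ := Fin.exists_succAbove_eq hxi
      rw [← he', finSuccEquiv'_succAbove] at he
      rw [← he', Option.some.inj he]
  rwa [liftHalf, ← hxe]

namespace RibbonGraph

variable {m : ℕ} {γ : RibbonGraph (m + 1)} {i : Fin (m + 1)}
  {S S' : BdSurface (Fin (m + 1) × Bool)}

theorem contract_vertices_self
    (hS : γ.vertices.find? (fun S => (i, false) ∈ S.halfEdges) = some S)
    (hS' : γ.vertices.find? (fun S => (i, true) ∈ S.halfEdges) = some S')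
    (h : (i, true) ∈ S.halfEdges) :
    (γ.contract i).vertices = (S.selfGlue (i, false) (i, true) ::
      γ.vertices.filter fun S => (i, false) ∉ S.halfEdges ∧ (i, true) ∉ S.halfEdges).map
        (BdSurface.relabel (dropHalf i)) := by
  simp only [contract, hS, hS', if_pos h]
  rfl

theorem contract_vertices_glue
    (hS : γ.vertices.find? (fun S => (i, false) ∈ S.halfEdges) = some S)
    (hS' : γ.vertices.find? (fun S => (i, true) ∈ S.halfEdges) = some S')
    (h : (i, true) ∉ S.halfEdges) :
    (γ.contract i).vertices = (S.glue (i, false) (i, true) S' ::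
      γ.vertices.filter fun S => (i, false) ∉ S.halfEdges ∧ (i, true) ∉ S.halfEdges).map
        (BdSurface.relabel (dropHalf i)) := by
  simp only [contract, hS, hS', if_neg h]
  rfl

end RibbonGraph

namespace DGFrobenius

variable {A : Type*} [NonUnitalRing A] [Module ℝ A] {F : DGFrobenius A}
  [FiniteDimensional ℝ A] [IsScalarTower ℝ A A] [SMulCommClass ℝ A A] {m : ℕ}

/-- Contracting an edge amounts to putting the inverse of the inner product on it. -/
theorem vertexMap_contract {γ : RibbonGraph (m + 1)} (once : ∀ h, γ.halfEdges.count h = 1)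
    (stable : ∀ S ∈ γ.vertices,
      4 < 4 * S.genus + 2 * S.boundary.length + S.halfEdges.length)
    (i : Fin (m + 1)) (f : Fin m × Bool → F.Idx) :
    ∑ x, ∑ y, F.inv x y * F.vertexMap γ (insertEdge i f x y) = F.vertexMap (γ.contract i) f := by
  have hmem : ∀ h, ∃ S ∈ γ.vertices, h ∈ S.halfEdges := fun h => by
    have : h ∈ γ.halfEdges := List.count_pos_iff.1 (by rw [once h]; norm_num)
    rw [γ.halfEdges_eq] at this
    exact List.mem_flatMap.1 this
  have hnd : (γ.vertices.flatMap BdSurface.halfEdges).Nodup := by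
    rw [← γ.halfEdges_eq]; exact List.nodup_iff_count_le_one.2 fun h => (once h).le
  have hfind : ∀ h, ∃ S ∈ γ.vertices, h ∈ S.halfEdges ∧
      γ.vertices.find? (fun S => h ∈ S.halfEdges) = some S := fun h => by
    obtain ⟨T, hT, hhT⟩ := hmem h
    have : (γ.vertices.find? (fun S => h ∈ S.halfEdges)).isSome :=
      List.find?_isSome.2 ⟨T, hT, by simpa using hhT⟩
    obtain ⟨S, hS⟩ := Option.isSome_iff_exists.1 this
    exact ⟨S, List.mem_of_find?_eq_some hS, by simpa using List.find?_some hS, hS⟩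
  obtain ⟨S, hSm, hhS, hS⟩ := hfind (i, false)
  obtain ⟨S', hSm', hhS', hS'⟩ := hfind (i, true)
  have hSn : S.halfEdges.Nodup := (List.nodup_flatMap.1 hnd).1 S hSm
  have hSn' : S'.halfEdges.Nodup := (List.nodup_flatMap.1 hnd).1 S' hSm'
  have hne : ((i, true) : Fin (m + 1) × Bool) ≠ (i, false) := by simp
  set R := γ.vertices.filter fun S => (i, false) ∉ S.halfEdges ∧ (i, true) ∉ S.halfEdges with hR
  have hp1 := List.perm_cons_filter_notMem hnd hSm hhS
  -- Three cases: a loop on one circle (split), a loop joining two circles (merge, the genus grows),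
  -- and an edge between different vertices (glue). In each, the vertices concerned are moved to the
  -- front and put in the normal form of the corresponding sum formula.
  by_cases hself : (i, true) ∈ S.halfEdges
  · have hp : γ.vertices.Perm (S :: R) := by
      refine hp1.trans (.of_eq ?_)
      rw [hR]
      congr 1
      refine List.filter_congr fun T hT => ?_
      by_cases hx : (i, false) ∈ T.halfEdges
      · simp [hx]
      · have : (i, true) ∉ T.halfEdges := fun hT' => by
          have := List.eq_of_mem_of_nodup_flatMap hnd hSm hT hself hT'
          exact hx (this ▸ hhS)
        simp [hx, this]
    have hnR := (hp.flatMap_right BdSurface.halfEdges).nodup_iff.1 hnd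
    rw [vertexMap_eq, RibbonGraph.contract_vertices_self hS hS' hself, List.map_cons]
    have hval : ∀ N, S.Same N → ∀ f : Fin (m + 1) × Bool → F.Idx,
        F.vertexMap γ f = listValue (N :: R) f := fun N hN f => by
      rw [vertexMap_eq, listValue_perm f hp hnd,
        listValue_same f (.cons hN (List.forall₂_same.2 fun T _ =>
          ⟨rfl, _, .refl _, List.forall₂_same.2 fun _ _ => .refl _⟩)) hnR]
    have hnN : ∀ N, S.Same N → ((N :: R).flatMap BdSurface.halfEdges).Nodup := fun N hN => by
      rw [List.flatMap_cons] at hnR ⊢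
      exact (hN.perm_halfEdges.append_right _).nodup_iff.1 hnR
    by_cases hc : (i, true) ∈ S.circle (i, false)
    · have hN := BdSurface.same_first_of_mem_circle hSn hhS hc hne
      have h1 := hnN _ hN
      simp only [List.flatMap_cons, BdSurface.halfEdges, List.flatten_cons, List.cons_append,
        List.append_assoc] at h1
      obtain ⟨h2, h3, h4, h5⟩ := h1.notMem_of_cons_append_cons
      simp only [List.mem_append, not_or] at h3 h5
      simp only [hval _ hN]
      rw [BdSurface.selfGlue, if_pos hc]
      simp only [BdSurface.relabel, List.map_cons]
      rw [← sum_listValue_split i, map_filterMap_dropHalf i h2 h4,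
        map_filterMap_dropHalf i h3.1 h5.1, map_map_filterMap_dropHalf i h3.2.1 h5.2.1]
      erw [map_liftSurface_relabel i h3.2.2 h5.2.2]
    · have hN := BdSurface.same_first_second hSn hhS hself hc
      have h1 := hnN _ hN
      simp only [List.flatMap_cons, BdSurface.halfEdges, List.flatten_cons, List.cons_append,
        List.append_assoc] at h1
      obtain ⟨h2, h3, h4, h5⟩ := h1.notMem_of_cons_append_cons
      simp only [List.mem_append, not_or] at h3 h5
      simp only [hval _ hN]
      rw [BdSurface.selfGlue, if_neg hc]
      simp only [BdSurface.relabel, List.map_cons, List.filterMap_append]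
      rw [← sum_listValue_merge i, map_filterMap_dropHalf i h2 h4,
        map_filterMap_dropHalf i h3.1 h5.1, map_map_filterMap_dropHalf i h3.2.1 h5.2.1]
      erw [map_liftSurface_relabel i h3.2.2 h5.2.2]
  · have hSS' : (i, false) ∉ S'.halfEdges := fun hx =>
      hself (List.eq_of_mem_of_nodup_flatMap hnd hSm hSm' hhS hx ▸ hhS')
    have hp : γ.vertices.Perm (S :: S' :: R) := by
      refine hp1.trans (.cons _ ?_)
      have hn2 := (hp1.flatMap_right BdSurface.halfEdges).nodup_iff.1 hnd
      rw [List.flatMap_cons] at hn2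
      have h4 := List.perm_cons_filter_notMem hn2.of_append_right (a := S') (x := (i, true))
        (by simp [hSm', hSS']) hhS'
      rw [List.filter_filter] at h4
      refine h4.trans (.of_eq ?_)
      rw [hR]
      congr 1
      refine List.filter_congr fun c _ => ?_
      simp [Bool.and_comm]
    have hnR := (hp.flatMap_right BdSurface.halfEdges).nodup_iff.1 hnd
    rw [vertexMap_eq, RibbonGraph.contract_vertices_glue hS hS' hself, List.map_cons]
    have hN := BdSurface.same_first hSn hhS
    have hN' := BdSurface.same_first hSn' hhS'
    have hval : ∀ N N', S.Same N → S'.Same N' → ∀ f : Fin (m + 1) × Bool → F.Idx,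
        F.vertexMap γ f = listValue (N :: N' :: R) f := fun N N' hN hN' f => by
      rw [vertexMap_eq, listValue_perm f hp hnd,
        listValue_same f (.cons hN (.cons hN' (List.forall₂_same.2 fun T _ =>
          ⟨rfl, _, .refl _, List.forall₂_same.2 fun _ _ => .refl _⟩))) hnR]
    have h1 := ((hN.perm_halfEdges.append (hN'.perm_halfEdges.append_right
      (R.flatMap BdSurface.halfEdges))).nodup_iff.1 (by simpa only [List.flatMap_cons] using hnR))
    simp only [List.flatMap_cons, BdSurface.halfEdges, List.flatten_cons, List.cons_append] at h1
    obtain ⟨h2, h3, h4, h5⟩ := h1.notMem_of_cons_append_cons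
    simp only [List.mem_append, not_or] at h2 h3 h4 h5
    -- Here stability enters: if all three alternatives failed, `T` would be a disk with one
    -- half-edge, and the count in `stable` would be `0 + 2 + 1 = 3`.
    have hst : ∀ (T : BdSurface (Fin (m + 1) × Bool)) (h : Fin (m + 1) × Bool)
        (u : List (Fin (m + 1) × Bool)) (cs : List (List (Fin (m + 1) × Bool))), T ∈ γ.vertices →
        T.Same ⟨T.genus, (h :: u) :: cs⟩ → u ≠ [] ∨ cs ≠ [] ∨ T.genus ≠ 0 := by
      intro T h u cs hT hN
      by_contra! hcon
      have e1 := stable T hT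
      have e2 := hN.perm_halfEdges.length_eq
      obtain ⟨_, B, hB, hr⟩ := hN
      have e3 := hB.length_eq.trans hr.length_eq
      rw [hcon.1, hcon.2.1] at e2 e3
      simp only [BdSurface.halfEdges, List.flatten_cons, List.flatten_nil, List.append_nil,
        List.length_cons, List.length_nil] at e2 e3
      rw [BdSurface.halfEdges, e2, e3, hcon.2.2] at e1
      omega
    have hnn : ∀ (l : List (Fin (m + 1) × Bool)), (i, false) ∉ l → (i, true) ∉ l → l ≠ [] →
        l.filterMap (dropHalf i) ≠ [] := fun l ha hb hl h0 => hl (by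
      rw [← map_filterMap_dropHalf i ha hb, h0, List.map_nil])
    simp only [hval _ _ hN hN']
    simp only [BdSurface.glue, BdSurface.relabel, List.map_cons, List.filterMap_append,
      List.map_append]
    rw [← sum_listValue_glue i, map_filterMap_dropHalf i h2.1 h4.1,
      map_map_filterMap_dropHalf i h2.2 h4.2,
      map_filterMap_dropHalf i h3.1.1 h5.1.1, map_map_filterMap_dropHalf i h3.1.2 h5.1.2]
    · erw [map_liftSurface_relabel i h3.2 h5.2]
    · rcases hst S _ _ _ hSm hN with h | h | h
      · exact .inl (hnn _ h2.1 h4.1 h)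
      · exact .inr (.inl (by simpa using h))
      · exact .inr (.inr h)
    · rcases hst S' _ _ _ hSm' hN' with h | h | h
      · exact .inl (hnn _ h3.1.1 h5.1.1 h)
      · exact .inr (.inl (by simpa using h))
      · exact .inr (.inr h)
    · intro z hz hz'
      have := List.disjoint_of_nodup_append (List.nodup_cons.1 h1).2
      refine this (a := liftHalf i z) (List.mem_append_right _ ?_)
        (List.mem_cons_of_mem _ (List.mem_append_left _ (List.mem_append_left _
          (liftHalf_mem_of_mem_filterMap i hz'))))
      obtain ⟨l, hl, hzl⟩ := List.mem_flatten.1 hz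
      obtain ⟨l', hl', rfl⟩ := List.mem_map.1 hl
      exact List.mem_flatten.2 ⟨l', hl', liftHalf_mem_of_mem_filterMap i hzl⟩

end DGFrobenius

end

/-! ### The propagator, the chain map property and the cocycle identity -/

noncomputable section

theorem psign_natCast (n : ℕ) : psign (n : ZMod 2) = (-1) ^ n := by
  induction n with
  | zero => simp [psign_zero]
  | succ n ih => rw [Nat.cast_succ, psign_add, ih, psign_one, pow_succ]

/-- Each earlier edge is odd and contributes one. This is the origin of the sign `(-1)^i` in the
coboundary. -/
theorem sum_parity_before {m : ℕ} (q : Fin m × Bool → ZMod 2)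
    (hq : ∀ e, q (e, false) + q (e, true) = 1) (i : Fin m) (b : Bool) :
    psign (∑ y with y.1 < i ∨ (y.1 = i ∧ y.2 < b), q y) =
      (-1) ^ (i : ℕ) * if b then psign (q (i, false)) else 1 := by
  have h1 : (∑ y with y.1 < i ∨ (y.1 = i ∧ y.2 < b), q y) =
      ((i : ℕ) : ZMod 2) + if b then q (i, false) else 0 := by
    rw [Finset.sum_filter, Fintype.sum_prod_type]
    have h2 : ∀ e : Fin m, (∑ c, if e < i ∨ (e = i ∧ c < b) then q (e, c) else 0) =
        (if e < i then 1 else 0) + if e = i then (if b then q (i, false) else 0) else 0 := by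
      intro e
      rw [Fintype.sum_bool]
      rcases lt_trichotomy e i with h | rfl | h
      · simp [h, h.ne, add_comm (q (e, true)), hq]
      · cases b <;> simp
      · simp [h.not_gt, h.ne']
    simp only [h2, Finset.sum_add_distrib, Finset.sum_boole, Finset.sum_ite_eq', Finset.mem_univ,
      if_true]
    congr 2
    have : (Finset.univ.filter fun e => e < i) = Finset.Iio i := by ext; simp
    rw [this, Fin.card_Iio]
  rw [h1, psign_add, psign_natCast]
  cases b <;> simp [psign_zero]

namespace DGFrobenius

variable {A : Type*} [NonUnitalRing A] [Module ℝ A] {F : DGFrobenius A}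
  [FiniteDimensional ℝ A]

/-! ### The components of the propagator -/

theorem coeff_rTensor_invForm (T : A →ₗ[ℝ] A) (x y : F.Idx) :
    F.coeff (T.rTensor A F.invForm) x y =
      ∑ i, F.basis.repr (T (F.basis i)) x * F.basis.repr (F.dual i) y := by
  simp [coeff, invForm, Module.Basis.tensorProduct_repr_tmul_apply, Finsupp.finsetSum_apply, mul_comm]

theorem coeff_invForm (x y : F.Idx) : F.coeff F.invForm x y = F.inv x y := by
  have := coeff_rTensor_invForm (F := F) LinearMap.id x y
  rw [LinearMap.rTensor_id, LinearMap.id_apply] at this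
  rw [this, inv]
  simp [Finsupp.single_apply]

theorem sum_dmat_mul_repr (u : A) (x : F.Idx) :
    ∑ z, F.dmat x z * F.basis.repr u z = F.basis.repr (F.d u) x := by
  conv_rhs => rw [← F.basis.sum_repr u]
  simp only [map_sum, map_smul, Finsupp.finsetSum_apply, Finsupp.smul_apply, smul_eq_mul, dmat,
    mul_comm]

namespace Hodge

variable (D : F.Hodge)

theorem coeff_propagator (x y : F.Idx) : F.coeff D.propagator x y =
    ∑ i, F.basis.coord x (D.s (F.basis i)) * F.basis.coord y (F.dual i) :=
  coeff_rTensor_invForm _ _ _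

/-- The operator `s` is odd and the inverse form is even, so the propagator is an odd tensor. -/
theorem coeff_propagator_of_ne {x y : F.Idx} (h : x.1 + y.1 ≠ 1) :
    F.coeff D.propagator x y = 0 := by
  rw [coeff_propagator]
  refine Finset.sum_eq_zero fun i _ => ?_
  rw [Module.Basis.coord_apply, Module.Basis.coord_apply, basis_repr, basis_repr]
  by_cases hx : x.1 = i.1 + 1
  · rw [F.form_even _ _ _ _ (F.dual_mem y) (F.dual_mem i), mul_zero]
    rintro hy
    apply h
    rw [hx, hy]
    exact (by decide : ∀ i : ZMod 2, i + 1 + i = 1) _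
  · rw [F.form_even _ _ _ _ (F.dual_mem x) (D.s_mem _ _ (F.basis_mem i)) hx, zero_mul]

theorem adjoint_s (i j : F.Idx) :
    F.form (F.dual j) (D.s (F.basis i)) = F.form (psign j.1 • D.s (F.dual j)) (F.basis i) := by
  rw [map_smul, LinearMap.smul_apply, D.form_s _ _ _ (F.dual_mem j), smul_eq_mul, ← mul_assoc,
    psign_mul_self, one_mul]

/-- Moving `s` to the other factor and exchanging the factors of the inverse form both produce the
sign of the parity, and the two cancel. -/
theorem coeff_propagator_comm (x y : F.Idx) :
    F.coeff D.propagator x y = F.coeff D.propagator y x := by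
  have h1 := casimir_adjoint (F := F) (M := ℝ) (fun _ => F.basis.coord x) (fun _ => F.basis.coord y)
    (fun i => D.s (F.basis i)) (fun j => psign j.1 • D.s (F.dual j)) 1 D.adjoint_s
    (fun i => D.s_mem _ _ (F.basis_mem i))
  have h2 := casimir_symm (F := F) (M := ℝ) (fun r => psign r • F.basis.coord x)
    (fun _ => F.basis.coord y ∘ₗ D.s)
  rw [coeff_propagator, coeff_propagator, h1]
  simp only [LinearMap.smul_apply, LinearMap.comp_apply, smul_eq_mul, map_smul] at h2 ⊢
  calc _ = ∑ i : F.Idx, psign i.1 * F.basis.coord x (F.basis i) * F.basis.coord y (D.s (F.dual i)) :=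
        Finset.sum_congr rfl fun _ _ => by ring
    _ = _ := h2
    _ = _ := Finset.sum_congr rfl fun i _ => by
      rw [← mul_assoc, ← mul_assoc, psign_mul_self, one_mul, mul_comm]

/-- The differential of the propagator is the inverse of the inner product, if the harmonic part
vanishes. -/
theorem inv_eq_d_propagator (hp : ∀ a, D.p a = 0) (x y : F.Idx) :
    F.inv x y = ∑ z, F.dmat x z * F.coeff D.propagator z y +
      psign x.1 * ∑ z, F.dmat y z * F.coeff D.propagator x z := by
  have e1 : ∑ z, F.dmat x z * F.coeff D.propagator z y =
      ∑ i, F.basis.coord x (F.d (D.s (F.basis i))) * F.basis.coord y (F.dual i) := by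
    simp only [coeff_propagator, Finset.mul_sum, ← mul_assoc]
    rw [Finset.sum_comm]
    refine Finset.sum_congr rfl fun i _ => ?_
    rw [← Finset.sum_mul, Module.Basis.coord_apply _ x, ← sum_dmat_mul_repr]
    simp
  -- The differential on the second factor is moved to the first by `adjoint_d`, giving `sd`. Its
  -- minus sign is absorbed because `s` shifts the parity of `x` by one. Together with `e1` this is
  -- `ds + sd = 1`.
  have e2 : psign x.1 * ∑ z, F.dmat y z * F.coeff D.propagator x z =
      ∑ i, F.basis.coord x (D.s (F.d (F.basis i))) * F.basis.coord y (F.dual i) := by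
    have h1 := casimir_adjoint (F := F) (M := ℝ) (fun _ => F.basis.coord x ∘ₗ D.s)
      (fun _ => F.basis.coord y)
      (fun i => F.d (F.basis i)) (fun j => -psign j.1 • F.d (F.dual j)) 1 adjoint_d
      (fun i => F.d_mem _ _ (F.basis_mem i))
    simp only [LinearMap.comp_apply, map_smul, smul_eq_mul] at h1
    rw [h1]
    simp only [coeff_propagator, Finset.mul_sum]
    rw [Finset.sum_comm]
    refine Finset.sum_congr rfl fun i _ => ?_
    rw [Module.Basis.coord_apply _ y, ← sum_dmat_mul_repr, Finset.mul_sum, Finset.mul_sum]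
    refine Finset.sum_congr rfl fun z _ => ?_
    by_cases hx : x.1 = i.1 + 1
    · rw [hx, psign_add, psign_one, Module.Basis.coord_apply _ z]; ring
    · rw [Module.Basis.coord_apply, basis_repr,
        F.form_even _ _ _ _ (F.dual_mem x) (D.s_mem _ _ (F.basis_mem i)) hx]
      ring
  rw [e1, e2, ← coeff_invForm, ← LinearMap.id_apply (R := ℝ) F.invForm, ← LinearMap.rTensor_id,
    coeff_rTensor_invForm, ← Finset.sum_add_distrib]
  refine Finset.sum_congr rfl fun i _ => ?_
  have := D.homotopy (F.basis i)
  rw [hp, sub_zero] at this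
  rw [← add_mul, ← map_add, this]
  rfl

end Hodge

variable [IsScalarTower ℝ A A] [SMulCommClass ℝ A A]

/-! ### The vertex map is a chain map -/

theorem vertexValue_congr {m : ℕ} {S : BdSurface (Fin m × Bool)} {f f' : Fin m × Bool → F.Idx}
    (h : ∀ x ∈ S.halfEdges, f x = f' x) : vertexValue S f = vertexValue S f' :=
  otft_congr _ h

/-- Leibniz rule over the vertices: each summand contains a factor that vanishes by `dsum_otft`. -/
theorem dsum_prod_vertexValue {m : ℕ} {vs : List (BdSurface (Fin m × Bool))}
    (h : (vs.flatMap BdSurface.halfEdges).Nodup) (f : Fin m × Bool → F.Idx) :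
    dsum (vs.flatMap BdSurface.halfEdges)
      (fun f => (vs.map fun S => vertexValue S f).prod) f = 0 := by
  induction vs with
  | nil => rfl
  | cons S vs ih =>
    rw [List.flatMap_cons] at h ⊢
    have hd := List.disjoint_of_nodup_append h
    simp only [List.map_cons, List.prod_cons]
    rw [dsum_append, dsum_map (LinearMap.mulRight ℝ (vs.map fun S => vertexValue S f).prod)
      S.halfEdges (fun f => vertexValue S f), dsum_map (LinearMap.mulLeft ℝ (vertexValue S f))
      (vs.flatMap BdSurface.halfEdges) (fun f => (vs.map fun S => vertexValue S f).prod),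
      ih h.of_append_right]
    · have := dsum_otft (F := F) h.of_append_left S.genus f
      change LinearMap.mulRight ℝ _ (dsum S.boundary.flatten _ f) + _ = _
      erw [this]
      simp
    · intro x hx y _
      rw [LinearMap.mulLeft_apply, vertexValue_congr (S := S) (f' := f)]
      intro z hz
      exact Function.update_of_ne (fun e : z = x => hd (e ▸ hz) hx) _ _
    · intro x hx y _
      rw [LinearMap.mulRight_apply]
      congr 2
      refine List.map_congr_left fun T hT => vertexValue_congr fun z hz => ?_
      exact Function.update_of_ne
        (fun e : z = x => hd hx (e ▸ List.mem_flatMap.2 ⟨T, hT, hz⟩)) _ _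

/-- Translates the signs of the differential from the edge-by-edge order of half-edges to their
order at the vertices. The discrepancy is the change of the Koszul sign in `koszul_update`. -/
theorem sum_koszul_update {m : ℕ} {l : List (Fin m × Bool)} (hl : l.Nodup) (hc : ∀ x, x ∈ l)
    (G : (Fin m × Bool → F.Idx) → ℝ) (f : Fin m × Bool → F.Idx) :
    ∑ h, psign (∑ y with y.1 < h.1 ∨ (y.1 = h.1 ∧ y.2 < h.2), (f y).1) *
      ∑ x, F.dmat x (f h) * (koszul (fun y => (Function.update f h x y).1) l *
        G (Function.update f h x)) = koszul (fun y => (f y).1) l * dsum l G f := by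
  set T : Fin m × Bool → ℝ := fun h =>
    psign (∑ y with y.1 < h.1 ∨ (y.1 = h.1 ∧ y.2 < h.2), (f y).1) *
      ∑ x, F.dmat x (f h) * (koszul (fun y => (Function.update f h x y).1) l *
        G (Function.update f h x)) with hT
  have key : ∀ b a, l = a ++ b → (b.map T).sum =
      koszul (fun y => (f y).1) l * (psign (par (a.map f)) * dsum b G f) := by
    intro b
    induction b with
    | nil => intro a _; simp [dsum]
    | cons h b ih =>
      intro a hab
      have := ih (a ++ [h]) (by simpa using hab)
      rw [List.map_cons, List.sum_cons, this, dsum]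
      have hTh : T h = koszul (fun y => (f y).1) l * psign (par (a.map f)) *
          ∑ x, F.dmat x (f h) • G (Function.update f h x) := by
        simp only [hT]
        rw [Finset.mul_sum, Finset.mul_sum]
        refine Finset.sum_congr rfl fun x _ => ?_
        by_cases hx : x.1 = (f h).1 + 1
        · have hk := koszul_update (fun y => (f y).1) (a := a) (b := b) (h := h) (hab ▸ hl)
            (hab ▸ hc) x.1 hx
          have hu : (fun y => (Function.update f h x y).1) =
              Function.update (fun y => (f y).1) h x.1 := by
            funext y
            by_cases hy : y = h
            · subst hy; simp
            · simp [hy]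
          rw [← hab] at hk
          rw [hu, par_map, smul_eq_mul]
          linear_combination F.dmat x (f h) * G (Function.update f h x) * hk
        · rw [dmat_eq_zero hx]; simp
      rw [hTh]
      simp only [List.map_append, List.map_cons, List.map_nil, par_append, par_cons, par_nil,
        add_zero, psign_add, smul_eq_mul]
      ring
  have h1 := key l [] rfl
  simp only [List.map_nil, par_nil, psign_zero, one_mul] at h1
  rw [← h1, ← List.sum_toFinset _ hl]
  congr 1
  ext x
  simp [hc x]

theorem sum_vertexMap_update {m : ℕ} {γ : RibbonGraph m} (once : ∀ h, γ.halfEdges.count h = 1)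
    (f : Fin m × Bool → F.Idx) :
    ∑ h, psign (∑ y with y.1 < h.1 ∨ (y.1 = h.1 ∧ y.2 < h.2), (f y).1) *
      ∑ x, F.dmat x (f h) * F.vertexMap γ (Function.update f h x) = 0 := by
  have hnd : γ.halfEdges.Nodup := List.nodup_iff_count_le_one.2 fun h => (once h).le
  have hc : ∀ h, h ∈ γ.halfEdges := fun h => List.count_pos_iff.1 (by rw [once h]; norm_num)
  have := sum_koszul_update hnd hc (fun f => (γ.vertices.map fun S => vertexValue S f).prod) f
  rw [γ.halfEdges_eq] at this hnd
  rw [dsum_prod_vertexValue hnd, mul_zero] at this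
  rw [← this]
  simp only [vertexMap_eq, listValue]

/-! ### The coboundary of the dual construction -/

/-- Exchanging the summation variable with the label at `h` is an involution. It serves to transfer
the matrix of `d` from the propagator to the vertex map. -/
theorem sum_update_swap {H I : Type*} [DecidableEq H] [Fintype I] [Fintype (H → I)] (h : H)
    (Ψ : (H → I) → I → ℝ) :
    ∑ f, ∑ z, Ψ f z = ∑ f, ∑ x, Ψ (Function.update f h x) (f h) := by
  have h1 := Fintype.sum_prod_type' (γ := ℝ) fun f z => Ψ f z
  have h2 := Fintype.sum_prod_type' (γ := ℝ) fun (f : H → I) x => Ψ (Function.update f h x) (f h)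
  rw [← h1, ← h2]
  let e : (H → I) × I ≃ (H → I) × I :=
    ⟨fun p => (Function.update p.1 h p.2, p.1 h), fun p => (Function.update p.1 h p.2, p.1 h),
      fun p => by simp, fun p => by simp⟩
  exact Fintype.sum_equiv e _ _ fun p => by simp [e]

theorem sum_insertEdge {m : ℕ} (i : Fin (m + 1)) (Ψ : (Fin (m + 1) × Bool → F.Idx) → ℝ) :
    ∑ f : Fin m × Bool → F.Idx, ∑ x, ∑ y, Ψ (insertEdge i f x y) = ∑ f, Ψ f := by
  have h1 : ∀ f : Fin m × Bool → F.Idx, ∑ x, ∑ y, Ψ (insertEdge i f x y) =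
      ∑ p : F.Idx × F.Idx, Ψ (insertEdge i f p.1 p.2) := fun f =>
    (Fintype.sum_prod_type' (γ := ℝ) fun x y => Ψ (insertEdge i f x y)).symm
  simp only [h1]
  rw [← Fintype.sum_prod_type' (γ := ℝ) fun (f : Fin m × Bool → F.Idx) (p : F.Idx × F.Idx) =>
    Ψ (insertEdge i f p.1 p.2)]
  refine Fintype.sum_bijective
    (fun p : (Fin m × Bool → F.Idx) × (F.Idx × F.Idx) => insertEdge i p.1 p.2.1 p.2.2) ⟨?_, ?_⟩ _ _
    fun _ => rfl
  · rintro ⟨f, x, y⟩ ⟨f', x', y'⟩ h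
    have hx := congrFun h (i, false)
    have hy := congrFun h (i, true)
    have hf : f = f' := by
      funext z
      have := congrFun h (liftHalf i z)
      simpa using this
    simp only [insertEdge_false, insertEdge_true] at hx hy
    rw [hf, hx, hy]
  · intro f
    refine ⟨(f ∘ liftHalf i, f (i, false), f (i, true)), ?_⟩
    funext z
    obtain ⟨e, b⟩ := z
    by_cases he : e = i
    · subst he; cases b <;> simp
    · obtain ⟨e', rfl⟩ := Fin.exists_succAbove_eq he
      exact insertEdge_lift i _ _ _ (e', b)

/-- After `⟨-,-⟩⁻¹` is replaced by `dP` on the contracted edge and `d` is transposed, every edge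
carries `P` again, and the alternating sum becomes `T ∘ d` evaluated on `P ⊗ ⋯ ⊗ P`. -/
theorem Hodge.sum_contract_eq_zero (D : F.Hodge) (hp : ∀ a, D.p a = 0) {m : ℕ}
    {γ : RibbonGraph (m + 1)} (once : ∀ h, γ.halfEdges.count h = 1)
    (stable : ∀ S ∈ γ.vertices,
      4 < 4 * S.genus + 2 * S.boundary.length + S.halfEdges.length) :
    ∑ i : Fin (m + 1), (-1 : ℝ) ^ (i : ℕ) * D.dualCochain.onGraph m (γ.contract i) = 0 := by
  set P : F.Idx → F.Idx → ℝ := fun x y => F.coeff D.propagator x y with hP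
  set W : Fin (m + 1) → (Fin (m + 1) × Bool → F.Idx) → ℝ := fun i f =>
    ∏ e : Fin m, P (f (i.succAbove e, false)) (f (i.succAbove e, true)) with hW
  set V := F.vertexMap γ with hV
  have hWu : ∀ i f b x, W i (Function.update f (i, b) x) = W i f := by
    intro i f b x
    refine Finset.prod_congr rfl fun e _ => ?_
    rw [Function.update_of_ne, Function.update_of_ne] <;>
    · intro h
      exact Fin.succAbove_ne i e (congrArg Prod.fst h)
  have hPW : ∀ i f, P (f (i, false)) (f (i, true)) * W i f =
      ∏ e, P (f (e, false)) (f (e, true)) := fun i f =>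
    (Fin.prod_univ_succAbove (fun e => P (f (e, false)) (f (e, true))) i).symm
  have h1 : ∀ i, D.dualCochain.onGraph m (γ.contract i) =
      ∑ f, V f * F.inv (f (i, false)) (f (i, true)) * W i f := by
    intro i
    change F.contractEdges (γ.contract i) (fun _ => P) = _
    rw [contractEdges_real, ← sum_insertEdge i]
    refine Finset.sum_congr rfl fun f _ => ?_
    rw [← vertexMap_contract once stable, Finset.sum_mul]
    refine Finset.sum_congr rfl fun x _ => ?_
    rw [Finset.sum_mul]
    refine Finset.sum_congr rfl fun y _ => ?_
    rw [insertEdge_false, insertEdge_true, mul_comm (V _)]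
    congr 1
    refine Finset.prod_congr rfl fun e _ => ?_
    exact (congrArg₂ P (insertEdge_lift i f x y (e, false)) (insertEdge_lift i f x y (e, true))).symm
  have h2 : ∀ i, D.dualCochain.onGraph m (γ.contract i) =
      ∑ f, (∏ e, P (f (e, false)) (f (e, true))) *
        (∑ x, F.dmat x (f (i, false)) * V (Function.update f (i, false) x) +
          psign (f (i, false)).1 *
            ∑ x, F.dmat x (f (i, true)) * V (Function.update f (i, true) x)) := by
    intro i
    have e1 := sum_update_swap (i, false) fun f z =>
      V f * (F.dmat (f (i, false)) z * P z (f (i, true))) * W i f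
    have e2 := sum_update_swap (i, true) fun f z =>
      V f * (psign (f (i, false)).1 * (F.dmat (f (i, true)) z * P (f (i, false)) z)) * W i f
    have hft : ((i, true) : Fin (m + 1) × Bool) ≠ (i, false) := by simp
    simp only [Function.update_self, Function.update_of_ne hft, Function.update_of_ne hft.symm,
      hWu] at e1 e2
    rw [h1]
    simp only [D.inv_eq_d_propagator hp, mul_add, add_mul, Finset.sum_add_distrib]
    congr 1
    · simp only [Finset.mul_sum, Finset.sum_mul]
      refine e1.trans ?_
      refine Finset.sum_congr rfl fun f _ => Finset.sum_congr rfl fun x _ => ?_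
      rw [← hPW i]; ring
    · simp only [Finset.mul_sum, Finset.sum_mul]
      refine e2.trans ?_
      refine Finset.sum_congr rfl fun f _ => Finset.sum_congr rfl fun x _ => ?_
      rw [← hPW i]; ring
  simp only [h2]
  conv_lhs => enter [2, i]; rw [Finset.mul_sum]
  rw [Finset.sum_comm]
  refine Finset.sum_eq_zero fun f _ => ?_
  -- On labellings with all edges odd, the signs `(-1)^i` are the Koszul signs of `d`, so
  -- `sum_vertexMap_update` applies. On all others some propagator vanishes.
  by_cases hq : ∀ e, (f (e, false)).1 + (f (e, true)).1 = 1
  · have key := sum_vertexMap_update once f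
    simp only [sum_parity_before (fun y => (f y).1) hq] at key
    rw [Fintype.sum_prod_type, ← hV] at key
    rw [← mul_zero (∏ e, P (f (e, false)) (f (e, true))), ← key, Finset.mul_sum]
    refine Finset.sum_congr rfl fun i _ => ?_
    rw [Fintype.sum_bool]
    simp only [if_true, Bool.false_eq_true, if_false]
    ring
  · push Not at hq
    obtain ⟨e, he⟩ := hq
    refine Finset.sum_eq_zero fun i _ => ?_
    rw [Finset.prod_eq_zero (Finset.mem_univ e) (D.coeff_propagator_of_ne he)]
    ring

end DGFrobenius

end

/-! ### The heat operator and the propagator as an integral -/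

noncomputable section

section MatrixExp

attribute [local instance] Matrix.linftyOpNormedRing Matrix.linftyOpNormedAlgebra

/-- `S` absorbs every power of `N`, so the exponential series acts on it as a scalar series. -/
theorem Matrix.mul_exp_smul_of_mul_eq {n : Type*} [Fintype n] [DecidableEq n]
    {S N : Matrix n n ℝ} (h : S * N = S) (t : ℝ) :
    S * NormedSpace.exp (t • N) = Real.exp t • S := by
  have hpow : ∀ k : ℕ, S * N ^ k = S := by
    intro k
    induction k with
    | zero => simp
    | succ k ih => rw [pow_succ, ← mul_assoc, ih, h]
  have h1 := (NormedSpace.exp_series_hasSum_exp' (𝕂 := ℝ) (t • N)).mul_left S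
  have h2 := (NormedSpace.exp_series_hasSum_exp' (𝕂 := ℝ) t).smul_const S
  rw [← Real.exp_eq_exp_ℝ] at h2
  have he : (fun k : ℕ => S * (((k.factorial : ℝ)⁻¹) • (t • N) ^ k)) =
      fun k : ℕ => (((k.factorial : ℝ)⁻¹) • t ^ k) • S := by
    funext k
    rw [smul_pow, mul_smul_comm, mul_smul_comm, hpow, smul_eq_mul, mul_smul]
  rw [he] at h1
  exact h1.unique h2

end MatrixExp

namespace DGFrobenius.Hodge

variable {A : Type*} [NonUnitalRing A] [Module ℝ A] {F : DGFrobenius A} 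

/-- The image of `p` consists of cycles, which are now exact, and `p` is idempotent and kills exact
elements. -/
theorem p_eq_zero (D : F.Hodge) (h : F.Contractible) (a : A) : D.p a = 0 := by
  obtain ⟨b, hb⟩ := h (D.p a) (D.d_p a)
  rw [← D.p_p, ← hb, D.p_d]

variable [FiniteDimensional ℝ A] (D : F.Hodge)

theorem comp_heat {T : A →ₗ[ℝ] A} (h : ∀ a, T (D.laplacian a) = T a) (t : ℝ) :
    T ∘ₗ D.heat t = Real.exp (-t) • T := by
  have hm : LinearMap.toMatrix F.basis F.basis T *
      LinearMap.toMatrix F.basis F.basis D.laplacian = LinearMap.toMatrix F.basis F.basis T := by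
    rw [← LinearMap.toMatrix_comp]
    exact congrArg _ (LinearMap.ext h)
  apply (LinearMap.toMatrix F.basis F.basis).injective
  rw [LinearMap.toMatrix_comp F.basis F.basis F.basis, heat, LinearMap.toMatrix_toLin,
    Matrix.mul_exp_smul_of_mul_eq hm, map_smul]

theorem laplacian_apply (a : A) : D.laplacian a = a - D.p a := D.homotopy a

theorem sKernel_eq (t : ℝ) : D.sKernel t = Real.exp (-t) • D.propagator := by
  rw [sKernel, kernel, propagator, ← LinearMap.rTensor_comp_apply,
    D.comp_heat (fun a => by rw [laplacian_apply, map_sub, D.s_p, sub_zero]),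
    LinearMap.rTensor_smul, LinearMap.smul_apply]

/-- Integrals in `A ⊗ A` are tested against linear functionals. By `sKernel_eq` each of them is a
multiple of `e^{-t}`. -/
theorem integrableOn_sKernel (φ : A ⊗[ℝ] A →ₗ[ℝ] ℝ) :
    MeasureTheory.IntegrableOn (fun t : ℝ => φ (D.sKernel t)) (Set.Ioi 0) := by
  simp only [sKernel_eq, map_smul, smul_eq_mul]
  exact (integrableOn_exp_neg_Ioi 0).mul_const _

theorem integral_sKernel (φ : A ⊗[ℝ] A →ₗ[ℝ] ℝ) :
    ∫ t in Set.Ioi (0 : ℝ), φ (D.sKernel t) = φ D.propagator := by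
  simp only [sKernel_eq, map_smul, smul_eq_mul]
  rw [MeasureTheory.integral_mul_const, integral_exp_neg_Ioi_zero, one_mul]

end DGFrobenius.Hodge

theorem List.reverse_ofFn {α : Type*} {n : ℕ} (f : Fin n → α) :
    (List.ofFn f).reverse = List.ofFn fun i => f i.rev := by
  refine List.ext_getElem (by simp) fun i h1 h2 => ?_
  simp only [List.getElem_reverse, List.getElem_ofFn, List.length_ofFn]
  congr 1
  ext
  simp [Fin.rev]
  omega

/-! ### Top-degree parts of products in the exterior algebra -/

namespace ExteriorAlgebra

variable {R M : Type*} [CommRing R] [AddCommGroup M] [Module R M]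

/-- The elements of the exterior algebra of degree less than `n`. -/
def degreeLT (R M : Type*) [CommRing R] [AddCommGroup M] [Module R M] (n : ℕ) :
    Submodule R (ExteriorAlgebra R M) :=
  Submodule.span R {x | ∃ j < n, ∃ v : Fin j → M, x = ιMulti R j v}

theorem degreeLT_mono {m n : ℕ} (h : m ≤ n) : degreeLT R M m ≤ degreeLT R M n :=
  Submodule.span_mono fun _ ⟨j, hj, v, hx⟩ => ⟨j, hj.trans_le h, v, hx⟩

theorem ιMulti_mem_degreeLT {j n : ℕ} (h : j < n) (v : Fin j → M) :
    ιMulti R j v ∈ degreeLT R M n := Submodule.subset_span ⟨j, h, v, rfl⟩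

theorem ι_mul_mem_degreeLT {n : ℕ} {x : ExteriorAlgebra R M} (h : x ∈ degreeLT R M n) (v : M) :
    ι R v * x ∈ degreeLT R M (n + 1) := by
  induction h using Submodule.span_induction with
  | mem x hx =>
    obtain ⟨j, hj, w, rfl⟩ := hx
    have := ιMulti_mem_degreeLT (R := R) (Nat.succ_lt_succ hj) (Matrix.vecCons v w)
    rwa [ιMulti_succ_apply] at this
  | zero => rw [mul_zero]; exact zero_mem _
  | add x y _ _ hx hy => rw [mul_add]; exact add_mem hx hy
  | smul a x _ hx => rw [mul_smul_comm]; exact Submodule.smul_mem _ _ hx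

theorem prod_sub_ιMulti_mem_degreeLT (n : ℕ) (c : Fin n → R) (v : Fin n → M) :
    (List.ofFn fun i => algebraMap R (ExteriorAlgebra R M) (c i) + ι R (v i)).prod -
      ιMulti R n v ∈ degreeLT R M n := by
  induction n with
  | zero => simp
  | succ n ih =>
    have h := ih (fun i => c i.succ) (fun i => v i.succ)
    set P := (List.ofFn fun i : Fin n =>
      algebraMap R (ExteriorAlgebra R M) (c i.succ) + ι R (v i.succ)).prod
    set I := ιMulti R n fun i : Fin n => v i.succ
    have hI : ιMulti R (n + 1) v = ι R (v 0) * I := ιMulti_succ_apply v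
    have hP : P ∈ degreeLT R M (n + 1) := by
      rw [← sub_add_cancel P I]
      exact add_mem (degreeLT_mono n.le_succ h) (ιMulti_mem_degreeLT n.lt_succ_self _)
    rw [List.ofFn_succ, List.prod_cons, hI, add_mul, ← Algebra.smul_def, add_sub_assoc, ← mul_sub]
    exact add_mem (Submodule.smul_mem _ _ hP) (ι_mul_mem_degreeLT h _)

end ExteriorAlgebra

/-! ### Costello's forms and their integrals -/

namespace DGFrobenius.Hodge

theorem topCoeff_eq_zero_of_mem {k : ℕ} {x : ExteriorAlgebra ℝ (Fin k → ℝ)}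
    (h : x ∈ ExteriorAlgebra.degreeLT ℝ (Fin k → ℝ) k) : topCoeff k x = 0 := by
  induction h using Submodule.span_induction with
  | mem x hx =>
    obtain ⟨j, hj, w, rfl⟩ := hx
    rw [topCoeff, ExteriorAlgebra.liftAlternating_apply_ιMulti, Pi.single_eq_of_ne hj.ne]
    rfl
  | zero => exact map_zero _
  | add x y _ _ hx hy => rw [map_add, hx, hy, add_zero]
  | smul a x _ hx => rw [map_smul, hx, smul_zero]

/-- The scalars `c j` only produce terms of lower degree. The reversed order of the factors is that
of the volume form `dt_k ∧ … ∧ dt_1`, so no sign appears. -/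
theorem topCoeff_prod (k : ℕ) (c s : Fin k → ℝ) :
    topCoeff k (List.ofFn fun j => algebraMap ℝ (ExteriorAlgebra ℝ (Fin k → ℝ)) (c j) +
      s j • ExteriorAlgebra.ι ℝ (Pi.single j (1 : ℝ))).reverse.prod = ∏ j, s j := by
  have h := topCoeff_eq_zero_of_mem (ExteriorAlgebra.prod_sub_ιMulti_mem_degreeLT k
    (fun j => c j.rev) fun j => s j.rev • (Pi.single j.rev (1 : ℝ) : Fin k → ℝ))
  rw [map_sub, sub_eq_zero] at h
  simp only [map_smul] at h
  rw [List.reverse_ofFn, h, topCoeff, ExteriorAlgebra.liftAlternating_apply_ιMulti,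
    Pi.single_eq_same, AlternatingMap.map_smul_univ,
    show (fun j : Fin k => (Pi.single j.rev (1 : ℝ) : Fin k → ℝ)) =
      (Pi.basisFun ℝ (Fin k)).reindex Fin.revPerm by ext j; simp, Module.Basis.det_self,
    smul_eq_mul, mul_one]
  exact Equiv.prod_comp Fin.revPerm s

variable {A : Type*} [NonUnitalRing A] [Module ℝ A] {F : DGFrobenius A} [FiniteDimensional ℝ A]
  (D : F.Hodge)

theorem topCoeff_costelloForm [IsScalarTower ℝ A A] [SMulCommClass ℝ A A] {k : ℕ}
    (γ : RibbonGraph (k + 0)) (t : Fin k → ℝ) :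
    topCoeff k (D.costelloForm γ t) = (∏ j, Real.exp (-t j)) * D.dualCochain.onGraph k γ := by
  have hγ : D.dualCochain.onGraph k γ = ∑ f, F.vertexMap γ f *
      ∏ e : Fin k, F.coeff D.propagator (f (e, false)) (f (e, true)) :=
    contractEdges_real ..
  have hform : D.costelloForm γ t = F.contractEdges (m := k) γ fun e => D.alpha e t := by
    rw [costelloForm]
    refine congrArg (F.contractEdges γ) (funext fun e => funext fun x => funext fun y => ?_)
    -- Without white edges, every edge carries `α`.
    exact Fin.addCases_left (n := 0) e
  rw [hγ, hform, contractEdges, map_sum, Finset.mul_sum]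
  refine Finset.sum_congr rfl fun f _ => ?_
  rw [map_smul, mul_left_comm, ← Finset.prod_mul_distrib, smul_eq_mul]
  congr 1
  simp only [alpha]
  rw [topCoeff_prod k (fun j => F.coeff (D.kernel (t j)) (f (j, false)) (f (j, true)))
    fun j => F.coeff (D.sKernel (t j)) (f (j, false)) (f (j, true))]
  refine Finset.prod_congr rfl fun j _ => ?_
  rw [sKernel_eq, coeff, map_smul, Finsupp.smul_apply, smul_eq_mul, coeff]

theorem costelloForm_eq_zero (hp : ∀ a, D.p a = 0) {k w : ℕ} (γ : RibbonGraph (k + (w + 1)))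
    (t : Fin k → ℝ) : D.costelloForm γ t = 0 := by
  have h0 : D.whiteTensor = 0 := by
    rw [whiteTensor, show D.p = 0 from LinearMap.ext hp, LinearMap.rTensor_zero,
      LinearMap.zero_apply]
  refine Finset.sum_eq_zero fun f _ => ?_
  rw [List.prod_eq_zero, smul_zero]
  rw [List.mem_reverse, List.mem_ofFn]
  refine ⟨Fin.natAdd k 0, ?_⟩
  simp only [Fin.addCases_right, h0, coeff, map_zero, Finsupp.zero_apply]

theorem restrict_Ici_eq_pi (k : ℕ) :
    (MeasureTheory.volume : MeasureTheory.Measure (Fin k → ℝ)).restrict (Set.Ici 0) =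
      MeasureTheory.Measure.pi fun _ => MeasureTheory.volume.restrict (Set.Ici (0 : ℝ)) := by
  rw [← MeasureTheory.Measure.restrict_pi_pi, Set.pi_univ_Ici]
  rfl

theorem integrableOn_prod_exp_neg (k : ℕ) : MeasureTheory.IntegrableOn
    (fun t : Fin k → ℝ => ∏ j, Real.exp (-t j)) (Set.Ici 0) := by
  rw [MeasureTheory.IntegrableOn, restrict_Ici_eq_pi]
  exact MeasureTheory.Integrable.fintype_prod fun _ =>
    (integrableOn_Ici_iff_integrableOn_Ioi).2 (integrableOn_exp_neg_Ioi 0)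

theorem integral_prod_exp_neg (k : ℕ) :
    ∫ t in Set.Ici (0 : Fin k → ℝ), ∏ j, Real.exp (-t j) = 1 := by
  rw [restrict_Ici_eq_pi, MeasureTheory.integral_fintype_prod_eq_prod (fun _ t => Real.exp (-t))]
  simp only [MeasureTheory.integral_Ici_eq_integral_Ioi, integral_exp_neg_Ioi_zero,
    Finset.prod_const_one]

variable [IsScalarTower ℝ A A] [SMulCommClass ℝ A A]

theorem integrableOn_costelloForm (hp : ∀ a, D.p a = 0) {k w : ℕ} (γ : RibbonGraph (k + w)) :
    MeasureTheory.IntegrableOn (fun t : Fin k → ℝ => topCoeff k (D.costelloForm γ t))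
      (Set.Ici 0) := by
  cases w with
  | zero =>
    simp only [topCoeff_costelloForm]
    exact (integrableOn_prod_exp_neg k).mul_const _
  | succ w => simp only [D.costelloForm_eq_zero hp, map_zero, MeasureTheory.integrableOn_zero]

theorem costelloIntegral_zero {k : ℕ} (γ : RibbonGraph (k + 0)) :
    D.costelloIntegral γ = D.dualCochain.onGraph k γ := by
  simp only [costelloIntegral, topCoeff_costelloForm]
  rw [MeasureTheory.integral_mul_const, integral_prod_exp_neg, one_mul]

theorem costelloIntegral_succ (hp : ∀ a, D.p a = 0) {k w : ℕ} (γ : RibbonGraph (k + (w + 1))) :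
    D.costelloIntegral γ = 0 := by
  simp only [costelloIntegral, D.costelloForm_eq_zero hp, map_zero, MeasureTheory.integral_zero]

end DGFrobenius.Hodge

end

/-! ### A graph with one edge in every type, and the conclusion -/

noncomputable section

namespace RibbonGraph

theorem flip_eq_swap : (flip : Equiv.Perm (Fin 1 × Bool)) = Equiv.swap (0, false) (0, true) := by
  decide

theorem card_sameCycle_one {α : Type*} [Fintype α] :
    Nat.card (Quotient (Equiv.Perm.SameCycle.setoid (1 : Equiv.Perm α))) = Fintype.card α := by
  have h : Function.Bijective (Quotient.mk (Equiv.Perm.SameCycle.setoid (1 : Equiv.Perm α))) := by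
    refine ⟨fun x y hxy => ?_, Quotient.mk_surjective⟩
    exact Equiv.Perm.sameCycle_one.mp (Quotient.exact hxy)
  rw [← Nat.card_eq_of_bijective _ h, Nat.card_eq_fintype_card]

theorem card_sameCycle_flip :
    Nat.card (Quotient (Equiv.Perm.SameCycle.setoid (flip : Equiv.Perm (Fin 1 × Bool)))) = 1 := by
  rw [Nat.card_eq_one_iff_unique]
  refine ⟨⟨fun x y => ?_⟩, ⟨Quotient.mk _ (0, false)⟩⟩
  have h1 : ∀ z : Fin 1 × Bool, Equiv.Perm.SameCycle flip (0, false) z := by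
    rintro ⟨e, b⟩
    obtain rfl := Subsingleton.elim e 0
    cases b
    · exact Equiv.Perm.SameCycle.refl _ _
    · exact ⟨1, rfl⟩
  induction x using Quotient.inductionOn with
  | h x =>
    induction y using Quotient.inductionOn with
    | h y => exact Quotient.sound ((h1 x).symm.trans (h1 y))

/-- Needed to reach the point at infinity: when the single edge is white, the cell is a point that
is mapped there. -/
theorem exists_hasType_one {g n : ℕ} (hn : 1 ≤ n) (hgn : 2 < 2 * g + n) :
    ∃ γ : RibbonGraph 1, γ.HasType g n := by
  obtain rfl | ⟨n, rfl⟩ : n = 1 ∨ ∃ k, n = k + 2 := by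
    rcases n with _ | _ | n <;> simp_all
  · obtain ⟨g, rfl⟩ : ∃ k, g = k + 1 := ⟨g - 1, by omega⟩
    -- For one boundary circle: the edge joins two circles of a vertex of genus one less, merging
    -- them and restoring the genus.
    refine ⟨⟨[⟨g, [[(0, false)], [(0, true)]]⟩]⟩, ?_, ?_, ?_, ?_, ?_, ?_, ?_⟩
    · change ∀ h : Fin 1 × Bool, List.count h [(0, false), (0, true)] = 1
      decide
    · simp
    · simp [BdSurface.halfEdges]
    · simp
    · rintro ⟨x, hx⟩ ⟨y, hy⟩
      simp only [List.length_singleton, Nat.lt_one_iff] at hx hy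
      subst hx hy
      exact Relation.EqvGen.refl _
    · have h : (next ⟨[⟨g, [[(0, false)], [(0, true)]]⟩]⟩ : Equiv.Perm (Fin 1 × Bool)) = 1 := by
        simp [next, circles]
      rw [faces, h, one_mul, card_sameCycle_flip]
      simp [circles]
    · simp
      ring
  · have hc : circles (⟨[⟨g, [(0, false), (0, true)] :: List.replicate n []⟩]⟩ : RibbonGraph 1) =
        [(0, false), (0, true)] :: List.replicate n [] := by simp [circles]
    refine ⟨⟨[⟨g, [(0, false), (0, true)] :: List.replicate n []⟩]⟩, ?_, ?_, ?_, ?_, ?_, ?_, ?_⟩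
    · rw [halfEdges, hc, List.flatten_cons, List.flatten_replicate_nil, List.append_nil]
      decide
    · simp
    · simp [BdSurface.halfEdges]
      omega
    · simp
    · rintro ⟨x, hx⟩ ⟨y, hy⟩
      simp only [List.length_singleton, Nat.lt_one_iff] at hx hy
      subst hx hy
      exact Relation.EqvGen.refl _
    · have h : next (⟨[⟨g, [(0, false), (0, true)] :: List.replicate n []⟩]⟩ : RibbonGraph 1) =
          flip := by
        rw [next, hc, flip_eq_swap]
        simp [List.formPerm_pair]
      rw [faces, h, hc, flip_eq_swap, Equiv.swap_mul_self, card_sameCycle_one]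
      simp [List.count_cons, List.count_replicate]
      omega
    · simp
      ring

end RibbonGraph

namespace DGFrobenius.Hodge

variable {A : Type*} [NonUnitalRing A] [Module ℝ A] {F : DGFrobenius A} [FiniteDimensional ℝ A]
  [IsScalarTower ℝ A A] [SMulCommClass ℝ A A] (D : F.Hodge)

theorem isCochain_dualCochain (g n : ℕ) : D.dualCochain.IsCochain g n :=
  fun _ _ _ _ hγ h => contractEdges_iso (fun _ _ hxy => D.coeff_propagator_of_ne hxy)
    D.coeff_propagator_comm hγ.once h

theorem isCocycle_dualCochain (hp : ∀ a, D.p a = 0) (g n : ℕ) : D.dualCochain.IsCocycle g n := by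
  refine ⟨D.isCochain_dualCochain g n, fun m γ hγ => ?_⟩
  rw [LCochain.coboundary, D.sum_contract_eq_zero hp hγ.once hγ.stable]
  simp [dualCochain]

theorem isCostello_dualCochain (hp : ∀ a, D.p a = 0) (g n : ℕ) :
    D.IsCostello g n D.dualCochain := by
  refine ⟨D.isCochain_dualCochain g n, fun k w γ _ => ?_⟩
  cases w with
  | zero =>
    rw [D.costelloIntegral_zero]
    rfl
  | succ w =>
    rw [D.costelloIntegral_succ hp]
    exact ite_self 0

/-- Graphs without white edges determine the values on cells; the value at infinity is read off from
a graph with no black and one white edge, whose integral vanishes. -/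
theorem IsCostello.agree {D : F.Hodge} (hp : ∀ a, D.p a = 0) {g n : ℕ} (hn : 1 ≤ n)
    (hgn : 2 < 2 * g + n) {c : LCochain} (hc : D.IsCostello g n c) :
    LCochain.Agree g n c D.dualCochain := by
  refine ⟨fun m γ hγ => ?_, ?_⟩
  · exact (hc.2 m 0 γ hγ).trans (D.costelloIntegral_zero (k := m) γ)
  obtain ⟨γ, hγ⟩ : ∃ γ : RibbonGraph (0 + 1), γ.HasType g n :=
    RibbonGraph.exists_hasType_one hn hgn
  exact (hc.2 0 1 γ hγ).trans (D.costelloIntegral_succ hp γ)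

end DGFrobenius.Hodge

end

theorem mainTheorem3 {A : Type*} [NonUnitalRing A] [Module ℝ A] [IsScalarTower ℝ A A]
    [SMulCommClass ℝ A A] [FiniteDimensional ℝ A] (F : DGFrobenius A) (D : F.Hodge) :
    (∀ φ : TensorProduct ℝ A A →ₗ[ℝ] ℝ,
      MeasureTheory.IntegrableOn (fun t : ℝ => φ (D.sKernel t)) (Set.Ioi 0) ∧
        ∫ t in Set.Ioi (0 : ℝ), φ (D.sKernel t) = φ D.propagator) ∧
    (F.Contractible → ∀ g n : ℕ, 1 ≤ n → 2 < 2 * g + n →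
      (∀ (k w : ℕ) (γ : RibbonGraph (k + w)), γ.HasType g n →
        MeasureTheory.IntegrableOn
          (fun t : Fin k → ℝ => DGFrobenius.Hodge.topCoeff k (D.costelloForm γ t))
          (Set.Ici 0)) ∧
      D.dualCochain.IsCocycle g n ∧
      D.IsCostello g n D.dualCochain ∧
      ∀ c : LCochain, D.IsCostello g n c → LCochain.Agree g n c D.dualCochain) := by
  refine ⟨fun φ => ⟨D.integrableOn_sKernel φ, D.integral_sKernel φ⟩, fun h g n hn hgn => ?_⟩
  have hp := D.p_eq_zero h
  exact ⟨fun k w γ _ => D.integrableOn_costelloForm hp γ, D.isCocycle_dualCochain hp g n,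
    D.isCostello_dualCochain hp g n, fun c hc => hc.agree hp hn hgn⟩
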